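/- **Setting.** Write $L^2=L^2(\mathbb R^n)$ (real valued). *Potential.* $\mathcal W:L^2\to[0,\infty]$ is weakly lower semicontinuous; its domain $\mathrm W=\{v\in L^2:\mathcal W(v)<\infty\}$ is a Banach space with dense (continuous) embeddings $C_0^\infty\hookrightarrow \mathrm W\hookrightarrow L^2$; $\mathcal W$ is Gâteaux differentiable on $\mathrm W$, and $\|\nabla\mathcal W(v)\|_{\mathrm W'}\le C(1+\mathcal W(v)^\theta)$ for all $v\in\mathrm W$, for some $C\ge0$, $\theta\in(0,1)$. *Dissipation.* $\mathcal G:L^2\to[0,\infty]$ is given by $\mathcal G(v)=\frac12a(v,v)$ for $v\in\mathrm G$ and $\mathcal G(v)=+\infty$ for $v\in L^2\setminus\mathrm G$, where $a$ is a symmetric, nonnegative, bounded bilinear form on a Hilbert space $\mathrm G$ with norm $\|v\|_{\mathrm G}^2=\|v\|_{L^2}^2+2\mathcal G(v)$ and dense (continuous) embeddings $C_0^\infty\hookrightarrow \mathrm G\hookrightarrow L^2$. *Data.* $w_0\in\mathrm W$, $w_1\in\mathrm W\cap\mathrm G$, $f\in L^2_{loc}([0,\infty);L^2)$, and $\gamma(t)=\int_0^t\|f(s)\|_{L^2}^2\,ds$.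 For each $\varepsilon\in(0,1)$ let $t_\varepsilon>0$, with $\lim_{\varepsilon\downarrow0}t_\varepsilon=0$, and let $\phi=\phi_\varepsilon:[0,\infty)\to L^2$ be (strongly) measurable with - $\phi(t)=0$ for all $t>T^*$, for some $T^*\in(0,\varepsilon^{-3/2}]$; - $\int_0^\infty e^{-t}\|\phi(t)\|_{L^2}^2\,dt\le\varepsilon^2$; - $\varepsilon\int_0^t\int_s^\infty e^{-(\tau-s)}(\tau-s)\|\phi(\tau)\|_{L^2}^2\,d\tau\,ds\le\gamma(\varepsilon t+t_\varepsilon)+\varepsilon^2$ for all $t\ge0$. *Minimizers.* For each $\varepsilon\in(0,1)$ let $u_\varepsilon$ be a minimizer of $$J_\varepsilon(u)=\int_0^\infty e^{-t}\Big(\tfrac1{2\varepsilon^2}\|u''(t)\|_{L^2}^2+\mathcal W(u(t))\Big)dt+\tfrac1\varepsilon\int_0^\infty e^{-t}\,\mathcal G(u'(t))\,dt-\int_0^\infty e^{-t}(\phi_\varepsilon(t),u(t))_{L^2}\,dt$$ among all $u\in H^2_{loc}([0,\infty);L^2)$ with $u(0)=w_0$ and $u'(0)=\varepsilon w_1$ (take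 the $C^1$ representatives). *Energies.* Put $\mathcal G_\varepsilon(t)=\mathcal G(u_\varepsilon'(t))$ and, for $t\ge0$, $$E_\varepsilon(t)=\tfrac1{2\varepsilon^2}\|u_\varepsilon'(t)\|_{L^2}^2+\int_t^\infty e^{-(s-t)}(s-t)\,\mathcal W(u_\varepsilon(s))\,ds,$$ $$E^d_\varepsilon(t)=E_\varepsilon(t)+\tfrac1\varepsilon\int_0^t\int_s^\infty e^{-(\tau-s)}(1+\tau-s)\,\mathcal G_\varepsilon(\tau)\,d\tau\,ds,$$ $$\Lambda_\varepsilon=E^d_\varepsilon(0)+\tfrac1\varepsilon\Big(\int_0^\infty e^{-s}s\,\mathcal G_\varepsilon(s)\,ds+2\int_0^\infty e^{-s}\,\mathcal G_\varepsilon(s)\,ds\Big).$$ **Statement.** (1) For every $\beta>1$ there is a constant $C_\beta>0$, depending only on $\beta$, such that in every setting as above, for all $T\ge0$ and all $\varepsilon\in(0,1)$, the quantities $E^d_\varepsilon(T/\varepsilon)$, $\Lambda_\varepsilon$ and $E_\varepsilon(T/\varepsilon)+\frac2\varepsilon\int_0^{T/\varepsilon}\mathcal G_\varepsilon\,dt$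 are finite, $$\sqrt{E^d_\varepsilon(T/\varepsilon)}\le\sqrt{E^d_\varepsilon(0)}+\Big(\sqrt{\varepsilon C_\beta}+\sqrt{T\beta/2}\Big)\sqrt{\gamma(T+t_\varepsilon)+\varepsilon^2},$$ and $$E_\varepsilon(T/\varepsilon)+\frac2\varepsilon\int_0^{T/\varepsilon}\mathcal G_\varepsilon(t)\,dt\le\Big(\sqrt{\Lambda_\varepsilon}+\Big(\sqrt{\varepsilon C_\beta}+\sqrt{T\beta/2}\Big)\sqrt{\gamma(T+t_\varepsilon)+\varepsilon^2}\Big)^2.$$ (2) In every such setting, for every $T\ge0$ there is a constant $C_T$ such that, for all $\varepsilon\in(0,1)$ and all $t\in[0,T]$, $$E^d_\varepsilon(t/\varepsilon)\le C_T\qquad\text{and}\qquad E_\varepsilon(t/\varepsilon)+\frac2\varepsilon\int_0^{t/\varepsilon}\mathcal G_\varepsilon(s)\,ds\le C_T.$$ -/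

import Mathlib

open MeasureTheory Set Filter Topology
open scoped ENNReal ContDiff

namespace DeGiorgi

/-- The real Hilbert space `L² = L²(ℝⁿ)`. -/
abbrev L2 (n : ℕ) : Type :=
  Lp ℝ 2 (volume : Measure (EuclideanSpace ℝ (Fin n)))

/-- `v` is (the class of) a test function in `C₀^∞(ℝⁿ)`. -/
def IsTestClass {n : ℕ} (v : L2 n) : Prop :=
  ∃ g : EuclideanSpace ℝ (Fin n) → ℝ, ContDiff ℝ ∞ g ∧ HasCompactSupport g ∧ v =ᵐ[volume] g

/-- Weak (sequential) lower semicontinuity of a functional on `L²`. -/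
def WeaklyLSC {n : ℕ} (F : L2 n → ℝ≥0∞) : Prop :=
  ∀ (x : ℕ → L2 n) (y : L2 n),
    (∀ z : L2 n, Tendsto (fun k => inner ℝ z (x k)) atTop (𝓝 (inner ℝ z y))) →
      F y ≤ liminf (fun k => F (x k)) atTop

/-- Via the inclusion `j`, the Banach space `X` is a subspace of `L²` with
`C₀^∞ ↪ X ↪ L²`, both embeddings being dense.
(Continuity of `X ↪ L²` is contained in the type of `j`; that of `C₀^∞ ↪ X` is then automatic by
the closed graph theorem.) -/
structure IsDenselyEmbedded {n : ℕ} {X : Type} [NormedAddCommGroup X] [NormedSpace ℝ X]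
    (j : X →L[ℝ] L2 n) : Prop where
  injective : Function.Injective j
  test_mem : ∀ v : L2 n, IsTestClass v → v ∈ range j
  dense_test : Dense {x : X | IsTestClass (j x)}
  dense_range : DenseRange j

/-- The assumption on the potential `𝒲 : L² → [0,∞]`: it is weakly lower semicontinuous, its
domain `{𝒲 < ∞}` is a Banach space `X` with `C₀^∞ ↪ X ↪ L²` densely, it is Gâteaux differentiable
on `X`, with derivative `dW : X → X'`, and `‖dW v‖ ≤ C (1 + 𝒲(v)^θ)` for some `C ≥ 0` and
`θ ∈ (0,1)`. -/
def IsPotential {n : ℕ} (W : L2 n → ℝ≥0∞) : Prop :=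
  WeaklyLSC W ∧
  ∃ (X : Type) (_ : NormedAddCommGroup X) (_ : NormedSpace ℝ X) (_ : CompleteSpace X)
    (j : X →L[ℝ] L2 n),
    IsDenselyEmbedded j ∧
    range j = {v : L2 n | W v < ⊤} ∧
    ∃ dW : X → (X →L[ℝ] ℝ),
      (∀ v h : X, HasLineDerivAt ℝ (fun x : X => (W (j x)).toReal) (dW v h) v h) ∧
      ∃ C θ : ℝ, 0 ≤ C ∧ 0 < θ ∧ θ < 1 ∧
        ∀ v : X, ‖dW v‖ ≤ C * (1 + (W (j v)).toReal ^ θ)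

/-- The assumption on the dissipation `𝒢 : L² → [0,∞]`: there are a Hilbert space `Y` with
`C₀^∞ ↪ Y ↪ L²` densely and a symmetric, nonnegative, bounded bilinear form `a` on `Y` such that
`𝒢(v) = a(v,v)/2` on `Y`, `𝒢 = ∞` off `Y`, and `‖v‖_Y² = ‖v‖_{L²}² + 2 𝒢(v)` on `Y`. -/
def IsDissipation {n : ℕ} (G : L2 n → ℝ≥0∞) : Prop :=
  ∃ (Y : Type) (_ : NormedAddCommGroup Y) (_ : InnerProductSpace ℝ Y) (_ : CompleteSpace Y)
    (k : Y →L[ℝ] L2 n) (a : Y →L[ℝ] Y →L[ℝ] ℝ),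
    IsDenselyEmbedded k ∧
    (∀ x y : Y, a x y = a y x) ∧
    (∀ x : Y, 0 ≤ a x x) ∧
    (∀ x : Y, G (k x) = ENNReal.ofReal (a x x / 2)) ∧
    (∀ v : L2 n, v ∉ range k → G v = ⊤) ∧
    (∀ x : Y, ‖x‖ ^ 2 = ‖k x‖ ^ 2 + a x x)

/-- `f ∈ L²_loc([0,∞); L²)`. -/
def MemL2loc {H : Type} [NormedAddCommGroup H] (f : ℝ → H) : Prop :=
  ∀ T : ℝ, MemLp f 2 (volume.restrict (Ioc 0 T))

/-- An element of `H²_loc([0,∞); H)`: the `C¹` representative `u = toFun`, its derivative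
`u' = d1`, which is locally absolutely continuous, and the weak derivative
`u'' = d2 ∈ L²_loc([0,∞); H)` of `u'`. Values at negative times are irrelevant. -/
structure H2loc (H : Type) [NormedAddCommGroup H] [NormedSpace ℝ H] where
  toFun : ℝ → H
  d1 : ℝ → H
  d2 : ℝ → H
  memL2loc_d2 : MemL2loc d2
  d1_eq : ∀ t : ℝ, 0 ≤ t → d1 t = d1 0 + ∫ s in (0 : ℝ)..t, d2 s
  toFun_eq : ∀ t : ℝ, 0 ≤ t → toFun t = toFun 0 + ∫ s in (0 : ℝ)..t, d1 s

/-- The average operator `𝒜h(t) = ∫_t^∞ e^{-(s-t)} h(s) ds`. -/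
noncomputable def avg (h : ℝ → ℝ≥0∞) (t : ℝ) : ℝ≥0∞ :=
  ∫⁻ s in Ioi t, ENNReal.ofReal (Real.exp (-(s - t))) * h s

/-- The operator `𝒜²h(t) = ∫_t^∞ e^{-(s-t)} (s-t) h(s) ds`. -/
noncomputable def avg2 (h : ℝ → ℝ≥0∞) (t : ℝ) : ℝ≥0∞ :=
  ∫⁻ s in Ioi t, ENNReal.ofReal (Real.exp (-(s - t)) * (s - t)) * h s

/-- `H_ε(u) + Δ_ε(u)`, the nonnegative part of the functional:
`∫₀^∞ e^{-t} ( ‖u''‖²/(2ε²) + 𝒲(u) ) dt + (1/ε) ∫₀^∞ e^{-t} 𝒢(u') dt`. -/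
noncomputable def posPart {n : ℕ} (W G : L2 n → ℝ≥0∞) (ε : ℝ) (u : H2loc (L2 n)) : ℝ≥0∞ :=
  (∫⁻ t in Ioi (0 : ℝ), ENNReal.ofReal (Real.exp (-t)) *
      (ENNReal.ofReal (1 / (2 * ε ^ 2) * ‖u.d2 t‖ ^ 2) + W (u.toFun t)))
  + ENNReal.ofReal (1 / ε) *
      ∫⁻ t in Ioi (0 : ℝ), ENNReal.ofReal (Real.exp (-t)) * G (u.d1 t)

/-- `S(u) = ∫₀^∞ e^{-t} (φ(t), u(t))_{L²} dt`. -/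
noncomputable def source {n : ℕ} (φ : ℝ → L2 n) (u : H2loc (L2 n)) : ℝ :=
  ∫ t in Ioi (0 : ℝ), Real.exp (-t) * inner ℝ (φ t) (u.toFun t)

/-- The functional `J_ε = H_ε + Δ_ε - S`, with values in `(-∞, ∞]`. -/
noncomputable def J {n : ℕ} (W G : L2 n → ℝ≥0∞) (φ : ℝ → L2 n) (ε : ℝ) (u : H2loc (L2 n)) :
    EReal :=
  ((posPart W G ε u : ℝ≥0∞) : EReal) - ((source φ u : ℝ) : EReal)

/-- The boundary conditions `u(0) = w₀`, `u'(0) = ε w₁`. -/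
def HasInitialData {n : ℕ} (ε : ℝ) (w₀ w₁ : L2 n) (u : H2loc (L2 n)) : Prop :=
  u.toFun 0 = w₀ ∧ u.d1 0 = ε • w₁

/-- `u` minimizes `J_ε` among the functions in `H²_loc([0,∞); L²)` with the given initial data. -/
def IsMinimizer {n : ℕ} (W G : L2 n → ℝ≥0∞) (w₀ w₁ : L2 n) (φ : ℝ → L2 n) (ε : ℝ)
    (u : H2loc (L2 n)) : Prop :=
  HasInitialData ε w₀ w₁ u ∧
    ∀ v : H2loc (L2 n), HasInitialData ε w₀ w₁ v → J W G φ ε u ≤ J W G φ ε v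

/-- `γ(t) = ∫₀^t ‖f(s)‖² ds`. -/
noncomputable def gam {n : ℕ} (f : ℝ → L2 n) (t : ℝ) : ℝ :=
  ∫ s in (0 : ℝ)..t, ‖f s‖ ^ 2

/-- The standing assumptions, for fixed `ε`, on the source `φ` in `J_ε`. -/
structure IsSource {n : ℕ} (f : ℝ → L2 n) (ε tε : ℝ) (φ : ℝ → L2 n) : Prop where
  meas : AEStronglyMeasurable φ (volume.restrict (Ioi 0))
  /-- `φ` vanishes after some time `T* ∈ (0, ε^{-3/2}]`. -/
  supp : ∃ Tstar : ℝ, 0 < Tstar ∧ Tstar ≤ ε ^ (-(3 / 2) : ℝ) ∧ ∀ t : ℝ, Tstar < t → φ t = 0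
  /-- `∫₀^∞ e^{-t} ‖φ(t)‖² dt ≤ ε²`. -/
  norm_le : ∫⁻ t in Ioi (0 : ℝ), ENNReal.ofReal (Real.exp (-t) * ‖φ t‖ ^ 2)
    ≤ ENNReal.ofReal (ε ^ 2)
  /-- `ε ∫₀^t 𝒜²‖φ‖² ds ≤ γ(εt + t_ε) + ε²`. -/
  avg_le : ∀ t : ℝ, 0 ≤ t →
    ENNReal.ofReal ε * ∫⁻ s in Ioc 0 t, avg2 (fun τ => ENNReal.ofReal (‖φ τ‖ ^ 2)) s
      ≤ ENNReal.ofReal (gam f (ε * t + tε) + ε ^ 2)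

/-- The setting: `𝒲`, `𝒢` as above, `w₀ ∈ {𝒲 < ∞}`, `w₁ ∈ {𝒲 < ∞} ∩ {𝒢 < ∞}`,
`f ∈ L²_loc([0,∞); L²)`, shifts `t_ε > 0` with `t_ε → 0` as `ε ↓ 0` and, for each `ε ∈ (0,1)`, an
admissible source `φ ε` and a minimizer `u ε` of the functional `J_ε` with this source. -/
structure IsMinimizerFamily {n : ℕ} (W G : L2 n → ℝ≥0∞) (w₀ w₁ : L2 n) (f : ℝ → L2 n)
    (tε : ℝ → ℝ) (φ : ℝ → ℝ → L2 n) (u : ℝ → H2loc (L2 n)) : Prop where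
  potential : IsPotential W
  dissipation : IsDissipation G
  w₀_mem : W w₀ < ⊤
  w₁_mem_W : W w₁ < ⊤
  w₁_mem_G : G w₁ < ⊤
  f_mem : MemL2loc f
  shift_pos : ∀ ε ∈ Ioo (0 : ℝ) 1, 0 < tε ε
  shift_tendsto : Tendsto tε (𝓝[>] 0) (𝓝 0)
  isSource : ∀ ε ∈ Ioo (0 : ℝ) 1, IsSource f ε (tε ε) (φ ε)
  isMinimizer : ∀ ε ∈ Ioo (0 : ℝ) 1, IsMinimizer W G w₀ w₁ (φ ε) ε (u ε)

/-- The approximate energy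
`E_ε(t) = ‖u'(t)‖²/(2ε²) + ∫_t^∞ e^{-(s-t)} (s-t) 𝒲(u(s)) ds`. -/
noncomputable def energy {n : ℕ} (W : L2 n → ℝ≥0∞) (ε : ℝ) (u : H2loc (L2 n)) (t : ℝ) : ℝ≥0∞ :=
  ENNReal.ofReal (1 / (2 * ε ^ 2) * ‖u.d1 t‖ ^ 2) + avg2 (fun s => W (u.toFun s)) t

/-- The dissipative approximate energy
`E_ε^d(t) = E_ε(t) + (1/ε) ∫₀^t ∫_s^∞ e^{-(τ-s)} (1+τ-s) 𝒢(u'(τ)) dτ ds`. -/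
noncomputable def energyD {n : ℕ} (W G : L2 n → ℝ≥0∞) (ε : ℝ) (u : H2loc (L2 n)) (t : ℝ) :
    ℝ≥0∞ :=
  energy W ε u t + ENNReal.ofReal (1 / ε) *
    ∫⁻ s in Ioc 0 t, ∫⁻ τ in Ioi s,
      ENNReal.ofReal (Real.exp (-(τ - s)) * (1 + τ - s)) * G (u.d1 τ)

/-- `Λ_ε = E_ε^d(0) + (1/ε) ( 𝒜²𝒢_ε(0) + 2 𝒜𝒢_ε(0) )`, where `𝒢_ε(t) = 𝒢(u'(t))`. -/
noncomputable def Lam {n : ℕ} (W G : L2 n → ℝ≥0∞) (ε : ℝ) (u : H2loc (L2 n)) : ℝ≥0∞ :=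
  energyD W G ε u 0 + ENNReal.ofReal (1 / ε) *
    (avg2 (fun t => G (u.d1 t)) 0 + 2 * avg (fun t => G (u.d1 t)) 0)

/-- `E_ε(t) + (2/ε) ∫₀^t 𝒢(u'(s)) ds`. -/
noncomputable def energyC {n : ℕ} (W G : L2 n → ℝ≥0∞) (ε : ℝ) (u : H2loc (L2 n)) (t : ℝ) :
    ℝ≥0∞ :=
  energy W ε u t + ENNReal.ofReal (2 / ε) * ∫⁻ s in Ioc 0 t, G (u.d1 s)

end DeGiorgi

/-! The estimates come from inner variations. Write `g = kerTwo T`; then `g' = kerOne T`, and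
`e^{-y} g''(y)` is the indicator of `(0,T)` on the positive half-line. The minimizer `u` is compared
with the slowed curve `u ∘ (id + δ g)⁻¹`, `δ > 0`. The initial data are kept because `g` and `g'`
vanish at `0`. Slowing down changes the densities by bounded factors, so the energy stays finite;
speeding up would multiply the weight `e^{-y}` by a growing exponential. Hence only one sign of `δ`
is used, and an inequality is all that is needed. Letting `δ → 0` in the minimality gives
`energy_inequality`, in which all integrals are over `(0,∞)`:

`‖u'(T)‖²/(2ε²) + ∫ e^{-y} g 𝒲 + ∫ e^{-y} (g + g') (𝒢/ε + ‖u''‖²/(2ε²)) ≤ ‖u'(0)‖²/(2ε²) + ∫ e^{-y}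
g' 𝒲 + ∫ e^{-y} g ‖φ‖ ‖u'‖`.

The kinetic terms at `0` and `T` come from `g''`, which integrates `⟨u'',u'⟩` over `(0,T)`. The
integrals on the left carry weights of order `y e^{-y}` and are not known to be finite beforehand,
so Fatou's lemma is used for them. By Tonelli, `e^{-y} g'` and `e^{-y} g` are the kernels of `∫₀^T
𝒜` and `∫₀^T 𝒜²`, and `kerTwo_add_self` turns the potential terms into `𝒜²𝒲` at `T` and at `0`. Thus
`E^d(T)` plus a weighted acceleration term is at most `E^d(0) + ∫₀^T 𝒜²(‖φ‖‖u'‖)`.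

Inside `𝒜²` at time `s`, replacing `u'(τ)` by `u'(s)` costs `∫_s^τ ‖u''‖`. Hardy's inequalities for
`𝒜` and `𝒜²` bound this error by exactly the acceleration term on the left, up to `4ε² ∫ 𝒜²‖φ‖²`.
Since `‖u'‖ ≤ √2 ε √(E^d)`, a quadratic Gronwall lemma and Cauchy–Schwarz in time give the first
estimate, with `C_β = 4` for every `β`. The second follows because `E + (2/ε)∫𝒢 ≤ E^d + (Λ -
E^d(0))`, and adding a constant to the energy does not disturb the Gronwall argument.

Finiteness and uniformity in `ε` rest on a level estimate. The affine curve `w₀ + tεw₁` has bounded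
energy, because `θ < 1` forces `𝒲` to grow at most like `e^{s/2}` along lines; by Hardy again, half
of the functional absorbs the source. The energy inequality at `T = 1` then bounds `Λ`. -/

namespace DeGiorgi

/-! ### Integration by parts for primitives of integrable functions -/

section ProductRule
variable {E F G : Type*} [NormedAddCommGroup E] [NormedSpace ℝ E]
  [NormedAddCommGroup F] [NormedSpace ℝ F] [NormedAddCommGroup G] [NormedSpace ℝ G]

theorem primitive_eq_integral_indicator (k : ℝ → E) {s t : ℝ} (hs : s ∈ Ioc 0 t) :
    (∫ r in (0 : ℝ)..s, k r) = ∫ r in Ioc 0 t, (Iic s).indicator k r := by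
  rw [intervalIntegral.integral_of_le hs.1.le, integral_indicator measurableSet_Iic,
    Measure.restrict_restrict measurableSet_Iic]
  congr 2
  ext r
  simp only [mem_Ioc, mem_inter_iff, mem_Iic]
  constructor
  · rintro ⟨h1, h2⟩; exact ⟨h2, h1, h2.trans hs.2⟩
  · rintro ⟨h1, h2, _⟩; exact ⟨h2, h1⟩

theorem continuousOn_primitive_uIcc {k : ℝ → E} {t : ℝ} (hk : IntervalIntegrable k volume 0 t) :
    ContinuousOn (fun s => ∫ r in (0 : ℝ)..s, k r) (uIcc 0 t) :=
  intervalIntegral.continuousOn_primitive_interval ((intervalIntegrable_iff' (by simp)).1 hk)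

theorem intervalIntegrable_bilin (b : E →L[ℝ] F →L[ℝ] G) {p : ℝ → E} {q : ℝ → F} {t : ℝ}
    (hp : IntervalIntegrable p volume 0 t) (hq : ContinuousOn q (uIcc 0 t)) :
    IntervalIntegrable (fun s => b (p s) (q s)) volume 0 t := by
  obtain ⟨C, hC⟩ := isCompact_uIcc.exists_bound_of_continuousOn hq
  rw [intervalIntegrable_iff] at hp ⊢
  have hqm : AEStronglyMeasurable q (volume.restrict (uIoc 0 t)) :=
    (hq.mono uIoc_subset_uIcc).aestronglyMeasurable measurableSet_uIoc
  refine Integrable.mono' (hp.norm.const_mul (‖b‖ * C)) (b.aestronglyMeasurable_comp₂ hp.1 hqm) ?_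
  filter_upwards [ae_restrict_mem measurableSet_uIoc] with s hs
  have h0 := hC s (uIoc_subset_uIcc hs)
  calc ‖b (p s) (q s)‖ ≤ ‖b‖ * ‖p s‖ * ‖q s‖ := b.le_opNorm₂ _ _
    _ ≤ ‖b‖ * ‖p s‖ * C := by gcongr
    _ = _ := by ring

/-- The two terms on the left are the integrals of `B (f x) (g y)` over the two triangles into which
the diagonal, a null set, divides the square `(0,t]²`. -/
theorem integral_bilin_primitive [CompleteSpace E] [CompleteSpace F] [CompleteSpace G]
    (B : E →L[ℝ] F →L[ℝ] G) {f : ℝ → E} {g : ℝ → F} {t : ℝ}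
    (ht : 0 ≤ t) (hf : IntervalIntegrable f volume 0 t) (hg : IntervalIntegrable g volume 0 t) :
    (∫ s in (0 : ℝ)..t, B (f s) (∫ r in (0 : ℝ)..s, g r)) +
      ∫ s in (0 : ℝ)..t, B (∫ r in (0 : ℝ)..s, f r) (g s) =
    B (∫ s in (0 : ℝ)..t, f s) (∫ s in (0 : ℝ)..t, g s) := by
  rw [intervalIntegrable_iff_integrableOn_Ioc_of_le ht] at hf hg
  set μ : Measure ℝ := volume.restrict (Ioc 0 t) with hμ
  have hΦ : Integrable (fun z : ℝ × ℝ => B (f z.1) (g z.2)) (μ.prod μ) :=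
    hf.op_fst_snd (by fun_prop) ⟨‖B‖, B.le_opNorm₂⟩ hg
  have hS : MeasurableSet {z : ℝ × ℝ | z.2 ≤ z.1} := measurableSet_le measurable_snd measurable_fst
  have h1 : (∫ s in (0 : ℝ)..t, B (f s) (∫ r in (0 : ℝ)..s, g r)) =
      ∫ z in {z : ℝ × ℝ | z.2 ≤ z.1}, B (f z.1) (g z.2) ∂(μ.prod μ) := by
    rw [← integral_indicator hS, integral_prod _ (hΦ.indicator hS),
      intervalIntegral.integral_of_le ht]
    refine setIntegral_congr_fun measurableSet_Ioc fun s hs => ?_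
    rw [primitive_eq_integral_indicator _ hs, ← ContinuousLinearMap.integral_comp_comm _ (hg.indicator measurableSet_Iic)]
    refine integral_congr_ae (Eventually.of_forall fun r => ?_)
    by_cases hr : r ≤ s <;> simp [indicator, hr]
  have h2 : (∫ s in (0 : ℝ)..t, B (∫ r in (0 : ℝ)..s, f r) (g s)) =
      ∫ z in {z : ℝ × ℝ | z.2 ≤ z.1}ᶜ, B (f z.1) (g z.2) ∂(μ.prod μ) := by
    rw [← integral_indicator hS.compl, integral_prod_symm _ (hΦ.indicator hS.compl),
      intervalIntegral.integral_of_le ht]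
    refine setIntegral_congr_fun measurableSet_Ioc fun s hs => ?_
    have : (∫ r in (0 : ℝ)..s, f r) = ∫ r, (Iio s).indicator f r ∂μ := by
      rw [primitive_eq_integral_indicator _ hs]
      refine integral_congr_ae ?_
      have : ∀ᵐ r ∂μ, r ≠ s := by
        rw [ae_iff]; simp [hμ]
      filter_upwards [this] with r hr
      simp [indicator, lt_iff_le_and_ne, hr]
    rw [this]
    have e := ContinuousLinearMap.integral_comp_comm (B.flip (g s))
      (hf.indicator (measurableSet_Iio (a := s)))
    simp only [ContinuousLinearMap.flip_apply] at e
    rw [← e]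
    refine integral_congr_ae (Eventually.of_forall fun r => ?_)
    by_cases hr : r < s
    · simp [indicator, hr]
    · simp [indicator, hr, not_lt.1 hr]
  rw [h1, h2, integral_add_compl hS hΦ, intervalIntegral.integral_of_le ht,
    intervalIntegral.integral_of_le ht]
  exact integral_prod_bilin B hf hg

/-- A product rule that requires no pointwise differentiability. It is used for scalar
multiplication (the competitor), the inner product (the kinetic energy) and real multiplication (the
Gronwall lemma). -/
theorem bilin_sub_eq_integral [CompleteSpace E] [CompleteSpace F] [CompleteSpace G]
    (B : E →L[ℝ] F →L[ℝ] G) {f f' : ℝ → E} {g g' : ℝ → F} {t : ℝ}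
    (ht : 0 ≤ t) (hf' : IntervalIntegrable f' volume 0 t) (hg' : IntervalIntegrable g' volume 0 t)
    (hf : ∀ s ∈ Icc 0 t, f s = f 0 + ∫ r in (0 : ℝ)..s, f' r)
    (hg : ∀ s ∈ Icc 0 t, g s = g 0 + ∫ r in (0 : ℝ)..s, g' r) :
    IntervalIntegrable (fun s => B (f' s) (g s)) volume 0 t ∧
    IntervalIntegrable (fun s => B (f s) (g' s)) volume 0 t ∧
    B (f t) (g t) = B (f 0) (g 0) + ∫ s in (0 : ℝ)..t, (B (f' s) (g s) + B (f s) (g' s)) := by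
  have hfc : ContinuousOn f (uIcc 0 t) :=
    ((continuousOn_primitive_uIcc hf').const_add (f 0)).congr fun s hs => hf s (by rwa [uIcc_of_le ht] at hs)
  have hgc : ContinuousOn g (uIcc 0 t) :=
    ((continuousOn_primitive_uIcc hg').const_add (g 0)).congr fun s hs => hg s (by rwa [uIcc_of_le ht] at hs)
  have i1 := intervalIntegrable_bilin B hf' hgc
  have i2 : IntervalIntegrable (fun s => B (f s) (g' s)) volume 0 t := intervalIntegrable_bilin B.flip hg' hfc
  refine ⟨i1, i2, ?_⟩
  have i3 := intervalIntegrable_bilin B hf' (continuousOn_primitive_uIcc hg')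
  have i4 : IntervalIntegrable (fun s => B (∫ r in (0 : ℝ)..s, f' r) (g' s)) volume 0 t :=
    intervalIntegrable_bilin B.flip hg' (continuousOn_primitive_uIcc hf')
  have i5 : IntervalIntegrable (fun s => B (f' s) (g 0)) volume 0 t :=
    intervalIntegrable_bilin B hf' continuousOn_const
  have i6 : IntervalIntegrable (fun s => B (f 0) (g' s)) volume 0 t :=
    intervalIntegrable_bilin B.flip hg' continuousOn_const
  have e1 : (∫ s in (0 : ℝ)..t, B (f' s) (g s)) =
      B (∫ s in (0 : ℝ)..t, f' s) (g 0) +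
        ∫ s in (0 : ℝ)..t, B (f' s) (∫ r in (0 : ℝ)..s, g' r) := by
    have e := ContinuousLinearMap.intervalIntegral_comp_comm (B.flip (g 0)) hf'
    simp only [ContinuousLinearMap.flip_apply] at e
    rw [← e, ← intervalIntegral.integral_add i5 i3]
    refine intervalIntegral.integral_congr fun s hs => ?_
    rw [uIcc_of_le ht] at hs
    rw [hg s hs, map_add]
  have e2 : (∫ s in (0 : ℝ)..t, B (f s) (g' s)) =
      B (f 0) (∫ s in (0 : ℝ)..t, g' s) +
        ∫ s in (0 : ℝ)..t, B (∫ r in (0 : ℝ)..s, f' r) (g' s) := by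
    rw [← ContinuousLinearMap.intervalIntegral_comp_comm (B (f 0)) hg',
      ← intervalIntegral.integral_add i6 i4]
    refine intervalIntegral.integral_congr fun s hs => ?_
    rw [uIcc_of_le ht] at hs
    rw [hf s hs, map_add, add_apply]
  rw [intervalIntegral.integral_add i1 i2, e1, e2, hf t ⟨ht, le_rfl⟩, hg t ⟨ht, le_rfl⟩]
  have := integral_bilin_primitive B ht hf' hg'
  simp only [map_add, add_apply]
  rw [← this]
  abel

end ProductRule
-- The kernels of the averaged operators
section Kernels

/-- `e^τ ∫₀^T 1_{s<τ} e^{-(τ-s)} ds`, the kernel of `∫₀^T 𝒜`. -/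
noncomputable def kerOne (T τ : ℝ) : ℝ := Real.exp (min (max τ 0) T) - 1

/-- `e^τ ∫₀^T 1_{s<τ} e^{-(τ-s)} (τ-s) ds`, the kernel of `∫₀^T 𝒜²`. -/
noncomputable def kerTwo (T τ : ℝ) : ℝ :=
  Real.exp (min (max τ 0) T) * (1 + τ - min (max τ 0) T) - 1 - τ

/-- The right derivative of `kerOne T` on `(0,∞)`. -/
noncomputable def kerZero (T τ : ℝ) : ℝ := if τ < T then Real.exp τ else 0

variable {T : ℝ}

theorem clamp_of_nonpos (hT : 0 ≤ T) {τ : ℝ} (h : τ ≤ 0) : min (max τ 0) T = 0 := by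
  rw [max_eq_right h, min_eq_left hT]

theorem clamp_of_mem {τ : ℝ} (h : 0 ≤ τ) (h' : τ ≤ T) : min (max τ 0) T = τ := by
  rw [max_eq_left h, min_eq_left h']

theorem clamp_of_ge (hT : 0 ≤ T) {τ : ℝ} (h : T ≤ τ) : min (max τ 0) T = T := by
  rw [max_eq_left (hT.trans h), min_eq_right h]

theorem kerOne_of_nonpos (hT : 0 ≤ T) {τ : ℝ} (h : τ ≤ 0) : kerOne T τ = 0 := by
  simp [kerOne, clamp_of_nonpos hT h]

theorem kerOne_of_mem {τ : ℝ} (h : 0 ≤ τ) (h' : τ ≤ T) : kerOne T τ = Real.exp τ - 1 := by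
  rw [kerOne, clamp_of_mem h h']

theorem kerOne_of_ge (hT : 0 ≤ T) {τ : ℝ} (h : T ≤ τ) : kerOne T τ = Real.exp T - 1 := by
  rw [kerOne, clamp_of_ge hT h]

theorem kerTwo_of_nonpos (hT : 0 ≤ T) {τ : ℝ} (h : τ ≤ 0) : kerTwo T τ = 0 := by
  simp [kerTwo, clamp_of_nonpos hT h]

theorem kerTwo_of_mem {τ : ℝ} (h : 0 ≤ τ) (h' : τ ≤ T) :
    kerTwo T τ = Real.exp τ - 1 - τ := by
  rw [kerTwo, clamp_of_mem h h']; ring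

theorem kerTwo_of_ge (hT : 0 ≤ T) {τ : ℝ} (h : T ≤ τ) :
    kerTwo T τ = Real.exp T * (1 + τ - T) - 1 - τ := by
  rw [kerTwo, clamp_of_ge hT h]

theorem continuous_kerOne : Continuous (kerOne T) := by
  unfold kerOne; fun_prop

theorem continuous_kerTwo : Continuous (kerTwo T) := by
  unfold kerTwo; fun_prop

theorem measurable_kerZero : Measurable (kerZero T) :=
  Measurable.ite measurableSet_Iio Real.measurable_exp measurable_const

theorem kerZero_nonneg (τ : ℝ) : 0 ≤ kerZero T τ := by
  unfold kerZero; split_ifs <;> positivity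

theorem kerZero_le (τ : ℝ) : kerZero T τ ≤ Real.exp T := by
  unfold kerZero; split_ifs with h
  · exact Real.exp_le_exp.2 h.le
  · positivity

theorem kerOne_nonneg (hT : 0 ≤ T) (τ : ℝ) : 0 ≤ kerOne T τ := by
  have : 0 ≤ min (max τ 0) T := le_min (le_max_right _ _) hT
  have := Real.add_one_le_exp (min (max τ 0) T)
  unfold kerOne; linarith

theorem kerOne_le (τ : ℝ) : kerOne T τ ≤ Real.exp T := by
  have : Real.exp (min (max τ 0) T) ≤ Real.exp T := Real.exp_le_exp.2 (min_le_right _ _)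
  unfold kerOne; linarith

theorem kerTwo_nonneg (hT : 0 ≤ T) (τ : ℝ) : 0 ≤ kerTwo T τ := by
  rcases le_total τ 0 with h | h
  · rw [kerTwo_of_nonpos hT h]
  rcases le_total τ T with h' | h'
  · rw [kerTwo_of_mem h h']; have := Real.add_one_le_exp τ; linarith
  · rw [kerTwo_of_ge hT h']; have := Real.add_one_le_exp T
    nlinarith [mul_nonneg hT (sub_nonneg.2 h')]

/-- After multiplication by `e^{-τ}`, the term with `max` is the kernel of `𝒜²` at `T` and `τ` that
of `𝒜²` at `0`. -/
theorem kerTwo_add_self (hT : 0 ≤ T) {τ : ℝ} (hτ : 0 ≤ τ) :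
    kerTwo T τ + τ = kerOne T τ + Real.exp T * max (τ - T) 0 := by
  rcases le_total τ T with h' | h'
  · rw [kerTwo_of_mem hτ h', kerOne_of_mem hτ h', max_eq_right (by linarith)]; ring
  · rw [kerTwo_of_ge hT h', kerOne_of_ge hT h', max_eq_left (by linarith)]; ring

theorem exp_neg_mul_kerTwo_le {τ : ℝ} (hτ : 0 ≤ τ) :
    Real.exp (-τ) * kerTwo T τ ≤ 1 := by
  unfold kerTwo
  set m := min (max τ 0) T
  have h1 : 1 + τ - m ≤ Real.exp (τ - m) := by have := Real.add_one_le_exp (τ - m); linarith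
  have h2 : Real.exp m * (1 + τ - m) ≤ Real.exp τ :=
    calc _ ≤ Real.exp m * Real.exp (τ - m) := by gcongr
      _ = _ := by rw [← Real.exp_add]; ring_nf
  calc Real.exp (-τ) * (Real.exp m * (1 + τ - m) - 1 - τ) ≤ Real.exp (-τ) * Real.exp τ := by
        gcongr; linarith
    _ = 1 := by rw [← Real.exp_add]; simp

theorem le_kerTwo_one_add_one {τ : ℝ} (hτ : 0 ≤ τ) : τ ≤ kerTwo 1 τ + 1 := by
  rcases le_total τ 1 with h' | h'
  · linarith [kerTwo_nonneg zero_le_one τ]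
  · rw [kerTwo_of_ge zero_le_one h']
    have := Real.add_one_le_exp 1
    nlinarith

/-- Only right derivatives are computed. Since `kerOne` is continuous, the fundamental theorem of
calculus makes `kerTwo` a primitive of it, and no gluing of two-sided derivatives at `0` and `T` is
needed. -/
theorem hasDerivAt_kerTwo (hT : 0 ≤ T) (τ : ℝ) : HasDerivAt (kerTwo T) (kerOne T τ) τ := by
  have hr : ∀ x, HasDerivWithinAt (kerTwo T) (kerOne T x) (Ioi x) x := by
    intro x
    rcases lt_or_ge x 0 with h | h
    · rw [kerOne_of_nonpos hT h.le]
      refine ((hasDerivAt_const x (0 : ℝ)).congr_of_eventuallyEq ?_).hasDerivWithinAt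
      filter_upwards [Iio_mem_nhds h] with y hy using kerTwo_of_nonpos hT hy.le
    rcases lt_or_ge x T with h' | h'
    · rw [kerOne_of_mem h h'.le]
      have h1 : HasDerivAt (fun y => Real.exp y - 1 - y) (Real.exp x - 1) x := by
        simpa using ((Real.hasDerivAt_exp x).sub_const 1).fun_sub (hasDerivAt_id' x)
      refine h1.hasDerivWithinAt.congr_of_eventuallyEq ?_ (kerTwo_of_mem h h'.le)
      filter_upwards [Ioo_mem_nhdsGT h'] with y hy
      exact kerTwo_of_mem (h.trans hy.1.le) hy.2.le
    · rw [kerOne_of_ge hT h']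
      have h1 : HasDerivAt (fun y => Real.exp T * (1 + y - T) - 1 - y) (Real.exp T - 1) x := by
        have := ((((hasDerivAt_id' x).const_add 1).sub_const T).const_mul (Real.exp T)).sub_const 1
          |>.fun_sub (hasDerivAt_id' x)
        simpa using this
      refine h1.hasDerivWithinAt.congr_of_eventuallyEq ?_ (kerTwo_of_ge hT h')
      filter_upwards [self_mem_nhdsWithin] with y hy
      exact kerTwo_of_ge hT (h'.trans (le_of_lt hy))
  have hint : ∀ y, ∫ s in (0 : ℝ)..y, kerOne T s = kerTwo T y - kerTwo T 0 := fun y =>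
    intervalIntegral.integral_eq_sub_of_hasDeriv_right continuous_kerTwo.continuousOn
      (fun x _ => hr x) (continuous_kerOne.intervalIntegrable _ _)
  have h2 := (continuous_kerOne (T := T)).integral_hasStrictDerivAt 0 τ
  have h3 : kerTwo T = fun y => (∫ s in (0 : ℝ)..y, kerOne T s) + kerTwo T 0 := by
    ext y; rw [hint]; ring
  rw [h3]
  exact h2.hasDerivAt.add_const _

theorem hasDerivWithinAt_kerOne (hT : 0 ≤ T) {τ : ℝ} (hτ : 0 ≤ τ) :
    HasDerivWithinAt (kerOne T) (kerZero T τ) (Ioi τ) τ := by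
  rcases lt_or_ge τ T with h' | h'
  · rw [kerZero, if_pos h']
    refine ((Real.hasDerivAt_exp τ).sub_const 1).hasDerivWithinAt.congr_of_eventuallyEq ?_
      (kerOne_of_mem hτ h'.le)
    filter_upwards [Ioo_mem_nhdsGT h'] with y hy
    exact kerOne_of_mem (hτ.trans hy.1.le) hy.2.le
  · rw [kerZero, if_neg (not_lt.2 h')]
    refine (hasDerivAt_const τ (Real.exp T - 1)).hasDerivWithinAt.congr_of_eventuallyEq ?_
      (kerOne_of_ge hT h')
    filter_upwards [self_mem_nhdsWithin] with y hy
    exact kerOne_of_ge hT (h'.trans (le_of_lt hy))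

/-- Tonelli on `{s < τ}`: a time integral of averages becomes a single integral in `τ` against an
explicit weight. -/
theorem lintegral_lintegral_Ioi_swap {k : ℝ → ℝ≥0∞} (hk : Measurable k) {h : ℝ → ℝ≥0∞}
    (hh : AEMeasurable h (volume.restrict (Ioi 0))) :
    ∫⁻ s in Ioc 0 T, ∫⁻ τ in Ioi s, k (τ - s) * h τ =
      ∫⁻ τ in Ioi 0, (∫⁻ s in Ioc 0 (min τ T), k (τ - s)) * h τ := by
  have h1 : ∀ s ∈ Ioc 0 T, ∫⁻ τ in Ioi s, k (τ - s) * h τ =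
      ∫⁻ τ in Ioi 0, (Ioi s).indicator (fun τ => k (τ - s) * h τ) τ := by
    intro s hs
    rw [lintegral_indicator measurableSet_Ioi, Measure.restrict_restrict measurableSet_Ioi,
      Ioi_inter_Ioi, sup_eq_left.2 hs.1.le]
  rw [setLIntegral_congr_fun measurableSet_Ioc h1, lintegral_lintegral_swap]
  · refine setLIntegral_congr_fun measurableSet_Ioi fun τ (hτ : 0 < τ) => ?_
    have h2 : ∀ s, (Ioi s).indicator (fun τ => k (τ - s) * h τ) τ =
        (Iio τ).indicator (fun s => k (τ - s)) s * h τ := by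
      intro s
      by_cases hs : s < τ <;> simp [indicator, hs]
    simp only [h2]
    have hm : Measurable (fun s => k (τ - s)) := hk.comp (measurable_const.sub measurable_id)
    rw [lintegral_mul_const _ (hm.indicator measurableSet_Iio),
      lintegral_indicator measurableSet_Iio, Measure.restrict_restrict measurableSet_Iio]
    congr 1
    refine setLIntegral_congr ?_
    filter_upwards [show ∀ᵐ x : ℝ, x ≠ τ by simp [ae_iff]] with x hx
    apply propext
    change x ∈ Iio τ ∩ Ioc 0 T ↔ x ∈ Ioc 0 (min τ T)
    simp only [mem_inter_iff, mem_Iio, mem_Ioc, le_min_iff, lt_iff_le_and_ne]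
    tauto
  · have hS : MeasurableSet {z : ℝ × ℝ | z.1 < z.2} :=
      measurableSet_lt measurable_fst measurable_snd
    have : (Function.uncurry fun s τ => (Ioi s).indicator (fun τ => k (τ - s) * h τ) τ) =
        {z : ℝ × ℝ | z.1 < z.2}.indicator (fun z => k (z.2 - z.1) * h z.2) := by
      ext ⟨s, τ⟩
      by_cases hs : s < τ <;> simp [indicator, hs]
    rw [this]
    refine AEMeasurable.indicator ?_ hS
    exact (hk.comp (measurable_snd.sub measurable_fst)).aemeasurable.mul hh.comp_snd

theorem setLIntegral_Ioc_ofReal_eq_sub {F f : ℝ → ℝ} {b : ℝ} (hb : 0 ≤ b) (hf : Continuous f)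
    (hF : ∀ s, HasDerivAt F (f s) s) (hpos : ∀ s ∈ Ioc 0 b, 0 ≤ f s) :
    ∫⁻ s in Ioc 0 b, ENNReal.ofReal (f s) = ENNReal.ofReal (F b - F 0) := by
  rw [← ofReal_integral_eq_lintegral_ofReal, ← intervalIntegral.integral_of_le hb,
    intervalIntegral.integral_eq_sub_of_hasDerivAt (fun s _ => hF s) (hf.intervalIntegrable _ _)]
  · exact hf.integrableOn_Ioc
  · exact (ae_restrict_iff' measurableSet_Ioc).2 (Eventually.of_forall hpos)

theorem lintegral_avg (hT : 0 ≤ T) {h : ℝ → ℝ≥0∞} (hh : AEMeasurable h (volume.restrict (Ioi 0))) :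
    ∫⁻ s in Ioc 0 T, avg h s =
      ∫⁻ τ in Ioi 0, ENNReal.ofReal (Real.exp (-τ) * kerOne T τ) * h τ := by
  have := lintegral_lintegral_Ioi_swap (T := T) (k := fun r => ENNReal.ofReal (Real.exp (-r)))
    (by fun_prop) hh
  simp only [avg]
  rw [this]
  refine setLIntegral_congr_fun measurableSet_Ioi fun τ (hτ : 0 < τ) => ?_
  congr 1
  rw [setLIntegral_Ioc_ofReal_eq_sub (F := fun s => Real.exp (-(τ - s))) (le_min hτ.le hT)
    (by fun_prop) _ (fun s _ => by positivity)]
  · congr 1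
    rw [kerOne, max_eq_left hτ.le]
    simp only [mul_sub, ← Real.exp_add]
    ring_nf
  · intro s
    have := ((hasDerivAt_id s).const_sub τ).neg.exp
    simpa using this

theorem lintegral_avg2 (hT : 0 ≤ T) {h : ℝ → ℝ≥0∞}
    (hh : AEMeasurable h (volume.restrict (Ioi 0))) :
    ∫⁻ s in Ioc 0 T, avg2 h s =
      ∫⁻ τ in Ioi 0, ENNReal.ofReal (Real.exp (-τ) * kerTwo T τ) * h τ := by
  have := lintegral_lintegral_Ioi_swap (T := T) (k := fun r => ENNReal.ofReal (Real.exp (-r) * r))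
    (by fun_prop) hh
  simp only [avg2]
  rw [this]
  refine setLIntegral_congr_fun measurableSet_Ioi fun τ (hτ : 0 < τ) => ?_
  congr 1
  rw [setLIntegral_Ioc_ofReal_eq_sub (F := fun s => Real.exp (-(τ - s)) * (1 + τ - s))
    (le_min hτ.le hT) (by fun_prop) _ (fun s hs => by
      have := hs.2.trans (min_le_left _ _)
      have : 0 ≤ τ - s := by linarith
      positivity)]
  · congr 1
    rw [kerTwo, max_eq_left hτ.le]
    simp only [mul_sub, ← mul_assoc, ← Real.exp_add]
    ring_nf
  · intro s
    have h1 : HasDerivAt (fun s => Real.exp (-(τ - s))) (Real.exp (-(τ - s))) s := by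
      simpa using ((hasDerivAt_id s).const_sub τ).neg.exp
    have h2 := h1.fun_mul ((hasDerivAt_id' s).const_sub (1 + τ))
    refine h2.congr_deriv ?_
    ring

theorem lintegral_avg_add_avg2 (hT : 0 ≤ T) {h : ℝ → ℝ≥0∞}
    (hh : AEMeasurable h (volume.restrict (Ioi 0))) :
    ∫⁻ s in Ioc 0 T, ∫⁻ τ in Ioi s, ENNReal.ofReal (Real.exp (-(τ - s)) * (1 + τ - s)) * h τ =
      ∫⁻ τ in Ioi 0, ENNReal.ofReal (Real.exp (-τ) * (kerOne T τ + kerTwo T τ)) * h τ := by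
  have := lintegral_lintegral_Ioi_swap (T := T)
    (k := fun r => ENNReal.ofReal (Real.exp (-r) * (1 + r))) (by fun_prop) hh
  simp only [add_sub_assoc]
  rw [this]
  refine setLIntegral_congr_fun measurableSet_Ioi fun τ (hτ : 0 < τ) => ?_
  congr 1
  rw [setLIntegral_Ioc_ofReal_eq_sub (F := fun s => Real.exp (-(τ - s)) * (2 + τ - s))
    (le_min hτ.le hT) (by fun_prop) _ (fun s hs => by
      have := hs.2.trans (min_le_left _ _)
      have : 0 ≤ τ - s := by linarith
      positivity)]
  · congr 1
    rw [kerTwo, kerOne, max_eq_left hτ.le]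
    simp only [mul_sub, mul_add, ← mul_assoc, ← Real.exp_add]
    ring_nf
  · intro s
    have h1 : HasDerivAt (fun s => Real.exp (-(τ - s))) (Real.exp (-(τ - s))) s := by
      simpa using ((hasDerivAt_id s).const_sub τ).neg.exp
    have h2 := h1.fun_mul ((hasDerivAt_id' s).const_sub (2 + τ))
    refine h2.congr_deriv ?_
    ring

end Kernels
-- Regularity of curves in `H²_loc`
section H2locBasics
variable {H : Type} [NormedAddCommGroup H] [NormedSpace ℝ H]

namespace H2loc
variable (u : H2loc H)

theorem integrableOn_d2 (t : ℝ) : IntegrableOn u.d2 (Ioc 0 t) :=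
  (u.memL2loc_d2 t).integrable (by norm_num)

theorem intervalIntegrable_d2 {t : ℝ} (ht : 0 ≤ t) : IntervalIntegrable u.d2 volume 0 t :=
  (intervalIntegrable_iff_integrableOn_Ioc_of_le ht).2 (u.integrableOn_d2 t)

theorem continuousOn_d1_Icc {t : ℝ} (ht : 0 ≤ t) : ContinuousOn u.d1 (Icc 0 t) := by
  have := continuousOn_primitive_uIcc (u.intervalIntegrable_d2 ht)
  rw [uIcc_of_le ht] at this
  exact (this.const_add (u.d1 0)).congr fun s hs => u.d1_eq s hs.1

/-- Values at negative times are arbitrary, so continuity on the whole line holds only after time is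
frozen at `0`. -/
theorem continuous_d1_max : Continuous fun t => u.d1 (max t 0) := by
  refine continuous_iff_continuousAt.2 fun t => ?_
  have h := (u.continuousOn_d1_Icc (t := |t| + 1) (by positivity)).comp_continuous
    (f := fun s => min (max s 0) (|t| + 1)) (by fun_prop)
    (fun s => ⟨le_min (le_max_right _ _) (by positivity), min_le_right _ _⟩)
  refine h.continuousAt.congr ?_
  filter_upwards [Iio_mem_nhds (show t < |t| + 1 from (le_abs_self t).trans_lt (by linarith))]
    with s hs
  simp only [Function.comp_apply]
  rw [min_eq_left (max_le (le_of_lt hs) (by positivity))]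

theorem continuousOn_d1 : ContinuousOn u.d1 (Ici 0) :=
  u.continuous_d1_max.continuousOn.congr fun s (hs : 0 ≤ s) => by simp [max_eq_left hs]

theorem toFun_eq_max {t : ℝ} (ht : 0 ≤ t) :
    u.toFun t = u.toFun 0 + ∫ s in (0 : ℝ)..t, u.d1 (max s 0) := by
  rw [u.toFun_eq t ht]
  congr 1
  refine intervalIntegral.integral_congr fun s hs => ?_
  rw [uIcc_of_le ht] at hs
  simp [max_eq_left hs.1]

theorem continuousOn_toFun : ContinuousOn u.toFun (Ici 0) := by
  have : Continuous fun t => u.toFun 0 + ∫ s in (0 : ℝ)..t, u.d1 (max s 0) :=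
    continuous_const.add (intervalIntegral.continuous_primitive
      (fun a b => u.continuous_d1_max.intervalIntegrable a b) 0)
  exact this.continuousOn.congr fun t ht => u.toFun_eq_max ht

theorem continuous_toFun_max : Continuous fun t => u.toFun (max t 0) :=
  u.continuousOn_toFun.comp_continuous (by fun_prop) fun t => mem_Ici.2 (le_max_right t 0)

theorem hasDerivAt_toFun [CompleteSpace H] {t : ℝ} (ht : 0 < t) :
    HasDerivAt u.toFun (u.d1 t) t := by
  have h := (u.continuous_d1_max.integral_hasStrictDerivAt 0 t).hasDerivAt.const_add (u.toFun 0)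
  rw [max_eq_left ht.le] at h
  refine h.congr_of_eventuallyEq ?_
  filter_upwards [Ioi_mem_nhds ht] with s hs using u.toFun_eq_max (le_of_lt hs)

theorem norm_toFun_sub_le [CompleteSpace H] {C a b : ℝ} (ha : 0 ≤ a) (hab : a ≤ b)
    (hC : ∀ s ∈ Icc a b, ‖u.d1 s‖ ≤ C) : ‖u.toFun b - u.toFun a‖ ≤ C * (b - a) := by
  have hi : ∀ x y, IntervalIntegrable (fun s => u.d1 (max s 0)) volume x y :=
    fun x y => u.continuous_d1_max.intervalIntegrable x y
  rw [u.toFun_eq_max (ha.trans hab), u.toFun_eq_max ha, add_sub_add_left_eq_sub,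
    intervalIntegral.integral_interval_sub_left (hi _ _) (hi _ _)]
  have := intervalIntegral.norm_integral_le_of_norm_le_const (a := a) (b := b) (C := C)
    (f := fun s => u.d1 (max s 0)) (fun s hs => by
      rw [uIoc_of_le hab] at hs
      rw [max_eq_left (ha.trans hs.1.le)]
      exact hC s ⟨hs.1.le, hs.2⟩)
  rwa [abs_of_nonneg (sub_nonneg.2 hab)] at this

theorem exists_bound_d1 (R : ℝ) : ∃ C, ∀ s ∈ Icc 0 R, ‖u.d1 s‖ ≤ C :=
  isCompact_Icc.exists_bound_of_continuousOn (u.continuousOn_d1.mono fun _ hs => hs.1)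

theorem aestronglyMeasurable_d2 : AEStronglyMeasurable u.d2 (volume.restrict (Ioi 0)) := by
  have : Ioi (0 : ℝ) = ⋃ n : ℕ, Ioc 0 (n : ℝ) := by
    ext s
    simp only [mem_Ioi, mem_iUnion, mem_Ioc]
    exact ⟨fun h => (exists_nat_ge s).imp fun n hn => ⟨h, hn⟩, fun ⟨n, h⟩ => h.1⟩
  rw [this, aestronglyMeasurable_iUnion_iff]
  exact fun n => (u.memL2loc_d2 n).1

theorem aestronglyMeasurable_d1 : AEStronglyMeasurable u.d1 (volume.restrict (Ioi 0)) :=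
  (u.continuousOn_d1.mono fun _ hs => le_of_lt (mem_Ioi.1 hs)).aestronglyMeasurable
    measurableSet_Ioi

theorem aestronglyMeasurable_toFun : AEStronglyMeasurable u.toFun (volume.restrict (Ioi 0)) :=
  (u.continuousOn_toFun.mono fun _ hs => le_of_lt (mem_Ioi.1 hs)).aestronglyMeasurable
    measurableSet_Ioi

end H2loc
end H2locBasics

/-! ### The time change and its inverse -/

section TimeChange

/-- The time change `y ↦ y + δ g(y)`, `g = kerTwo T`. -/
noncomputable def timeChange (T δ y : ℝ) : ℝ := y + δ * kerTwo T y

/-- The derivative of the time change. -/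
noncomputable def timeChangeDeriv (T δ y : ℝ) : ℝ := 1 + δ * kerOne T y

variable {T δ : ℝ}

theorem hasDerivAt_timeChange (hT : 0 ≤ T) (y : ℝ) :
    HasDerivAt (timeChange T δ) (timeChangeDeriv T δ y) y :=
  (hasDerivAt_id' y).fun_add ((hasDerivAt_kerTwo hT y).const_mul δ)

theorem continuous_timeChangeDeriv : Continuous (timeChangeDeriv T δ) := by
  unfold timeChangeDeriv
  exact continuous_const.add (continuous_const.mul continuous_kerOne)

theorem one_le_timeChangeDeriv (hT : 0 ≤ T) (hδ : 0 ≤ δ) (y : ℝ) : 1 ≤ timeChangeDeriv T δ y := by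
  have := mul_nonneg hδ (kerOne_nonneg hT y)
  unfold timeChangeDeriv; linarith

theorem timeChangeDeriv_pos (hT : 0 ≤ T) (hδ : 0 ≤ δ) (y : ℝ) : 0 < timeChangeDeriv T δ y :=
  zero_lt_one.trans_le (one_le_timeChangeDeriv hT hδ y)

theorem strictMono_timeChange (hT : 0 ≤ T) (hδ : 0 ≤ δ) : StrictMono (timeChange T δ) :=
  strictMono_of_deriv_pos fun y => by
    rw [(hasDerivAt_timeChange hT y).deriv]; exact timeChangeDeriv_pos hT hδ y

theorem continuous_timeChange : Continuous (timeChange T δ) := by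
  unfold timeChange
  exact continuous_id.add (continuous_const.mul continuous_kerTwo)

theorem le_timeChange (hT : 0 ≤ T) (hδ : 0 ≤ δ) (y : ℝ) : y ≤ timeChange T δ y := by
  have := mul_nonneg hδ (kerTwo_nonneg hT y)
  unfold timeChange; linarith

theorem timeChange_of_nonpos (hT : 0 ≤ T) {y : ℝ} (hy : y ≤ 0) : timeChange T δ y = y := by
  simp [timeChange, kerTwo_of_nonpos hT hy]

theorem surjective_timeChange (hT : 0 ≤ T) (hδ : 0 ≤ δ) :
    Function.Surjective (timeChange T δ) := by
  refine continuous_timeChange.surjective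
    (tendsto_atTop_mono (le_timeChange hT hδ) tendsto_id) (tendsto_id.congr' ?_)
  filter_upwards [eventually_le_atBot 0] with y hy using (timeChange_of_nonpos hT hy).symm

/-- The inverse of the time change. -/
noncomputable def timeInv (T δ : ℝ) : ℝ → ℝ := Function.invFun (timeChange T δ)

theorem timeChange_timeInv (hT : 0 ≤ T) (hδ : 0 ≤ δ) (s : ℝ) :
    timeChange T δ (timeInv T δ s) = s :=
  Function.rightInverse_invFun (surjective_timeChange hT hδ) s

theorem timeInv_timeChange (hT : 0 ≤ T) (hδ : 0 ≤ δ) (y : ℝ) :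
    timeInv T δ (timeChange T δ y) = y :=
  Function.leftInverse_invFun (strictMono_timeChange hT hδ).injective y

theorem continuous_timeInv (hT : 0 ≤ T) (hδ : 0 ≤ δ) : Continuous (timeInv T δ) := by
  set e := (strictMono_timeChange hT hδ).orderIsoOfSurjective _ (surjective_timeChange hT hδ)
  have : timeInv T δ = e.symm := by
    ext s
    apply (strictMono_timeChange hT hδ).injective
    rw [timeChange_timeInv hT hδ]
    exact (e.apply_symm_apply s).symm
  rw [this]
  exact e.symm.continuous

theorem timeInv_le (hT : 0 ≤ T) (hδ : 0 ≤ δ) (s : ℝ) : timeInv T δ s ≤ s := by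
  conv_rhs => rw [← timeChange_timeInv hT hδ s]
  exact le_timeChange hT hδ _

theorem timeInv_zero (hT : 0 ≤ T) (hδ : 0 ≤ δ) : timeInv T δ 0 = 0 := by
  conv_lhs => rw [← timeChange_of_nonpos (δ := δ) hT le_rfl]
  exact timeInv_timeChange hT hδ 0

theorem timeInv_strictMono (hT : 0 ≤ T) (hδ : 0 ≤ δ) : StrictMono (timeInv T δ) := by
  intro a b hab
  rw [← (strictMono_timeChange hT hδ).lt_iff_lt, timeChange_timeInv hT hδ, timeChange_timeInv hT hδ]
  exact hab

theorem timeInv_pos (hT : 0 ≤ T) (hδ : 0 ≤ δ) {s : ℝ} (hs : 0 < s) : 0 < timeInv T δ s := by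
  simpa [timeInv_zero hT hδ] using timeInv_strictMono hT hδ hs

theorem timeInv_nonneg (hT : 0 ≤ T) (hδ : 0 ≤ δ) {s : ℝ} (hs : 0 ≤ s) : 0 ≤ timeInv T δ s := by
  simpa [timeInv_zero hT hδ] using (timeInv_strictMono hT hδ).monotone hs

theorem hasDerivAt_timeInv (hT : 0 ≤ T) (hδ : 0 ≤ δ) (s : ℝ) :
    HasDerivAt (timeInv T δ) (timeChangeDeriv T δ (timeInv T δ s))⁻¹ s :=
  HasDerivAt.of_local_left_inverse (continuous_timeInv hT hδ).continuousAt
    (hasDerivAt_timeChange hT _) (timeChangeDeriv_pos hT hδ _).ne'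
    (Eventually.of_forall (timeChange_timeInv hT hδ))

theorem image_timeChange_Ioi (hT : 0 ≤ T) (hδ : 0 ≤ δ) : timeChange T δ '' Ioi 0 = Ioi 0 := by
  ext s
  constructor
  · rintro ⟨y, hy, rfl⟩
    exact lt_of_lt_of_le hy (le_timeChange hT hδ y)
  · intro hs
    exact ⟨_, timeInv_pos hT hδ hs, timeChange_timeInv hT hδ s⟩

theorem image_timeChange_Ioc (hT : 0 ≤ T) (hδ : 0 ≤ δ) (t : ℝ) :
    timeChange T δ '' Ioc 0 (timeInv T δ t) = Ioc 0 t := by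
  ext s
  constructor
  · rintro ⟨y, hy, rfl⟩
    refine ⟨lt_of_lt_of_le hy.1 (le_timeChange hT hδ y), ?_⟩
    rw [← timeChange_timeInv hT hδ t]
    exact (strictMono_timeChange hT hδ).monotone hy.2
  · intro hs
    exact ⟨_, ⟨timeInv_pos hT hδ hs.1, (timeInv_strictMono hT hδ).monotone hs.2⟩,
      timeChange_timeInv hT hδ s⟩

/-- The derivative of `1 / timeChangeDeriv`. -/
noncomputable def invDeriv (T δ y : ℝ) : ℝ := -(δ * kerZero T y) / timeChangeDeriv T δ y ^ 2

/-- `kerOne` has a corner at `T`, so the reciprocal is not differentiable there; it is still the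
primitive of its bounded right derivative, which suffices for an `H²_loc` competitor. -/
theorem inv_timeChangeDeriv_eq (hT : 0 ≤ T) (hδ : 0 ≤ δ) {t : ℝ} (ht : 0 ≤ t) :
    IntervalIntegrable (invDeriv T δ) volume 0 t ∧
    (timeChangeDeriv T δ t)⁻¹ = (timeChangeDeriv T δ 0)⁻¹ + ∫ s in (0 : ℝ)..t, invDeriv T δ s := by
  have hpos := timeChangeDeriv_pos hT hδ
  have hint : IntervalIntegrable (invDeriv T δ) volume 0 t := by
    rw [intervalIntegrable_iff_integrableOn_Ioc_of_le ht]
    refine Measure.integrableOn_of_bounded (M := δ * Real.exp T) (by simp) ?_ ?_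
    · exact ((measurable_const.mul measurable_kerZero).neg.div
        (continuous_timeChangeDeriv.measurable.pow_const 2)).aestronglyMeasurable
    · refine Eventually.of_forall fun y => ?_
      rw [invDeriv, norm_div, norm_neg, Real.norm_of_nonneg (mul_nonneg hδ (kerZero_nonneg y)),
        Real.norm_of_nonneg (by positivity), div_le_iff₀ (pow_pos (hpos y) 2)]
      have h1 := one_le_timeChangeDeriv hT hδ y
      calc δ * kerZero T y ≤ δ * Real.exp T * 1 := by
            rw [mul_one]; gcongr; exact kerZero_le y
        _ ≤ _ := by gcongr; nlinarith
  refine ⟨hint, ?_⟩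
  rw [intervalIntegral.integral_eq_sub_of_hasDeriv_right (f := fun y => (timeChangeDeriv T δ y)⁻¹)
    ?_ ?_ hint]
  · ring
  · exact (continuous_timeChangeDeriv.inv₀ fun y => (hpos y).ne').continuousOn
  · intro y hy
    rw [min_eq_left ht] at hy
    have h1 : HasDerivWithinAt (timeChangeDeriv T δ) (δ * kerZero T y) (Ioi y) y :=
      ((hasDerivWithinAt_kerOne hT hy.1.le).const_mul δ).const_add 1
    exact h1.fun_inv (hpos y).ne'

end TimeChange

/-! ### The slowed curve as an admissible competitor -/

section Competitor
variable {H : Type} [NormedAddCommGroup H] [NormedSpace ℝ H] [CompleteSpace H] {T δ : ℝ}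

/-- The second derivative of `u ∘ timeInv` in the variable `y = timeInv s`. -/
noncomputable def slowedD2 (T δ : ℝ) (u : H2loc H) (y : ℝ) : H :=
  (timeChangeDeriv T δ y)⁻¹ • ((invDeriv T δ y) • u.d1 y + (timeChangeDeriv T δ y)⁻¹ • u.d2 y)

theorem product_rule_d1 (hT : 0 ≤ T) (hδ : 0 ≤ δ) (u : H2loc H) {t : ℝ} (ht : 0 ≤ t) :
    (timeChangeDeriv T δ t)⁻¹ • u.d1 t = (timeChangeDeriv T δ 0)⁻¹ • u.d1 0 +
      ∫ y in (0 : ℝ)..t, (invDeriv T δ y • u.d1 y + (timeChangeDeriv T δ y)⁻¹ • u.d2 y) :=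
  (bilin_sub_eq_integral (ContinuousLinearMap.lsmul ℝ ℝ (E := H)) ht
    (inv_timeChangeDeriv_eq hT hδ ht).1 (u.intervalIntegrable_d2 ht)
    (fun _ hs => (inv_timeChangeDeriv_eq hT hδ hs.1).2) (fun s hs => u.d1_eq s hs.1)).2.2

omit [CompleteSpace H] in
theorem memLp_slowedD2 (hT : 0 ≤ T) (hδ : 0 ≤ δ) (u : H2loc H) (t : ℝ) :
    MemLp (slowedD2 T δ u) 2 (volume.restrict (Ioc 0 t)) := by
  have hpos := timeChangeDeriv_pos hT hδ
  have hone := one_le_timeChangeDeriv hT hδ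
  have hinv : ∀ y, ‖(timeChangeDeriv T δ y)⁻¹‖ ≤ 1 := fun y => by
    rw [Real.norm_of_nonneg (inv_nonneg.2 (hpos y).le)]
    exact inv_le_one_of_one_le₀ (hone y)
  have hci : Continuous fun y => (timeChangeDeriv T δ y)⁻¹ :=
    continuous_timeChangeDeriv.inv₀ fun y => (hpos y).ne'
  have hb : ∀ y, ‖invDeriv T δ y‖ ≤ δ * Real.exp T := fun y => by
    rw [invDeriv, norm_div, norm_neg, Real.norm_of_nonneg (mul_nonneg hδ (kerZero_nonneg y)),
      Real.norm_of_nonneg (pow_nonneg (hpos y).le 2), div_le_iff₀ (pow_pos (hpos y) 2)]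
    calc δ * kerZero T y ≤ δ * Real.exp T * 1 := by
          rw [mul_one]; gcongr; exact kerZero_le y
      _ ≤ _ := by gcongr; nlinarith [hone y]
  obtain ⟨C, hC⟩ := u.exists_bound_d1 t
  have hm1 : AEStronglyMeasurable u.d1 (volume.restrict (Ioc 0 t)) :=
    (u.continuousOn_d1.mono fun s hs => hs.1.le).aestronglyMeasurable measurableSet_Ioc
  have hd1 : MemLp (fun y => invDeriv T δ y • u.d1 y) 2 (volume.restrict (Ioc 0 t)) := by
    refine MemLp.of_bound (AEStronglyMeasurable.smul ?_ hm1) (δ * Real.exp T * C) ?_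
    · exact ((measurable_const.mul measurable_kerZero).neg.div
        (continuous_timeChangeDeriv.measurable.pow_const 2)).aestronglyMeasurable
    · filter_upwards [ae_restrict_mem measurableSet_Ioc] with y hy
      rw [norm_smul]
      exact mul_le_mul (hb y) (hC y ⟨hy.1.le, hy.2⟩) (norm_nonneg _) (by positivity)
  have hd2 : MemLp (fun y => (timeChangeDeriv T δ y)⁻¹ • u.d2 y) 2 (volume.restrict (Ioc 0 t)) := by
    refine (u.memL2loc_d2 t).mono (hci.aestronglyMeasurable.smul (u.memL2loc_d2 t).1) ?_
    refine Eventually.of_forall fun y => ?_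
    rw [norm_smul]
    exact mul_le_of_le_one_left (norm_nonneg _) (hinv y)
  have hs := hd1.add hd2
  refine hs.mono (hci.aestronglyMeasurable.smul hs.1) (Eventually.of_forall fun y => ?_)
  rw [slowedD2, norm_smul]
  exact mul_le_of_le_one_left (norm_nonneg _) (hinv y)

theorem integrableOn_comp_timeInv {F : Type*} [NormedAddCommGroup F] [NormedSpace ℝ F]
    (hT : 0 ≤ T) (hδ : 0 ≤ δ) {h : ℝ → F} {t : ℝ}
    (hh : IntegrableOn h (Ioc 0 (timeInv T δ t))) :
    IntegrableOn (fun s => h (timeInv T δ s)) (Ioc 0 t) := by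
  rw [← image_timeChange_Ioc hT hδ t, integrableOn_image_iff_integrableOn_abs_deriv_smul
    measurableSet_Ioc (fun x _ => (hasDerivAt_timeChange hT x).hasDerivWithinAt)
    (strictMono_timeChange hT hδ).injective.injOn]
  simp only [timeInv_timeChange hT hδ]
  have hc : Continuous fun y => |timeChangeDeriv T δ y| := continuous_timeChangeDeriv.abs
  refine Integrable.mono' (hh.norm.const_mul (1 + δ * Real.exp T))
    (hc.aestronglyMeasurable.smul hh.1) (Eventually.of_forall fun y => ?_)
  rw [norm_smul, norm_abs_eq_norm, Real.norm_of_nonneg (timeChangeDeriv_pos hT hδ y).le]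
  gcongr
  rw [timeChangeDeriv]
  gcongr
  exact kerOne_le y

/-- The competitor `u ∘ timeInv`, a slowed down version of `u`. -/
noncomputable def slowed (hT : 0 ≤ T) (hδ : 0 ≤ δ) (u : H2loc H) : H2loc H where
  toFun s := u.toFun (timeInv T δ s)
  d1 s := (timeChangeDeriv T δ (timeInv T δ s))⁻¹ • u.d1 (timeInv T δ s)
  d2 s := slowedD2 T δ u (timeInv T δ s)
  memL2loc_d2 t := by
    have hm := memLp_slowedD2 hT hδ u (timeInv T δ t)
    have h1 : IntegrableOn (fun s => slowedD2 T δ u (timeInv T δ s)) (Ioc 0 t) :=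
      integrableOn_comp_timeInv hT hδ (hm.integrable (by norm_num))
    rw [memLp_two_iff_integrable_sq_norm h1.1]
    exact integrableOn_comp_timeInv (h := fun y => ‖slowedD2 T δ u y‖ ^ 2) hT hδ
      ((memLp_two_iff_integrable_sq_norm hm.1).1 hm)
  d1_eq t ht := by
    have hpos := timeChangeDeriv_pos hT hδ
    rw [product_rule_d1 hT hδ u (timeInv_nonneg hT hδ ht), timeInv_zero hT hδ]
    congr 1
    rw [intervalIntegral.integral_of_le ht, ← image_timeChange_Ioc hT hδ t,
      integral_image_eq_integral_abs_deriv_smul measurableSet_Ioc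
        (fun x _ => (hasDerivAt_timeChange hT x).hasDerivWithinAt)
        (strictMono_timeChange hT hδ).injective.injOn,
      intervalIntegral.integral_of_le (timeInv_nonneg hT hδ ht)]
    -- The Jacobian of the time change cancels the outer factor in `slowedD2`.
    refine integral_congr_ae (Eventually.of_forall fun y => ?_)
    simp only [timeInv_timeChange hT hδ, slowedD2, abs_of_pos (hpos y), smul_smul,
      mul_inv_cancel₀ (hpos y).ne', one_smul]
  toFun_eq t ht := by
    have hpos := timeChangeDeriv_pos hT hδ
    have hc : ContinuousOn (fun s => (timeChangeDeriv T δ (timeInv T δ s))⁻¹ •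
        u.d1 (timeInv T δ s)) (Icc 0 t) := by
      refine ContinuousOn.smul ?_ ?_
      · exact ((continuous_timeChangeDeriv.comp (continuous_timeInv hT hδ)).inv₀
          fun s => (hpos _).ne').continuousOn
      · exact u.continuousOn_d1.comp (continuous_timeInv hT hδ).continuousOn
          fun s hs => timeInv_nonneg hT hδ hs.1
    rw [intervalIntegral.integral_eq_sub_of_hasDerivAt_of_le
      (f := fun s => u.toFun (timeInv T δ s)) ht]
    · abel
    · exact u.continuousOn_toFun.comp (continuous_timeInv hT hδ).continuousOn
          fun s hs => timeInv_nonneg hT hδ hs.1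
    · intro s hs
      exact (u.hasDerivAt_toFun (timeInv_pos hT hδ hs.1)).scomp s (hasDerivAt_timeInv hT hδ s)
    · exact hc.intervalIntegrable_of_Icc ht

end Competitor
-- Pointwise comparison of the densities of the slowed curve
section Slowed
variable {T δ : ℝ}

/-- The factor by which the kinetic and dissipative densities of a slowed down curve decrease. -/
noncomputable def damp (T δ y : ℝ) : ℝ :=
  Real.exp (-(δ * kerTwo T y)) * (timeChangeDeriv T δ y)⁻¹

theorem continuous_damp (hT : 0 ≤ T) (hδ : 0 ≤ δ) : Continuous (damp T δ) := by
  unfold damp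
  refine Continuous.mul ?_ (continuous_timeChangeDeriv.inv₀ fun y =>
    (timeChangeDeriv_pos hT hδ y).ne')
  exact Real.continuous_exp.comp (continuous_const.mul continuous_kerTwo).neg

theorem damp_nonneg (hT : 0 ≤ T) (hδ : 0 ≤ δ) (y : ℝ) : 0 ≤ damp T δ y := by
  have := timeChangeDeriv_pos hT hδ y
  unfold damp; positivity

theorem exp_neg_mul_kerTwo_le_one (hT : 0 ≤ T) (hδ : 0 ≤ δ) (y : ℝ) :
    Real.exp (-(δ * kerTwo T y)) ≤ 1 :=
  Real.exp_le_one_iff.2 (neg_nonpos.2 (mul_nonneg hδ (kerTwo_nonneg hT y)))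

theorem damp_le_one (hT : 0 ≤ T) (hδ : 0 ≤ δ) (y : ℝ) : damp T δ y ≤ 1 :=
  mul_le_one₀ (exp_neg_mul_kerTwo_le_one hT hδ y)
    (inv_nonneg.2 (timeChangeDeriv_pos hT hδ y).le)
    (inv_le_one_of_one_le₀ (one_le_timeChangeDeriv hT hδ y))

theorem exp_neg_timeChange (y : ℝ) : Real.exp (-timeChange T δ y) =
    Real.exp (-y) * Real.exp (-(δ * kerTwo T y)) := by
  rw [← Real.exp_add, timeChange]; ring_nf

/-- The left side equals `e^{-y}(1 + δ kerOne e^{-δ kerTwo})`, and the last exponential is at most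
`1`. The gain `1 - e^{-δ kerTwo}` stays on the left because the integrals are taken in `ℝ≥0∞`. -/
theorem slowed_potential_coeff (hT : 0 ≤ T) (hδ : 0 ≤ δ) (y : ℝ) :
    timeChangeDeriv T δ y * Real.exp (-timeChange T δ y) +
      Real.exp (-y) * (1 - Real.exp (-(δ * kerTwo T y))) ≤
    Real.exp (-y) + δ * (Real.exp (-y) * kerOne T y) := by
  rw [exp_neg_timeChange, timeChangeDeriv]
  have h1 := exp_neg_mul_kerTwo_le_one hT hδ y
  have h2 := mul_nonneg (mul_nonneg hδ (kerOne_nonneg hT y)) (Real.exp_pos (-y)).le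
  nlinarith [mul_nonneg h2 (sub_nonneg.2 h1)]

theorem slowed_dissipation_coeff (hT : 0 ≤ T) (hδ : 0 ≤ δ) (y : ℝ) :
    timeChangeDeriv T δ y * Real.exp (-timeChange T δ y) * (timeChangeDeriv T δ y)⁻¹ ^ 2 =
    Real.exp (-y) * damp T δ y := by
  have := (timeChangeDeriv_pos hT hδ y).ne'
  rw [exp_neg_timeChange, damp]
  field_simp

variable {H : Type} [NormedAddCommGroup H] [InnerProductSpace ℝ H]

/-- First order change of the kinetic density of a slowed down curve, apart from `damp`. -/
noncomputable def slowErr (T δ : ℝ) (u : H2loc H) (y : ℝ) : ℝ :=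
  kerZero T y * (-2 * inner ℝ (u.d2 y) (u.d1 y) +
    δ * (2 * (kerTwo T y + 4 * kerOne T y) * (‖u.d2 y‖ * ‖u.d1 y‖) + kerZero T y * ‖u.d1 y‖ ^ 2))

/-- Combines `e^{-x} ≥ 1 - x`, `1/(1+x) ≥ 1 - x` and Bernoulli's inequality for the fourth power. -/
theorem one_sub_le_exp_mul_inv_pow (hT : 0 ≤ T) (hδ : 0 ≤ δ) (y : ℝ) :
    1 - δ * (kerTwo T y + 4 * kerOne T y) ≤
      Real.exp (-(δ * kerTwo T y)) * (timeChangeDeriv T δ y)⁻¹ ^ 4 := by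
  have hpos := timeChangeDeriv_pos hT hδ y
  have hx := mul_nonneg hδ (kerOne_nonneg hT y)
  have h1 := exp_neg_mul_kerTwo_le_one hT hδ y
  have h2 := Real.add_one_le_exp (-(δ * kerTwo T y))
  have h3 : 1 - δ * kerOne T y ≤ (timeChangeDeriv T δ y)⁻¹ := by
    rw [← one_div, le_div_iff₀ hpos, timeChangeDeriv]
    nlinarith
  set r := (timeChangeDeriv T δ y)⁻¹
  have h4 : 0 ≤ r := inv_nonneg.2 hpos.le
  have h5 : r ≤ 1 := inv_le_one_of_one_le₀ (one_le_timeChangeDeriv hT hδ y)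
  have h6 := one_add_mul_le_pow (a := r - 1) (by linarith) 4
  have h7 : r ^ 4 ≤ 1 := pow_le_one₀ h4 h5
  simp only [add_sub_cancel] at h6
  push_cast at h6
  nlinarith [mul_nonneg (sub_nonneg.2 h1) (sub_nonneg.2 h7)]

/-- With `r` the inverse of the derivative of the time change and `k = kerZero T y`, the second
derivative of the slowed curve is `r²(u'' - δ k r u')`. The square is expanded; the cross term gives
the kinetic energy in the limit, and everything of second order in `δ` goes into `slowErr`. -/
theorem slowed_kinetic (hT : 0 ≤ T) (hδ : 0 ≤ δ) (u : H2loc H) (y : ℝ) :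
    timeChangeDeriv T δ y * Real.exp (-timeChange T δ y) * ‖slowedD2 T δ u y‖ ^ 2 ≤
      Real.exp (-y) * (damp T δ y * ‖u.d2 y‖ ^ 2 + δ * slowErr T δ u y) := by
  have hpos := timeChangeDeriv_pos hT hδ y
  have hone := one_le_timeChangeDeriv hT hδ y
  set χ := timeChangeDeriv T δ y with hχ
  set E := Real.exp (-(δ * kerTwo T y)) with hE
  set k := kerZero T y with hk
  set r := χ⁻¹ with hr
  have hr0 : 0 ≤ r := inv_nonneg.2 hpos.le
  have hr1 : r ≤ 1 := inv_le_one_of_one_le₀ hone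
  have hE0 : 0 ≤ E := (Real.exp_pos _).le
  have hE1 : E ≤ 1 := exp_neg_mul_kerTwo_le_one hT hδ y
  have hk0 : 0 ≤ k := kerZero_nonneg y
  have hb := one_sub_le_exp_mul_inv_pow hT hδ y
  rw [← hE, ← hχ, ← hr] at hb
  have hh : slowedD2 T δ u y = r ^ 2 • (u.d2 y - (δ * k * r) • u.d1 y) := by
    have : invDeriv T δ y = -(δ * k * r ^ 2) := by
      rw [invDeriv, ← hk, ← hχ, hr, inv_pow, div_eq_mul_inv, neg_mul]
    rw [slowedD2, ← hχ, ← hr, this]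
    module
  have hn : ‖slowedD2 T δ u y‖ ^ 2 = r ^ 4 * (‖u.d2 y‖ ^ 2 -
      2 * (δ * k * r) * inner ℝ (u.d2 y) (u.d1 y) + (δ * k * r) ^ 2 * ‖u.d1 y‖ ^ 2) := by
    rw [hh, norm_smul, mul_pow, norm_sub_sq_real, inner_smul_right, norm_smul, mul_pow,
      Real.norm_eq_abs, Real.norm_eq_abs, sq_abs, sq_abs]
    ring
  have hχr : χ * r = 1 := mul_inv_cancel₀ hpos.ne'
  have e1 : χ * r ^ 4 = r ^ 3 := by
    calc χ * r ^ 4 = (χ * r) * r ^ 3 := by ring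
      _ = _ := by rw [hχr, one_mul]
  have hin := abs_real_inner_le_norm (u.d2 y) (u.d1 y)
  set p := inner ℝ (u.d2 y) (u.d1 y)
  have hp : p ≤ ‖u.d2 y‖ * ‖u.d1 y‖ := (le_abs_self p).trans hin
  set N := ‖u.d2 y‖ * ‖u.d1 y‖ with hN
  have hN0 : 0 ≤ N := by positivity
  have hEr1 : E * r ^ 4 ≤ 1 := mul_le_one₀ hE1 (by positivity) (pow_le_one₀ hr0 hr1)
  -- Replacing `r³` by `r` gives up part of the gain, so that the one factor `damp` serves
  -- acceleration and dissipation alike; its derivative `-(kerOne + kerTwo)` at `δ = 0` is all that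
  -- Hardy's inequalities will need.
  have m1 : E * r ^ 3 * ‖u.d2 y‖ ^ 2 ≤ E * r * ‖u.d2 y‖ ^ 2 := by
    have : r ^ 3 ≤ r := pow_le_of_le_one hr0 hr1 (by norm_num)
    gcongr
  -- The inner product has no sign, so freezing its coefficient at the value for `δ = 0` costs an
  -- error of order `δ` measured with norms.
  have m2 : (1 - E * r ^ 4) * p ≤ δ * (kerTwo T y + 4 * kerOne T y) * N :=
    calc _ ≤ (1 - E * r ^ 4) * N := by gcongr
      _ ≤ _ := by gcongr; linarith
  have m3 : E * r ^ 5 * (δ * k) ^ 2 * ‖u.d1 y‖ ^ 2 ≤ 1 * (δ * k) ^ 2 * ‖u.d1 y‖ ^ 2 := by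
    gcongr
    exact mul_le_one₀ hE1 (by positivity) (pow_le_one₀ hr0 hr1)
  have m2' := mul_le_mul_of_nonneg_left m2 (mul_nonneg hδ hk0)
  have key : E * r ^ 3 * (‖u.d2 y‖ ^ 2 - 2 * (δ * k * r) * p + (δ * k * r) ^ 2 * ‖u.d1 y‖ ^ 2) ≤
      E * r * ‖u.d2 y‖ ^ 2 + δ * slowErr T δ u y := by
    rw [slowErr, ← hk, ← hN]
    nlinarith
  rw [exp_neg_timeChange, ← hE, hn, damp, ← hE, ← hχ, ← hr]
  calc χ * (Real.exp (-y) * E) * (r ^ 4 * (‖u.d2 y‖ ^ 2 -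
      2 * (δ * k * r) * p + (δ * k * r) ^ 2 * ‖u.d1 y‖ ^ 2))
      = Real.exp (-y) * (E * (χ * r ^ 4) * (‖u.d2 y‖ ^ 2 -
      2 * (δ * k * r) * p + (δ * k * r) ^ 2 * ‖u.d1 y‖ ^ 2)) := by ring
    _ ≤ _ := by rw [e1]; gcongr

theorem lintegral_comp_timeChange (hT : 0 ≤ T) (hδ : 0 ≤ δ) (F : ℝ → ℝ≥0∞) :
    ∫⁻ s in Ioi 0, F s = ∫⁻ y in Ioi 0, ENNReal.ofReal (timeChangeDeriv T δ y) *
      F (timeChange T δ y) := by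
  conv_lhs => rw [← image_timeChange_Ioi hT hδ]
  rw [lintegral_image_eq_lintegral_abs_deriv_mul measurableSet_Ioi
    (fun x _ => (hasDerivAt_timeChange hT x).hasDerivWithinAt)
    (strictMono_timeChange hT hδ).injective.injOn]
  simp only [abs_of_pos (timeChangeDeriv_pos hT hδ _)]

end Slowed
-- The functional on the slowed curve
section Competitor
variable {n : ℕ} {T δ ε : ℝ} {W G : L2 n → ℝ≥0∞}

theorem measurable_slowErr_aux (u : H2loc (L2 n)) :
    AEStronglyMeasurable (slowErr T δ u) (volume.restrict (Ioi 0)) := by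
  unfold slowErr
  have h1 := u.aestronglyMeasurable_d1
  have h2 := u.aestronglyMeasurable_d2
  have h3 : AEStronglyMeasurable (kerZero T) (volume.restrict (Ioi 0)) :=
    measurable_kerZero.aestronglyMeasurable
  have h4 : AEStronglyMeasurable (kerOne T) (volume.restrict (Ioi 0)) :=
    continuous_kerOne.aestronglyMeasurable
  have h5 : AEStronglyMeasurable (kerTwo T) (volume.restrict (Ioi 0)) :=
    continuous_kerTwo.aestronglyMeasurable
  exact h3.mul (((h2.inner h1).const_mul (-2)).add
    ((((h5.add (h4.const_mul 4)).const_mul 2).mul (h2.norm.mul h1.norm)).add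
      (h3.mul (h1.norm.pow 2)) |>.const_mul δ))

/-- Decreases are written on the left and increases on the right, since `ℝ≥0∞` has no subtraction;
`slowErr`, which has no sign, enters through its positive and negative parts. -/
theorem slowed_density_le (hT : 0 ≤ T) (hδ : 0 ≤ δ) (hε : 0 < ε)
    (hG : ∀ c : ℝ, 0 < c → ∀ v, G (c • v) = ENNReal.ofReal (c ^ 2) * G v)
    (u : H2loc (L2 n)) (y : ℝ) :
    ENNReal.ofReal (timeChangeDeriv T δ y) * (ENNReal.ofReal (Real.exp (-timeChange T δ y)) *
      (ENNReal.ofReal (1 / (2 * ε ^ 2) * ‖slowedD2 T δ u y‖ ^ 2) + W (u.toFun y))) +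
    ENNReal.ofReal (1 / ε) * (ENNReal.ofReal (timeChangeDeriv T δ y) *
      (ENNReal.ofReal (Real.exp (-timeChange T δ y)) *
        G ((timeChangeDeriv T δ y)⁻¹ • u.d1 y))) +
    ENNReal.ofReal (Real.exp (-y) * (1 - Real.exp (-(δ * kerTwo T y)))) * W (u.toFun y) +
    ENNReal.ofReal (Real.exp (-y) * (1 - damp T δ y)) * (ENNReal.ofReal (1 / ε) * G (u.d1 y) +
      ENNReal.ofReal (1 / (2 * ε ^ 2) * ‖u.d2 y‖ ^ 2)) +
    ENNReal.ofReal (δ * (1 / (2 * ε ^ 2) * (Real.exp (-y) * max (-slowErr T δ u y) 0))) ≤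
    ENNReal.ofReal (Real.exp (-y)) *
      (ENNReal.ofReal (1 / (2 * ε ^ 2) * ‖u.d2 y‖ ^ 2) + W (u.toFun y)) +
    ENNReal.ofReal (1 / ε) * (ENNReal.ofReal (Real.exp (-y)) * G (u.d1 y)) +
    ENNReal.ofReal (δ * (Real.exp (-y) * kerOne T y)) * W (u.toFun y) +
    ENNReal.ofReal (δ * (1 / (2 * ε ^ 2) * (Real.exp (-y) * max (slowErr T δ u y) 0))) := by
  have hpos := timeChangeDeriv_pos hT hδ y
  have hd0 := damp_nonneg hT hδ y
  have hd1 := damp_le_one hT hδ y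
  have hE1 := exp_neg_mul_kerTwo_le_one hT hδ y
  have hk1 := kerOne_nonneg hT y
  have pW : ENNReal.ofReal (timeChangeDeriv T δ y) * (ENNReal.ofReal
      (Real.exp (-timeChange T δ y)) * W (u.toFun y)) +
      ENNReal.ofReal (Real.exp (-y) * (1 - Real.exp (-(δ * kerTwo T y)))) * W (u.toFun y) ≤
      ENNReal.ofReal (Real.exp (-y)) * W (u.toFun y) +
      ENNReal.ofReal (δ * (Real.exp (-y) * kerOne T y)) * W (u.toFun y) := by
    rw [← mul_assoc, ← ENNReal.ofReal_mul hpos.le, ← add_mul, ← add_mul,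
      ← ENNReal.ofReal_add (by positivity) (mul_nonneg (Real.exp_pos _).le (by linarith)),
      ← ENNReal.ofReal_add (by positivity) (by positivity)]
    exact mul_le_mul_left (ENNReal.ofReal_le_ofReal (slowed_potential_coeff hT hδ y)) _
  have pG : ENNReal.ofReal (1 / ε) * (ENNReal.ofReal (timeChangeDeriv T δ y) *
      (ENNReal.ofReal (Real.exp (-timeChange T δ y)) *
        G ((timeChangeDeriv T δ y)⁻¹ • u.d1 y))) +
      ENNReal.ofReal (Real.exp (-y) * (1 - damp T δ y)) * (ENNReal.ofReal (1 / ε) * G (u.d1 y)) =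
      ENNReal.ofReal (1 / ε) * (ENNReal.ofReal (Real.exp (-y)) * G (u.d1 y)) := by
    rw [hG _ (inv_pos.2 hpos), ← mul_assoc (ENNReal.ofReal (Real.exp (-timeChange T δ y))),
      ← mul_assoc (ENNReal.ofReal (timeChangeDeriv T δ y)), ← ENNReal.ofReal_mul (by positivity),
      ← ENNReal.ofReal_mul hpos.le, ← mul_assoc (timeChangeDeriv T δ y),
      slowed_dissipation_coeff hT hδ, ← mul_assoc, mul_comm (ENNReal.ofReal (1 / ε)), mul_assoc,
      ← add_mul,
      ← ENNReal.ofReal_add (by positivity) (mul_nonneg (Real.exp_pos _).le (by linarith)),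
      ← mul_add, add_sub_cancel, mul_one, mul_left_comm]
  have pD : ENNReal.ofReal (timeChangeDeriv T δ y) * (ENNReal.ofReal
      (Real.exp (-timeChange T δ y)) *
        ENNReal.ofReal (1 / (2 * ε ^ 2) * ‖slowedD2 T δ u y‖ ^ 2)) +
      ENNReal.ofReal (Real.exp (-y) * (1 - damp T δ y)) *
        ENNReal.ofReal (1 / (2 * ε ^ 2) * ‖u.d2 y‖ ^ 2) +
      ENNReal.ofReal (δ * (1 / (2 * ε ^ 2) * (Real.exp (-y) * max (-slowErr T δ u y) 0))) ≤
      ENNReal.ofReal (Real.exp (-y)) * ENNReal.ofReal (1 / (2 * ε ^ 2) * ‖u.d2 y‖ ^ 2) +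
      ENNReal.ofReal (δ * (1 / (2 * ε ^ 2) * (Real.exp (-y) * max (slowErr T δ u y) 0))) := by
    have h1 : 0 ≤ Real.exp (-y) * (1 - damp T δ y) :=
      mul_nonneg (Real.exp_pos _).le (by linarith)
    have h2 : ∀ x : ℝ, 0 ≤ max x 0 := fun x => le_max_right _ _
    have h3 := h2 (slowErr T δ u y)
    have h4 := h2 (-slowErr T δ u y)
    rw [← ENNReal.ofReal_mul (Real.exp_pos _).le, ← ENNReal.ofReal_mul hpos.le,
      ← ENNReal.ofReal_mul h1, ← ENNReal.ofReal_mul (Real.exp_pos _).le,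
      ← ENNReal.ofReal_add (by positivity) (by positivity),
      ← ENNReal.ofReal_add (by positivity) (by positivity),
      ← ENNReal.ofReal_add (by positivity) (by positivity)]
    apply ENNReal.ofReal_le_ofReal
    have hk := mul_le_mul_of_nonneg_left (slowed_kinetic hT hδ u y)
      (show 0 ≤ 1 / (2 * ε ^ 2) by positivity)
    have hs : max (slowErr T δ u y) 0 - max (-slowErr T δ u y) 0 = slowErr T δ u y := by
      rcases le_total (slowErr T δ u y) 0 with h | h
      · rw [max_eq_right h, max_eq_left (by linarith)]; ring
      · rw [max_eq_left h, max_eq_right (by linarith)]; ring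
    have e : ∀ c e p q k : ℝ, δ * (c * (e * p)) - δ * (c * (e * q)) = c * (e * (δ * (p - q))) :=
      fun _ _ _ _ _ => by ring
    have := e (1 / (2 * ε ^ 2)) (Real.exp (-y)) (max (slowErr T δ u y) 0)
      (max (-slowErr T δ u y) 0) 0
    rw [hs] at this
    linarith
  calc _ = (ENNReal.ofReal (timeChangeDeriv T δ y) * (ENNReal.ofReal
      (Real.exp (-timeChange T δ y)) * W (u.toFun y)) +
      ENNReal.ofReal (Real.exp (-y) * (1 - Real.exp (-(δ * kerTwo T y)))) * W (u.toFun y)) +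
      (ENNReal.ofReal (1 / ε) * (ENNReal.ofReal (timeChangeDeriv T δ y) *
      (ENNReal.ofReal (Real.exp (-timeChange T δ y)) *
        G ((timeChangeDeriv T δ y)⁻¹ • u.d1 y))) +
      ENNReal.ofReal (Real.exp (-y) * (1 - damp T δ y)) * (ENNReal.ofReal (1 / ε) * G (u.d1 y))) +
      (ENNReal.ofReal (timeChangeDeriv T δ y) * (ENNReal.ofReal
      (Real.exp (-timeChange T δ y)) *
        ENNReal.ofReal (1 / (2 * ε ^ 2) * ‖slowedD2 T δ u y‖ ^ 2)) +
      ENNReal.ofReal (Real.exp (-y) * (1 - damp T δ y)) *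
        ENNReal.ofReal (1 / (2 * ε ^ 2) * ‖u.d2 y‖ ^ 2) +
      ENNReal.ofReal (δ * (1 / (2 * ε ^ 2) * (Real.exp (-y) * max (-slowErr T δ u y) 0)))) := by
        ring
    _ ≤ _ := add_le_add (add_le_add pW pG.le) pD
    _ = _ := by ring

/-- Superadditivity of the lower integral requires no measurability, so none has to be proved for
the densities of the competitor. -/
theorem add_lintegral_five_le (μ : Measure ℝ) (a b c d e : ℝ → ℝ≥0∞) :
    (∫⁻ y, a y ∂μ) + (∫⁻ y, b y ∂μ) + (∫⁻ y, c y ∂μ) + (∫⁻ y, d y ∂μ) + ∫⁻ y, e y ∂μ ≤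
      ∫⁻ y, (a y + b y + c y + d y + e y) ∂μ :=
  calc _ ≤ (∫⁻ y, (a y + b y) ∂μ) + (∫⁻ y, c y ∂μ) + (∫⁻ y, d y ∂μ) + ∫⁻ y, e y ∂μ := by
        gcongr; exact le_lintegral_add _ _
    _ ≤ (∫⁻ y, (a y + b y + c y) ∂μ) + (∫⁻ y, d y ∂μ) + ∫⁻ y, e y ∂μ := by
        gcongr; exact le_lintegral_add _ _
    _ ≤ (∫⁻ y, (a y + b y + c y + d y) ∂μ) + ∫⁻ y, e y ∂μ := by
        gcongr; exact le_lintegral_add _ _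
    _ ≤ _ := le_lintegral_add _ _

theorem posPart_slowed (hT : 0 ≤ T) (hδ : 0 ≤ δ) (u : H2loc (L2 n)) :
    posPart W G ε (slowed hT hδ u) =
    (∫⁻ y in Ioi 0, ENNReal.ofReal (timeChangeDeriv T δ y) *
      (ENNReal.ofReal (Real.exp (-timeChange T δ y)) *
      (ENNReal.ofReal (1 / (2 * ε ^ 2) * ‖slowedD2 T δ u y‖ ^ 2) + W (u.toFun y)))) +
    ∫⁻ y in Ioi 0, ENNReal.ofReal (1 / ε) * (ENNReal.ofReal (timeChangeDeriv T δ y) *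
      (ENNReal.ofReal (Real.exp (-timeChange T δ y)) *
        G ((timeChangeDeriv T δ y)⁻¹ • u.d1 y))) := by
  rw [posPart]
  congr 1
  · rw [lintegral_comp_timeChange hT hδ]
    refine lintegral_congr fun y => ?_
    change _ * (_ * (ENNReal.ofReal (1 / (2 * ε ^ 2) * ‖slowedD2 T δ u (timeInv T δ _)‖ ^ 2) +
      W (u.toFun (timeInv T δ _)))) = _
    rw [timeInv_timeChange hT hδ]
  · rw [lintegral_comp_timeChange hT hδ, ← lintegral_const_mul' _ _ ENNReal.ofReal_ne_top]
    refine lintegral_congr fun y => ?_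
    change _ * (_ * (_ * G ((timeChangeDeriv T δ (timeInv T δ _))⁻¹ • u.d1 (timeInv T δ _)))) = _
    rw [timeInv_timeChange hT hδ]

theorem posPart_slowed_add_le (hT : 0 ≤ T) (hδ : 0 ≤ δ) (hε : 0 < ε)
    (hG : ∀ c : ℝ, 0 < c → ∀ v, G (c • v) = ENNReal.ofReal (c ^ 2) * G v) (u : H2loc (L2 n))
    (hWm : AEMeasurable (fun s => W (u.toFun s)) (volume.restrict (Ioi 0)))
    (hGm : AEMeasurable (fun s => G (u.d1 s)) (volume.restrict (Ioi 0))) :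
    posPart W G ε (slowed hT hδ u) +
    (∫⁻ y in Ioi 0, ENNReal.ofReal (Real.exp (-y) * (1 - Real.exp (-(δ * kerTwo T y)))) *
      W (u.toFun y)) +
    (∫⁻ y in Ioi 0, ENNReal.ofReal (Real.exp (-y) * (1 - damp T δ y)) *
      (ENNReal.ofReal (1 / ε) * G (u.d1 y) + ENNReal.ofReal (1 / (2 * ε ^ 2) * ‖u.d2 y‖ ^ 2))) +
    (∫⁻ y in Ioi 0,
      ENNReal.ofReal (δ * (1 / (2 * ε ^ 2) * (Real.exp (-y) * max (-slowErr T δ u y) 0)))) ≤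
    posPart W G ε u +
    (∫⁻ y in Ioi 0, ENNReal.ofReal (δ * (Real.exp (-y) * kerOne T y)) * W (u.toFun y)) +
    ∫⁻ y in Ioi 0,
      ENNReal.ofReal (δ * (1 / (2 * ε ^ 2) * (Real.exp (-y) * max (slowErr T δ u y) 0))) := by
  have hexp : Measurable fun y : ℝ => ENNReal.ofReal (Real.exp (-y)) := by fun_prop
  have mE : AEMeasurable (fun y => ENNReal.ofReal
      (δ * (1 / (2 * ε ^ 2) * (Real.exp (-y) * max (slowErr T δ u y) 0))))
      (volume.restrict (Ioi 0)) := by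
    have h0 : AEMeasurable (fun y => max (slowErr T δ u y) 0) (volume.restrict (Ioi 0)) :=
      (measurable_slowErr_aux u).aemeasurable.max aemeasurable_const
    have h1 : AEMeasurable (fun y : ℝ => Real.exp (-y)) (volume.restrict (Ioi 0)) := by fun_prop
    exact (((h1.mul h0).const_mul _).const_mul _).ennreal_ofReal
  have m1 : AEMeasurable (fun y => ENNReal.ofReal (1 / ε) *
      (ENNReal.ofReal (Real.exp (-y)) * G (u.d1 y))) (volume.restrict (Ioi 0)) :=
    (hexp.aemeasurable.mul hGm).const_mul _
  have m2 : AEMeasurable (fun y => ENNReal.ofReal (δ * (Real.exp (-y) * kerOne T y)) *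
      W (u.toFun y)) (volume.restrict (Ioi 0)) := by
    have : Continuous fun y => δ * (Real.exp (-y) * kerOne T y) :=
      continuous_const.mul ((by fun_prop : Continuous fun y : ℝ => Real.exp (-y)).mul
        continuous_kerOne)
    exact this.measurable.ennreal_ofReal.aemeasurable.mul hWm
  rw [posPart_slowed, posPart, ← lintegral_const_mul' _ _ ENNReal.ofReal_ne_top,
    ← lintegral_add_right' _ m1, ← lintegral_add_right' _ m2, ← lintegral_add_right' _ mE]
  refine (add_lintegral_five_le _ _ _ _ _ _).trans ?_
  exact lintegral_mono fun y => slowed_density_le hT hδ hε hG u y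

end Competitor
-- The first order kinetic term
section FirstOrder
variable {H : Type} [NormedAddCommGroup H] [InnerProductSpace ℝ H] {T : ℝ}

theorem integral_inner_d2_d1 [CompleteSpace H] (u : H2loc H) (hT : 0 ≤ T) :
    IntervalIntegrable (fun s => inner ℝ (u.d2 s) (u.d1 s)) volume 0 T ∧
    ∫ s in (0 : ℝ)..T, inner ℝ (u.d2 s) (u.d1 s) = (‖u.d1 T‖ ^ 2 - ‖u.d1 0‖ ^ 2) / 2 := by
  have hd := u.intervalIntegrable_d2 hT
  have he : ∀ s ∈ Icc 0 T, u.d1 s = u.d1 0 + ∫ r in (0 : ℝ)..s, u.d2 r :=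
    fun s hs => u.d1_eq s hs.1
  obtain ⟨h1, h2, h3⟩ := bilin_sub_eq_integral
    (isBoundedBilinearMap_inner (𝕜 := ℝ) (E := H)).toContinuousLinearMap hT hd hd he he
  refine ⟨h1, ?_⟩
  rw [intervalIntegral.integral_add h1 h2] at h3
  change inner ℝ (u.d1 T) (u.d1 T) = inner ℝ (u.d1 0) (u.d1 0) +
    ((∫ s in (0 : ℝ)..T, inner ℝ (u.d2 s) (u.d1 s)) +
      ∫ s in (0 : ℝ)..T, inner ℝ (u.d1 s) (u.d2 s)) at h3
  simp only [real_inner_self_eq_norm_sq] at h3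
  have : (∫ s in (0 : ℝ)..T, inner ℝ (u.d1 s) (u.d2 s)) =
      ∫ s in (0 : ℝ)..T, inner ℝ (u.d2 s) (u.d1 s) :=
    intervalIntegral.integral_congr fun s _ => real_inner_comm _ _
  linarith

/-- This dictates the choice of perturbation: its second derivative cancels the exponential weight
up to time `T` and vanishes afterwards. -/
theorem exp_neg_mul_kerZero_mul (q : ℝ → ℝ) :
    (fun y => Real.exp (-y) * (kerZero T y * q y)) = (Iio T).indicator q := by
  ext y
  by_cases h : y < T
  · rw [indicator_of_mem (mem_Iio.2 h), kerZero, if_pos h, ← mul_assoc, ← Real.exp_add]; simp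
  · rw [indicator_of_notMem (by simpa using h), kerZero, if_neg h]; simp

theorem integral_exp_neg_mul_kerZero_mul (hT : 0 ≤ T) {q : ℝ → ℝ}
    (hq : IntervalIntegrable q volume 0 T) :
    IntegrableOn (fun y => Real.exp (-y) * (kerZero T y * q y)) (Ioi 0) ∧
    ∫ y in Ioi 0, Real.exp (-y) * (kerZero T y * q y) = ∫ y in (0 : ℝ)..T, q y := by
  rw [intervalIntegrable_iff_integrableOn_Ioo_of_le hT] at hq
  rw [exp_neg_mul_kerZero_mul]
  have hs : Iio T ∩ Ioi 0 = Ioo 0 T := by rw [inter_comm]; rfl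
  constructor
  · rw [IntegrableOn, integrable_indicator_iff measurableSet_Iio, IntegrableOn,
      Measure.restrict_restrict measurableSet_Iio, hs]
    exact hq
  · rw [integral_indicator measurableSet_Iio, Measure.restrict_restrict measurableSet_Iio, hs,
      intervalIntegral.integral_of_le hT, integral_Ioc_eq_integral_Ioo]

/-- The leading part `-2⟨u'',u'⟩` is the derivative of `-‖u'‖²`; the correction has an integral over
`(0,T)` that does not depend on `δ`. -/
theorem integral_slowErr [CompleteSpace H] (u : H2loc H) (hT : 0 ≤ T) : ∃ R : ℝ, ∀ δ : ℝ,
    IntegrableOn (fun y => Real.exp (-y) * slowErr T δ u y) (Ioi 0) ∧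
    ∫ y in Ioi 0, Real.exp (-y) * slowErr T δ u y =
      ‖u.d1 0‖ ^ 2 - ‖u.d1 T‖ ^ 2 + δ * R := by
  obtain ⟨i1, e1⟩ := integral_inner_d2_d1 u hT
  have c1 : ContinuousOn u.d1 (uIcc 0 T) := by
    rw [uIcc_of_le hT]; exact u.continuousOn_d1_Icc hT
  have i2 : IntervalIntegrable (fun y => 2 * (kerTwo T y + 4 * kerOne T y) *
      (‖u.d2 y‖ * ‖u.d1 y‖) + kerZero T y * ‖u.d1 y‖ ^ 2) volume 0 T := by
    refine IntervalIntegrable.add ?_ ?_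
    · refine IntervalIntegrable.continuousOn_mul ?_ ?_
      · exact (u.intervalIntegrable_d2 hT).norm.mul_continuousOn c1.norm
      · exact (continuous_const.mul (continuous_kerTwo.add
          (continuous_const.mul continuous_kerOne))).continuousOn
    · refine IntervalIntegrable.mul_continuousOn ?_ (c1.norm.pow 2)
      rw [intervalIntegrable_iff_integrableOn_Ioc_of_le hT]
      refine Measure.integrableOn_of_bounded (M := Real.exp T) (by simp)
        measurable_kerZero.aestronglyMeasurable (Eventually.of_forall fun y => ?_)
      rw [Real.norm_of_nonneg (kerZero_nonneg y)]
      exact kerZero_le y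
  refine ⟨∫ y in (0 : ℝ)..T, (2 * (kerTwo T y + 4 * kerOne T y) * (‖u.d2 y‖ * ‖u.d1 y‖) +
    kerZero T y * ‖u.d1 y‖ ^ 2), fun δ => ?_⟩
  have i3 := (i1.const_mul (-2)).add (i2.const_mul δ)
  obtain ⟨a, b⟩ := integral_exp_neg_mul_kerZero_mul hT i3
  refine ⟨a, ?_⟩
  unfold slowErr
  rw [b, intervalIntegral.integral_add (i1.const_mul (-2)) (i2.const_mul δ),
    intervalIntegral.integral_const_mul, intervalIntegral.integral_const_mul, e1]
  ring

end FirstOrder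

/-! ### The source term and its first variation -/

section SourceTerm
variable {n : ℕ} {f : ℝ → L2 n} {ε tε : ℝ} {φ : ℝ → L2 n}

namespace IsSource
variable (hφ : IsSource f ε tε φ)
include hφ

theorem integrable_sq : IntegrableOn (fun t => Real.exp (-t) * ‖φ t‖ ^ 2) (Ioi 0) := by
  refine ⟨?_, ?_⟩
  · exact (by fun_prop : Continuous fun t : ℝ => Real.exp (-t)).aestronglyMeasurable.mul
      (hφ.meas.norm.pow 2)
  · rw [hasFiniteIntegral_iff_ofReal (Eventually.of_forall fun t => by positivity)]
    exact hφ.norm_le.trans_lt ENNReal.ofReal_lt_top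

theorem integrable_norm : IntegrableOn (fun t => Real.exp (-t) * ‖φ t‖) (Ioi 0) := by
  have h1 : IntegrableOn (fun t : ℝ => Real.exp (-t)) (Ioi 0) := integrableOn_exp_neg_Ioi 0
  refine (h1.add hφ.integrable_sq).mono' ?_ (Eventually.of_forall fun t => ?_)
  · exact (by fun_prop : Continuous fun t : ℝ => Real.exp (-t)).aestronglyMeasurable.mul
      hφ.meas.norm
  · rw [Real.norm_of_nonneg (by positivity)]
    change _ ≤ Real.exp (-t) + Real.exp (-t) * ‖φ t‖ ^ 2
    nlinarith [Real.exp_pos (-t), mul_nonneg (Real.exp_pos (-t)).le (sq_nonneg (‖φ t‖ - 1)),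
      mul_nonneg (Real.exp_pos (-t)).le (norm_nonneg (φ t))]

theorem integrable_mul {E : Type*} [NormedAddCommGroup E] {w : ℝ → E}
    (hw : AEStronglyMeasurable w (volume.restrict (Ioi 0)))
    (hb : ∀ R, ∃ C, ∀ t ∈ Ioc 0 R, ‖w t‖ ≤ C) :
    IntegrableOn (fun t => Real.exp (-t) * (‖φ t‖ * ‖w t‖)) (Ioi 0) := by
  obtain ⟨R, -, -, hR⟩ := hφ.supp
  obtain ⟨C, hC⟩ := hb R
  refine (hφ.integrable_norm.const_mul C).mono' ?_ ?_
  · exact (by fun_prop : Continuous fun t : ℝ => Real.exp (-t)).aestronglyMeasurable.mul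
      (hφ.meas.norm.mul hw.norm)
  · filter_upwards [ae_restrict_mem measurableSet_Ioi] with t ht
    rw [Real.norm_of_nonneg (by positivity)]
    rcases le_or_gt t R with h | h
    · have := hC t ⟨ht, h⟩
      calc _ = Real.exp (-t) * ‖φ t‖ * ‖w t‖ := by ring
        _ ≤ Real.exp (-t) * ‖φ t‖ * C := by gcongr
        _ = _ := by ring
    · simp [hR t h]

theorem integrable_inner {w : ℝ → L2 n} (hw : AEStronglyMeasurable w (volume.restrict (Ioi 0)))
    (hb : ∀ R, ∃ C, ∀ t ∈ Ioc 0 R, ‖w t‖ ≤ C) :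
    IntegrableOn (fun t => Real.exp (-t) * inner ℝ (φ t) (w t)) (Ioi 0) := by
  refine (hφ.integrable_mul hw hb).mono' ?_ (Eventually.of_forall fun t => ?_)
  · exact (by fun_prop : Continuous fun t : ℝ => Real.exp (-t)).aestronglyMeasurable.mul
      (hφ.meas.inner hw)
  · rw [norm_mul, Real.norm_of_nonneg (Real.exp_pos _).le]
    gcongr
    exact norm_inner_le_norm _ _

theorem integrable_source (u : H2loc (L2 n)) :
    IntegrableOn (fun t => Real.exp (-t) * inner ℝ (φ t) (u.toFun t)) (Ioi 0) := by
  refine hφ.integrable_inner u.aestronglyMeasurable_toFun fun R => ?_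
  obtain ⟨C, hC⟩ := isCompact_Icc.exists_bound_of_continuousOn
    (u.continuousOn_toFun.mono fun (s : ℝ) (hs : s ∈ Icc 0 R) => hs.1)
  exact ⟨C, fun t ht => hC t ⟨ht.1.le, ht.2⟩⟩

theorem source_sub_le (u v : H2loc (L2 n)) :
    source φ u - source φ v ≤
      ∫ t in Ioi 0, Real.exp (-t) * (‖φ t‖ * ‖u.toFun t - v.toFun t‖) := by
  rw [source, source, ← integral_sub (hφ.integrable_source u) (hφ.integrable_source v)]
  refine integral_mono ((hφ.integrable_source u).sub (hφ.integrable_source v))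
    (hφ.integrable_mul (u.aestronglyMeasurable_toFun.sub v.aestronglyMeasurable_toFun)
      fun R => ?_) fun t => ?_
  · obtain ⟨C, hC⟩ := isCompact_Icc.exists_bound_of_continuousOn
      ((u.continuousOn_toFun.sub v.continuousOn_toFun).mono
        fun (s : ℝ) (hs : s ∈ Icc 0 R) => hs.1)
    exact ⟨C, fun t ht => hC t ⟨ht.1.le, ht.2⟩⟩
  · simp only
    rw [← mul_sub, ← inner_sub_right]
    gcongr
    exact real_inner_le_norm _ _

/-- First order change of the source term along slowed down curves. -/
theorem tendsto_slowed (u : H2loc (L2 n)) {T : ℝ} (hT : 0 ≤ T) {δ : ℕ → ℝ}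
    (hδ : ∀ k, 0 < δ k) (hlim : Tendsto δ atTop (𝓝 0)) :
    Tendsto (fun k => (δ k)⁻¹ * ∫ t in Ioi 0, Real.exp (-t) *
      (‖φ t‖ * ‖u.toFun t - u.toFun (timeInv T (δ k) t)‖)) atTop
      (𝓝 (∫ t in Ioi 0, Real.exp (-t) * kerTwo T t * (‖φ t‖ * ‖u.d1 t‖))) := by
  obtain ⟨R, -, -, hR⟩ := hφ.supp
  obtain ⟨C, hC⟩ := u.exists_bound_d1 R
  obtain ⟨C', hC'⟩ := isCompact_Icc.exists_bound_of_continuousOn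
    ((continuous_kerTwo (T := T)).continuousOn (s := Icc 0 R))
  -- The time lag is `δ` times `kerTwo` at the earlier time, so the difference quotient is bounded
  -- on the support of `φ`, uniformly in `δ`.
  have hsub : ∀ k t, t - timeInv T (δ k) t = δ k * kerTwo T (timeInv T (δ k) t) := fun k t => by
    conv_lhs => rw [← timeChange_timeInv hT (hδ k).le t, timeInv_timeChange hT (hδ k).le, timeChange]
    ring
  have hmono : Monotone (kerTwo T) := monotone_of_deriv_nonneg
    (fun y => (hasDerivAt_kerTwo hT y).differentiableAt)
    fun y => by rw [(hasDerivAt_kerTwo hT y).deriv]; exact kerOne_nonneg hT y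
  simp_rw [← integral_const_mul]
  refine tendsto_integral_of_dominated_convergence
    (fun t => C' * C * (Real.exp (-t) * ‖φ t‖)) ?_ (hφ.integrable_norm.const_mul _) ?_ ?_
  · intro k
    have hm : AEStronglyMeasurable (fun t => u.toFun (timeInv T (δ k) t))
        (volume.restrict (Ioi 0)) :=
      (slowed hT (hδ k).le u).aestronglyMeasurable_toFun
    exact ((by fun_prop : Continuous fun t : ℝ => Real.exp (-t)).aestronglyMeasurable.mul
      (hφ.meas.norm.mul (u.aestronglyMeasurable_toFun.sub hm).norm)).const_mul _
  · intro k
    filter_upwards [ae_restrict_mem measurableSet_Ioi] with t (ht : 0 < t)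
    have hδk := hδ k
    rw [Real.norm_of_nonneg (by positivity)]
    rcases le_or_gt t R with h | h
    · have h0 := timeInv_nonneg hT hδk.le ht.le
      have h1 := timeInv_le hT hδk.le t
      have h2 := u.norm_toFun_sub_le h0 h1 (C := C)
        fun s hs => hC s ⟨h0.trans hs.1, hs.2.trans h⟩
      have hC0 : 0 ≤ C := (norm_nonneg _).trans (hC t ⟨ht.le, h⟩)
      rw [hsub] at h2
      have h3 : kerTwo T (timeInv T (δ k) t) ≤ C' :=
        (hmono h1).trans ((le_abs_self _).trans (hC' t ⟨ht.le, h⟩))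
      calc (δ k)⁻¹ * (Real.exp (-t) * (‖φ t‖ * ‖u.toFun t - u.toFun (timeInv T (δ k) t)‖))
          ≤ (δ k)⁻¹ * (Real.exp (-t) * (‖φ t‖ * (C * (δ k * C')))) := by
            gcongr
            exact h2.trans (by gcongr)
        _ = C' * C * (Real.exp (-t) * ‖φ t‖) := by field_simp
    · simp [hR t h]
  · filter_upwards [ae_restrict_mem measurableSet_Ioi] with t (ht : 0 < t)
    have hinv : Tendsto (fun k => timeInv T (δ k) t) atTop (𝓝 t) := by
      have hl : Tendsto (fun k => t - δ k * kerTwo T t) atTop (𝓝 t) := by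
        simpa using (hlim.mul_const (kerTwo T t)).const_sub t
      refine tendsto_of_tendsto_of_tendsto_of_le_of_le hl tendsto_const_nhds (fun k => ?_)
        fun k => timeInv_le hT (hδ k).le t
      have := mul_le_mul_of_nonneg_left (hmono (timeInv_le hT (hδ k).le t)) (hδ k).le
      have := hsub k t
      simp only
      linarith
    -- `dslope` also covers `timeInv = t`, where the ordinary difference quotient is meaningless.
    have hd : Tendsto (fun k => dslope u.toFun t (timeInv T (δ k) t)) atTop (𝓝 (u.d1 t)) := by
      have h1 := u.hasDerivAt_toFun ht
      have h2 := (continuousAt_dslope_same.2 h1.differentiableAt).tendsto.comp hinv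
      rwa [dslope_same, h1.deriv] at h2
    have hg : Tendsto (fun k => kerTwo T (timeInv T (δ k) t)) atTop (𝓝 (kerTwo T t)) :=
      (continuous_kerTwo.tendsto t).comp hinv
    have := ((hg.mul hd.norm).const_mul (‖φ t‖)).const_mul (Real.exp (-t))
    convert this using 2 with k
    · rw [norm_sub_rev, ← sub_smul_dslope u.toFun t, norm_smul, norm_sub_rev _ t, hsub,
        norm_mul, Real.norm_of_nonneg (hδ k).le, Real.norm_of_nonneg (kerTwo_nonneg hT _)]
      have := (hδ k).ne'
      field_simp
    · ring

end IsSource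
end SourceTerm
-- The inequality obtained from inner variations
section Variation
variable {n : ℕ} {W G : L2 n → ℝ≥0∞} {w₀ w₁ : L2 n} {f : ℝ → L2 n} {ε tε : ℝ} {φ : ℝ → L2 n}
  {u : H2loc (L2 n)}

/-- The source term is a real number, so a competitor with finite nonnegative part forces that of
the minimizer to be finite, and the comparison can be made in `ℝ`. -/
theorem toReal_posPart_sub_source_le {v : H2loc (L2 n)} (hu : IsMinimizer W G w₀ w₁ φ ε u)
    (hv : HasInitialData ε w₀ w₁ v) (hfin : posPart W G ε v ≠ ⊤) :
    posPart W G ε u ≠ ⊤ ∧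
    (posPart W G ε u).toReal - source φ u ≤ (posPart W G ε v).toReal - source φ v := by
  have h := hu.2 v hv
  rw [J, J] at h
  have e : ((posPart W G ε v : ℝ≥0∞) : EReal) = ((posPart W G ε v).toReal : EReal) :=
    (EReal.coe_ennreal_toReal hfin).symm
  rw [e, ← EReal.coe_sub] at h
  have hu' : posPart W G ε u ≠ ⊤ := by
    intro ht
    rw [ht, EReal.coe_ennreal_top, EReal.top_sub_coe] at h
    exact absurd (top_le_iff.1 h) (EReal.coe_ne_top _)
  have e' : ((posPart W G ε u : ℝ≥0∞) : EReal) = ((posPart W G ε u).toReal : EReal) :=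
    (EReal.coe_ennreal_toReal hu').symm
  rw [e', ← EReal.coe_sub, EReal.coe_le_coe_iff] at h
  exact ⟨hu', h⟩

theorem lintegral_exp_potential_le :
    ∫⁻ y in Ioi 0, ENNReal.ofReal (Real.exp (-y)) * W (u.toFun y) ≤ posPart W G ε u := by
  refine le_trans (lintegral_mono fun y => ?_) le_self_add
  gcongr
  exact le_add_self

theorem lintegral_kerOne_potential_le {T : ℝ} :
    ∫⁻ y in Ioi 0, ENNReal.ofReal (Real.exp (-y) * kerOne T y) * W (u.toFun y) ≤
      ENNReal.ofReal (Real.exp T) * posPart W G ε u := by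
  refine le_trans ?_ (mul_le_mul_right lintegral_exp_potential_le _)
  rw [← lintegral_const_mul' _ _ ENNReal.ofReal_ne_top]
  refine lintegral_mono fun y => ?_
  rw [← mul_assoc, ← ENNReal.ofReal_mul (Real.exp_pos _).le, mul_comm (Real.exp T)]
  gcongr
  exact kerOne_le y

theorem lintegral_kerOne_potential_ne_top {T : ℝ} (hfin : posPart W G ε u ≠ ⊤) :
    ∫⁻ y in Ioi 0, ENNReal.ofReal (Real.exp (-y) * kerOne T y) * W (u.toFun y) ≠ ⊤ :=
  (lintegral_kerOne_potential_le.trans_lt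
    (ENNReal.mul_lt_top ENNReal.ofReal_lt_top hfin.lt_top)).ne

theorem hasInitialData_slowed {T δ : ℝ} (hT : 0 ≤ T) (hδ : 0 ≤ δ)
    (hu : HasInitialData ε w₀ w₁ u) : HasInitialData ε w₀ w₁ (slowed hT hδ u) := by
  constructor
  · change u.toFun (timeInv T δ 0) = w₀
    rw [timeInv_zero hT hδ]; exact hu.1
  · change (timeChangeDeriv T δ (timeInv T δ 0))⁻¹ • u.d1 (timeInv T δ 0) = ε • w₁
    rw [timeInv_zero hT hδ, timeChangeDeriv, kerOne_of_nonpos hT le_rfl]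
    simpa using hu.2

/-- Minimality against the slowed curve: `r` collects the difference quotients of all terms that may
grow, and the gains are at most `δ r`. The sign of `r` is recorded because `ENNReal.ofReal`
truncates negative numbers. -/
theorem variation_le {T δ : ℝ} (hT : 0 ≤ T) (hδ : 0 < δ) (hε : 0 < ε)
    (hG : ∀ c : ℝ, 0 < c → ∀ v, G (c • v) = ENNReal.ofReal (c ^ 2) * G v)
    (hWm : AEMeasurable (fun s => W (u.toFun s)) (volume.restrict (Ioi 0)))
    (hGm : AEMeasurable (fun s => G (u.d1 s)) (volume.restrict (Ioi 0)))
    (hφ : IsSource f ε tε φ) (hu : IsMinimizer W G w₀ w₁ φ ε u) (hfin : posPart W G ε u ≠ ⊤)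
    {r : ℝ} (hr : r = (∫⁻ y in Ioi 0, ENNReal.ofReal (Real.exp (-y) * kerOne T y) *
        W (u.toFun y)).toReal +
      1 / (2 * ε ^ 2) * (∫ y in Ioi 0, Real.exp (-y) * slowErr T δ u y) +
      δ⁻¹ * ∫ t in Ioi 0, Real.exp (-t) * (‖φ t‖ * ‖u.toFun t - u.toFun (timeInv T δ t)‖)) :
    0 ≤ r ∧
    (∫⁻ y in Ioi 0, ENNReal.ofReal (Real.exp (-y) * (1 - Real.exp (-(δ * kerTwo T y)))) *
      W (u.toFun y)) +
    (∫⁻ y in Ioi 0, ENNReal.ofReal (Real.exp (-y) * (1 - damp T δ y)) *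
      (ENNReal.ofReal (1 / ε) * G (u.d1 y) + ENNReal.ofReal (1 / (2 * ε ^ 2) * ‖u.d2 y‖ ^ 2))) ≤
    ENNReal.ofReal (δ * r) := by
  have hmain := posPart_slowed_add_le hT hδ.le hε hG u hWm hGm
  have hUi := hasInitialData_slowed hT hδ.le hu.1
  have hUt : ∀ t, (slowed hT hδ.le u).toFun t = u.toFun (timeInv T δ t) := fun t => rfl
  set U := slowed hT hδ.le u
  clear_value U
  set A := ∫⁻ y in Ioi 0, ENNReal.ofReal (Real.exp (-y) * (1 - Real.exp (-(δ * kerTwo T y)))) *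
    W (u.toFun y)
  set B := ∫⁻ y in Ioi 0, ENNReal.ofReal (Real.exp (-y) * (1 - damp T δ y)) *
    (ENNReal.ofReal (1 / ε) * G (u.d1 y) + ENNReal.ofReal (1 / (2 * ε ^ 2) * ‖u.d2 y‖ ^ 2))
  set V := ∫⁻ y in Ioi 0, ENNReal.ofReal (Real.exp (-y) * kerOne T y) * W (u.toFun y)
  have hV : V ≠ ⊤ := lintegral_kerOne_potential_ne_top hfin
  have hV' : ∫⁻ y in Ioi 0, ENNReal.ofReal (δ * (Real.exp (-y) * kerOne T y)) * W (u.toFun y) =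
      ENNReal.ofReal δ * V := by
    rw [← lintegral_const_mul' _ _ ENNReal.ofReal_ne_top]
    refine lintegral_congr fun y => ?_
    rw [ENNReal.ofReal_mul hδ.le, mul_assoc]
  obtain ⟨R, hR⟩ := integral_slowErr u hT
  have hierr := (hR δ).1
  have hgen : ∀ σ : ℝ, σ = 1 ∨ σ = -1 →
      IntegrableOn (fun y => δ * (1 / (2 * ε ^ 2) * (Real.exp (-y) *
        max (σ * slowErr T δ u y) 0))) (Ioi 0) := by
    intro σ hσ
    have h1 : ∀ y, Real.exp (-y) * max (σ * slowErr T δ u y) 0 =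
        max (σ * (Real.exp (-y) * slowErr T δ u y)) 0 := fun y => by
      rw [mul_max_of_nonneg _ _ (Real.exp_pos _).le, mul_zero]; ring_nf
    simp only [h1]
    exact (((hierr.const_mul σ).pos_part).const_mul _).const_mul _
  have ip : IntegrableOn (fun y => δ * (1 / (2 * ε ^ 2) * (Real.exp (-y) *
        max (slowErr T δ u y) 0))) (Ioi 0) := by simpa using hgen 1 (Or.inl rfl)
  have im : IntegrableOn (fun y => δ * (1 / (2 * ε ^ 2) * (Real.exp (-y) *
        max (-slowErr T δ u y) 0))) (Ioi 0) := by simpa using hgen (-1) (Or.inr rfl)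
  rw [hV', ← ofReal_integral_eq_lintegral_ofReal ip (Eventually.of_forall fun y => by
      have := le_max_right (slowErr T δ u y) 0
      positivity),
    ← ofReal_integral_eq_lintegral_ofReal im (Eventually.of_forall fun y => by
      have := le_max_right (-slowErr T δ u y) 0
      positivity)] at hmain
  set p := ∫ y in Ioi 0, δ * (1 / (2 * ε ^ 2) * (Real.exp (-y) * max (slowErr T δ u y) 0))
  set m := ∫ y in Ioi 0, δ * (1 / (2 * ε ^ 2) * (Real.exp (-y) * max (-slowErr T δ u y) 0))
  have hp0 : 0 ≤ p := integral_nonneg fun y => by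
      have := le_max_right (slowErr T δ u y) 0
      positivity
  have hm0 : 0 ≤ m := integral_nonneg fun y => by
      have := le_max_right (-slowErr T δ u y) 0
      positivity
  have hpm : p - m = δ * (1 / (2 * ε ^ 2) * ∫ y in Ioi 0, Real.exp (-y) * slowErr T δ u y) := by
    rw [← integral_const_mul, ← integral_const_mul, ← integral_sub ip im]
    refine integral_congr_ae (Eventually.of_forall fun y => ?_)
    simp only
    rw [← mul_sub, ← mul_sub, ← mul_sub]
    congr 3
    rcases le_total (slowErr T δ u y) 0 with h | h
    · rw [max_eq_right h, max_eq_left (by linarith)]; ring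
    · rw [max_eq_left h, max_eq_right (by linarith)]; ring
  have hRHS : posPart W G ε u + ENNReal.ofReal δ * V + ENNReal.ofReal p ≠ ⊤ := by
    simp [hfin, hV, ENNReal.mul_eq_top]
  have hLHS := ne_top_of_le_ne_top hRHS hmain
  have hUfin : posPart W G ε U ≠ ⊤ := by
    intro h; rw [h] at hLHS; simp at hLHS
  have hA : A ≠ ⊤ := by intro h; rw [h] at hLHS; simp at hLHS
  have hB : B ≠ ⊤ := by intro h; rw [h] at hLHS; simp at hLHS
  have hmin := (toReal_posPart_sub_source_le hu hUi hUfin).2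
  have hs := hφ.source_sub_le u U
  have hreal := (ENNReal.toReal_le_toReal hLHS hRHS).2 hmain
  rw [ENNReal.toReal_add (by simp [*]) (by simp), ENNReal.toReal_add (by simp [*]) hB,
    ENNReal.toReal_add hUfin hA, ENNReal.toReal_add (by simp [*, ENNReal.mul_eq_top]) (by simp),
    ENNReal.toReal_add hfin (by simp [*, ENNReal.mul_eq_top]), ENNReal.toReal_mul,
    ENNReal.toReal_ofReal hδ.le, ENNReal.toReal_ofReal hp0, ENNReal.toReal_ofReal hm0] at hreal
  have hδr : δ * r = δ * V.toReal + δ * (1 / (2 * ε ^ 2) *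
      ∫ y in Ioi 0, Real.exp (-y) * slowErr T δ u y) +
      ∫ t in Ioi 0, Real.exp (-t) * (‖φ t‖ * ‖u.toFun t - u.toFun (timeInv T δ t)‖) := by
    rw [hr, mul_add, mul_add, ← mul_assoc δ δ⁻¹, mul_inv_cancel₀ hδ.ne', one_mul]
  have hAB : A.toReal + B.toReal ≤ δ * r := by
    rw [hδr, ← hpm]
    simp only [hUt] at hs
    linarith
  constructor
  · have : 0 ≤ δ * r := le_trans (by positivity) hAB
    exact nonneg_of_mul_nonneg_right this hδ
  · rw [← ENNReal.toReal_add hA hB] at hAB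
    exact (ENNReal.le_ofReal_iff_toReal_le (by simp [*]) (le_trans ENNReal.toReal_nonneg hAB)).2 hAB

theorem tendsto_one_sub_exp_div (a : ℝ) {δ : ℕ → ℝ} (hδ : ∀ k, 0 < δ k)
    (hlim : Tendsto δ atTop (𝓝 0)) :
    Tendsto (fun k => (1 - Real.exp (-(δ k * a))) / δ k) atTop (𝓝 a) := by
  have h : HasDerivAt (fun x : ℝ => Real.exp (-(x * a))) (-a) 0 := by
    simpa using ((hasDerivAt_id (0 : ℝ)).mul_const a).neg.exp
  have h2 := (hasDerivAt_iff_tendsto_slope.1 h).comp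
    (tendsto_nhdsWithin_iff.2 ⟨hlim, Eventually.of_forall fun k => (hδ k).ne'⟩)
  have h3 := h2.neg
  rw [neg_neg] at h3
  refine h3.congr fun k => ?_
  simp only [Function.comp_apply, slope_def_field, zero_mul, neg_zero, Real.exp_zero, sub_zero]
  rw [← neg_div, neg_sub]

theorem tendsto_one_sub_damp_div {T : ℝ} (y : ℝ) {δ : ℕ → ℝ} (hδ : ∀ k, 0 < δ k)
    (hlim : Tendsto δ atTop (𝓝 0)) :
    Tendsto (fun k => (1 - damp T (δ k) y) / δ k) atTop (𝓝 (kerOne T y + kerTwo T y)) := by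
  have h1 : HasDerivAt (fun x : ℝ => Real.exp (-(x * kerTwo T y))) (-kerTwo T y) 0 := by
    simpa using ((hasDerivAt_id (0 : ℝ)).mul_const (kerTwo T y)).neg.exp
  have h2 : HasDerivAt (fun x : ℝ => (1 + x * kerOne T y)⁻¹) (-kerOne T y) 0 := by
    have := (((hasDerivAt_id (0 : ℝ)).mul_const (kerOne T y)).const_add 1).fun_inv (by simp)
    simpa using this
  have h : HasDerivAt (fun x : ℝ => damp T x y) (-(kerOne T y + kerTwo T y)) 0 := by
    refine (h1.fun_mul h2).congr_deriv ?_
    simp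
  have h2 := (hasDerivAt_iff_tendsto_slope.1 h).comp
    (tendsto_nhdsWithin_iff.2 ⟨hlim, Eventually.of_forall fun k => (hδ k).ne'⟩)
  have h3 := h2.neg
  rw [neg_neg] at h3
  refine h3.congr fun k => ?_
  have h0 : damp T 0 y = 1 := by simp [damp, timeChangeDeriv]
  simp only [Function.comp_apply, slope_def_field, sub_zero, h0]
  rw [← neg_div, neg_sub]

/-- The limit `δ → 0`. The right sides converge, since their weights are bounded by a multiple of
`e^{-y}` or supported in bounded time. On the left, Fatou's lemma yields finiteness of the limit
integrals as part of the conclusion. -/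
theorem weighted_potential_add_le {T : ℝ} (hT : 0 ≤ T) (hε : 0 < ε)
    (hG : ∀ c : ℝ, 0 < c → ∀ v, G (c • v) = ENNReal.ofReal (c ^ 2) * G v)
    (hWm : AEMeasurable (fun s => W (u.toFun s)) (volume.restrict (Ioi 0)))
    (hGm : AEMeasurable (fun s => G (u.d1 s)) (volume.restrict (Ioi 0)))
    (hφ : IsSource f ε tε φ) (hu : IsMinimizer W G w₀ w₁ φ ε u) (hfin : posPart W G ε u ≠ ⊤) :
    0 ≤ (∫⁻ y in Ioi 0, ENNReal.ofReal (Real.exp (-y) * kerOne T y) * W (u.toFun y)).toReal +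
      1 / (2 * ε ^ 2) * (‖u.d1 0‖ ^ 2 - ‖u.d1 T‖ ^ 2) +
      (∫ t in Ioi 0, Real.exp (-t) * kerTwo T t * (‖φ t‖ * ‖u.d1 t‖)) ∧
    ∫⁻ y in Ioi 0, (ENNReal.ofReal (Real.exp (-y) * kerTwo T y) * W (u.toFun y) +
      ENNReal.ofReal (Real.exp (-y) * (kerOne T y + kerTwo T y)) *
      (ENNReal.ofReal (1 / ε) * G (u.d1 y) + ENNReal.ofReal (1 / (2 * ε ^ 2) * ‖u.d2 y‖ ^ 2))) ≤
    ENNReal.ofReal ((∫⁻ y in Ioi 0, ENNReal.ofReal (Real.exp (-y) * kerOne T y) *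
        W (u.toFun y)).toReal +
      1 / (2 * ε ^ 2) * (‖u.d1 0‖ ^ 2 - ‖u.d1 T‖ ^ 2) +
      ∫ t in Ioi 0, Real.exp (-t) * kerTwo T t * (‖φ t‖ * ‖u.d1 t‖)) := by
  obtain ⟨δ, hδ, hlim⟩ : ∃ δ : ℕ → ℝ, (∀ k, 0 < δ k) ∧ Tendsto δ atTop (𝓝 0) :=
    ⟨fun k => 1 / ((k : ℝ) + 1), fun k => by positivity, tendsto_one_div_add_atTop_nhds_zero_nat⟩
  set V := (∫⁻ y in Ioi 0, ENNReal.ofReal (Real.exp (-y) * kerOne T y) * W (u.toFun y)).toReal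
    with hV
  obtain ⟨R, hR⟩ := integral_slowErr u hT
  have hvar := fun k => variation_le hT (hδ k) hε hG hWm hGm hφ hu hfin rfl
  simp only [← hV] at hvar
  have hr := (((hlim.mul_const R).const_add (‖u.d1 0‖ ^ 2 - ‖u.d1 T‖ ^ 2)).const_mul
    (1 / (2 * ε ^ 2)) |>.const_add V).add (hφ.tendsto_slowed u hT hδ hlim)
  rw [zero_mul, add_zero] at hr
  simp only [← (hR _).2] at hr
  refine ⟨ge_of_tendsto' hr fun k => (hvar k).1, ?_⟩
  have hQm : AEMeasurable (fun y => ENNReal.ofReal (1 / ε) * G (u.d1 y) +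
      ENNReal.ofReal (1 / (2 * ε ^ 2) * ‖u.d2 y‖ ^ 2)) (volume.restrict (Ioi 0)) :=
    (hGm.const_mul _).add
      ((u.aestronglyMeasurable_d2.norm.pow 2).const_mul _).aemeasurable.ennreal_ofReal
  have hexp : Measurable fun y : ℝ => ENNReal.ofReal (Real.exp (-y)) := by fun_prop
  have hexp0 : ∀ y : ℝ, ENNReal.ofReal (Real.exp (-y)) ≠ 0 := fun y => by
    simp [Real.exp_pos]
  -- Convergence of the weights passes to the products only where the other factor is finite: a
  -- limit weight may be `0`, and `0 * ⊤` is a point of discontinuity.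
  have hWfin : ∀ᵐ y ∂(volume.restrict (Ioi (0 : ℝ))), W (u.toFun y) ≠ ⊤ := by
    have := ae_lt_top' (hexp.aemeasurable.mul hWm)
      (lintegral_exp_potential_le.trans_lt hfin.lt_top).ne
    filter_upwards [this] with y hy h
    change ENNReal.ofReal (Real.exp (-y)) * W (u.toFun y) < ⊤ at hy
    simp only [h, ENNReal.mul_top (hexp0 y), lt_self_iff_false] at hy
  have hQfin : ∀ᵐ y ∂(volume.restrict (Ioi (0 : ℝ))), ENNReal.ofReal (1 / ε) * G (u.d1 y) +
      ENNReal.ofReal (1 / (2 * ε ^ 2) * ‖u.d2 y‖ ^ 2) ≠ ⊤ := by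
    have h1 : ENNReal.ofReal (1 / ε) *
        ∫⁻ y in Ioi 0, ENNReal.ofReal (Real.exp (-y)) * G (u.d1 y) ≠ ⊤ :=
      ne_top_of_le_ne_top hfin le_add_self
    have h2 : ∫⁻ y in Ioi 0, ENNReal.ofReal (Real.exp (-y)) * G (u.d1 y) ≠ ⊤ := by
      intro h
      rw [h, ENNReal.mul_top (by simpa using hε)] at h1
      exact h1 rfl
    filter_upwards [ae_lt_top' (hexp.aemeasurable.mul hGm) h2] with y hy
    have : G (u.d1 y) ≠ ⊤ := by
      intro h
      change ENNReal.ofReal (Real.exp (-y)) * G (u.d1 y) < ⊤ at hy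
      simp only [h, ENNReal.mul_top (hexp0 y), lt_self_iff_false] at hy
    simp [this, ENNReal.mul_eq_top]
  set F : ℕ → ℝ → ℝ≥0∞ := fun k y =>
    ENNReal.ofReal (Real.exp (-y) * ((1 - Real.exp (-(δ k * kerTwo T y))) / δ k)) * W (u.toFun y) +
    ENNReal.ofReal (Real.exp (-y) * ((1 - damp T (δ k) y) / δ k)) *
      (ENNReal.ofReal (1 / ε) * G (u.d1 y) + ENNReal.ofReal (1 / (2 * ε ^ 2) * ‖u.d2 y‖ ^ 2))
    with hF
  have hm1 : ∀ k, Measurable fun y => ENNReal.ofReal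
      (Real.exp (-y) * ((1 - Real.exp (-(δ k * kerTwo T y))) / δ k)) := fun k => by
    have := (continuous_kerTwo (T := T)).measurable
    fun_prop
  have hm2 : ∀ k, Measurable fun y => ENNReal.ofReal
      (Real.exp (-y) * ((1 - damp T (δ k) y) / δ k)) := fun k => by
    have := (continuous_damp hT (hδ k).le).measurable
    fun_prop
  have hA : ∀ k, AEMeasurable (fun y => ENNReal.ofReal
      (Real.exp (-y) * ((1 - Real.exp (-(δ k * kerTwo T y))) / δ k)) * W (u.toFun y))
      (volume.restrict (Ioi 0)) := fun k => (hm1 k).aemeasurable.mul hWm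
  have hFm : ∀ k, AEMeasurable (F k) (volume.restrict (Ioi 0)) := fun k =>
    ((hm1 k).aemeasurable.mul hWm).add ((hm2 k).aemeasurable.mul hQm)
  have hFle : ∀ k, ∫⁻ y in Ioi 0, F k y ≤ ENNReal.ofReal (V + 1 / (2 * ε ^ 2) *
      (∫ y in Ioi 0, Real.exp (-y) * slowErr T (δ k) u y) + (δ k)⁻¹ * ∫ t in Ioi 0,
        Real.exp (-t) * (‖φ t‖ * ‖u.toFun t - u.toFun (timeInv T (δ k) t)‖)) := by
    intro k
    have h := (hvar k).2
    rw [ENNReal.ofReal_mul (hδ k).le] at h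
    refine (ENNReal.mul_le_mul_iff_right (a := ENNReal.ofReal (δ k)) (by simpa using hδ k)
      ENNReal.ofReal_ne_top).1 (le_trans (le_of_eq ?_) h)
    simp only [hF]
    rw [lintegral_add_left' (hA k), mul_add,
      ← lintegral_const_mul' _ _ ENNReal.ofReal_ne_top,
      ← lintegral_const_mul' _ _ ENNReal.ofReal_ne_top]
    have hδk := (hδ k).ne'
    congr 1
    all_goals
      refine lintegral_congr fun y => ?_
      rw [← mul_assoc, ← ENNReal.ofReal_mul (hδ k).le]
      congr 2
      field_simp
  calc _ ≤ ∫⁻ y in Ioi 0, liminf (fun k => F k y) atTop := by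
        refine lintegral_mono_ae ?_
        filter_upwards [hWfin, hQfin] with y h1 h2
        refine le_of_eq (Tendsto.liminf_eq ?_).symm
        refine Tendsto.add ?_ ?_
        · exact ENNReal.Tendsto.mul_const (ENNReal.tendsto_ofReal
            ((tendsto_one_sub_exp_div _ hδ hlim).const_mul _)) (Or.inr h1)
        · exact ENNReal.Tendsto.mul_const (ENNReal.tendsto_ofReal
            ((tendsto_one_sub_damp_div y hδ hlim).const_mul _)) (Or.inr h2)
    _ ≤ liminf (fun k => ∫⁻ y in Ioi 0, F k y) atTop := lintegral_liminf_le' hFm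
    _ ≤ liminf (fun k => ENNReal.ofReal (V + 1 / (2 * ε ^ 2) *
      (∫ y in Ioi 0, Real.exp (-y) * slowErr T (δ k) u y) + (δ k)⁻¹ * ∫ t in Ioi 0,
        Real.exp (-t) * (‖φ t‖ * ‖u.toFun t - u.toFun (timeInv T (δ k) t)‖))) atTop :=
        liminf_le_liminf (Eventually.of_forall hFle)
    _ = _ := (ENNReal.tendsto_ofReal hr).liminf_eq

/-- The consequence of minimality under inner variations. -/
theorem energy_inequality {T : ℝ} (hT : 0 ≤ T) (hε : 0 < ε)
    (hG : ∀ c : ℝ, 0 < c → ∀ v, G (c • v) = ENNReal.ofReal (c ^ 2) * G v)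
    (hWm : AEMeasurable (fun s => W (u.toFun s)) (volume.restrict (Ioi 0)))
    (hGm : AEMeasurable (fun s => G (u.d1 s)) (volume.restrict (Ioi 0)))
    (hφ : IsSource f ε tε φ) (hu : IsMinimizer W G w₀ w₁ φ ε u) (hfin : posPart W G ε u ≠ ⊤) :
    ENNReal.ofReal (1 / (2 * ε ^ 2) * ‖u.d1 T‖ ^ 2) +
    (∫⁻ y in Ioi 0, ENNReal.ofReal (Real.exp (-y) * kerTwo T y) * W (u.toFun y)) +
    ENNReal.ofReal (1 / ε) *
      (∫⁻ y in Ioi 0, ENNReal.ofReal (Real.exp (-y) * (kerOne T y + kerTwo T y)) * G (u.d1 y)) +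
    (∫⁻ y in Ioi 0, ENNReal.ofReal (Real.exp (-y) * (kerOne T y + kerTwo T y)) *
      ENNReal.ofReal (1 / (2 * ε ^ 2) * ‖u.d2 y‖ ^ 2)) ≤
    ENNReal.ofReal (1 / (2 * ε ^ 2) * ‖u.d1 0‖ ^ 2) +
    (∫⁻ y in Ioi 0, ENNReal.ofReal (Real.exp (-y) * kerOne T y) * W (u.toFun y)) +
    ∫⁻ y in Ioi 0, ENNReal.ofReal (Real.exp (-y) * kerTwo T y) *
      ENNReal.ofReal (‖φ y‖ * ‖u.d1 y‖) := by
  obtain ⟨h0, h⟩ := weighted_potential_add_le hT hε hG hWm hGm hφ hu hfin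
  set V := ∫⁻ y in Ioi 0, ENNReal.ofReal (Real.exp (-y) * kerOne T y) * W (u.toFun y) with hVdef
  have hV : V ≠ ⊤ := lintegral_kerOne_potential_ne_top hfin
  set I := ∫ t in Ioi 0, Real.exp (-t) * kerTwo T t * (‖φ t‖ * ‖u.d1 t‖) with hI
  have hpos : ∀ t, 0 ≤ Real.exp (-t) * kerTwo T t := fun t =>
    mul_nonneg (Real.exp_pos _).le (kerTwo_nonneg hT t)
  have hI0 : 0 ≤ I := integral_nonneg fun t => mul_nonneg (hpos t) (by positivity)
  have hIle : ENNReal.ofReal I ≤ ∫⁻ y in Ioi 0, ENNReal.ofReal (Real.exp (-y) * kerTwo T y) *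
      ENNReal.ofReal (‖φ y‖ * ‖u.d1 y‖) := by
    simp_rw [← ENNReal.ofReal_mul (hpos _)]
    rw [hI, integral_eq_lintegral_of_nonneg_ae
      (Eventually.of_forall fun t => mul_nonneg (hpos t) (by positivity))]
    · exact ENNReal.ofReal_toReal_le
    · exact ((by fun_prop : Continuous fun t : ℝ => Real.exp (-t)).mul
        continuous_kerTwo).aestronglyMeasurable.mul
        (hφ.meas.norm.mul u.aestronglyMeasurable_d1.norm)
  have hexp : Continuous fun y : ℝ => Real.exp (-y) := by fun_prop
  have hm : Measurable fun y => ENNReal.ofReal (Real.exp (-y) * (kerOne T y + kerTwo T y)) :=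
    (hexp.mul (continuous_kerOne.add continuous_kerTwo)).measurable.ennreal_ofReal
  have hm2 : Measurable fun y => ENNReal.ofReal (Real.exp (-y) * kerTwo T y) :=
    (hexp.mul continuous_kerTwo).measurable.ennreal_ofReal
  have hA : AEMeasurable (fun y => ENNReal.ofReal (Real.exp (-y) * kerTwo T y) * W (u.toFun y))
      (volume.restrict (Ioi 0)) := hm2.aemeasurable.mul hWm
  have hB : AEMeasurable (fun y => ENNReal.ofReal (Real.exp (-y) * (kerOne T y + kerTwo T y)) *
      (ENNReal.ofReal (1 / ε) * G (u.d1 y))) (volume.restrict (Ioi 0)) :=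
    hm.aemeasurable.mul (hGm.const_mul _)
  simp only [mul_add (ENNReal.ofReal _)] at h
  rw [lintegral_add_left' hA, lintegral_add_left' hB] at h
  have e1 : ∫⁻ y in Ioi 0, ENNReal.ofReal (Real.exp (-y) * (kerOne T y + kerTwo T y)) *
      (ENNReal.ofReal (1 / ε) * G (u.d1 y)) = ENNReal.ofReal (1 / ε) *
      ∫⁻ y in Ioi 0, ENNReal.ofReal (Real.exp (-y) * (kerOne T y + kerTwo T y)) * G (u.d1 y) := by
    rw [← lintegral_const_mul' _ _ ENNReal.ofReal_ne_top]
    exact lintegral_congr fun y => by ring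
  rw [e1] at h
  -- By `h0` the real bracket is nonnegative, so `ofReal` does not truncate it and the kinetic
  -- energy at `T` can be moved to the left.
  have hsum : ENNReal.ofReal (1 / (2 * ε ^ 2) * ‖u.d1 T‖ ^ 2) + ENNReal.ofReal (V.toReal +
      1 / (2 * ε ^ 2) * (‖u.d1 0‖ ^ 2 - ‖u.d1 T‖ ^ 2) + I) =
      ENNReal.ofReal (1 / (2 * ε ^ 2) * ‖u.d1 0‖ ^ 2) + V + ENNReal.ofReal I := by
    rw [← ENNReal.ofReal_add (by positivity) h0]
    conv_rhs => rw [← ENNReal.ofReal_toReal hV]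
    rw [← ENNReal.ofReal_add (by positivity) (by positivity), ← ENNReal.ofReal_add
      (by positivity) hI0]
    congr 1
    ring
  calc _ = ENNReal.ofReal (1 / (2 * ε ^ 2) * ‖u.d1 T‖ ^ 2) + (
      (∫⁻ y in Ioi 0, ENNReal.ofReal (Real.exp (-y) * kerTwo T y) * W (u.toFun y)) +
      (ENNReal.ofReal (1 / ε) *
      (∫⁻ y in Ioi 0, ENNReal.ofReal (Real.exp (-y) * (kerOne T y + kerTwo T y)) * G (u.d1 y)) +
      (∫⁻ y in Ioi 0, ENNReal.ofReal (Real.exp (-y) * (kerOne T y + kerTwo T y)) *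
      ENNReal.ofReal (1 / (2 * ε ^ 2) * ‖u.d2 y‖ ^ 2)))) := by ring
    _ ≤ _ := by gcongr
    _ = _ := hsum
    _ ≤ _ := by gcongr

end Variation
-- Hardy and Jensen inequalities for `𝒜` and `𝒜²`
section Hardy

theorem sq_lintegral_mul_le {α : Type*} [MeasurableSpace α] (μ : Measure α) {f g : α → ℝ≥0∞}
    (hf : AEMeasurable f μ) (hg : AEMeasurable g μ) :
    (∫⁻ a, f a * g a ∂μ) ^ 2 ≤ (∫⁻ a, f a ^ 2 ∂μ) * ∫⁻ a, g a ^ 2 ∂μ := by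
  have h := ENNReal.lintegral_mul_le_Lp_mul_Lq μ Real.HolderConjugate.two_two hf hg
  have h2 := pow_le_pow_left' h 2
  simp only [Pi.mul_apply, ENNReal.rpow_two, mul_pow] at h2
  have e : ∀ x : ℝ≥0∞, (x ^ (1 / 2 : ℝ)) ^ 2 = x := fun x => by
    rw [← ENNReal.rpow_two, ← ENNReal.rpow_mul]; norm_num
  rwa [e, e] at h2

theorem lintegral_Ioi_ofReal_eq {F f : ℝ → ℝ} {a : ℝ} (hF : ∀ x, HasDerivAt F (f x) x)
    (hpos : ∀ x ∈ Ioi a, 0 ≤ f x) (hlim : Tendsto F atTop (𝓝 0)) :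
    ∫⁻ x in Ioi a, ENNReal.ofReal (f x) = ENNReal.ofReal (-F a) := by
  rw [← ofReal_integral_eq_lintegral_ofReal
    (integrableOn_Ioi_deriv_of_nonneg' (fun x _ => hF x) hpos hlim)
    ((ae_restrict_iff' measurableSet_Ioi).2 (Eventually.of_forall hpos)),
    integral_Ioi_of_hasDerivAt_of_nonneg' (fun x _ => hF x) hpos hlim, zero_sub]

theorem hasDerivAt_exp_neg_half (s x : ℝ) :
    HasDerivAt (fun x => Real.exp (-((x - s) / 2))) (-(1 / 2) * Real.exp (-((x - s) / 2))) x := by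
  have := (((hasDerivAt_id' x).sub_const s).div_const 2).neg.exp
  refine this.congr_deriv ?_
  simp; ring

theorem tendsto_sub_div_two (s : ℝ) : Tendsto (fun x : ℝ => (x - s) / 2) atTop atTop :=
  (tendsto_atTop_add_const_right _ (-s) tendsto_id).atTop_div_const two_pos

theorem lintegral_tail_exp (s σ : ℝ) :
    ∫⁻ τ in Ioi σ, ENNReal.ofReal (2 * Real.exp (-((τ - s) / 2))) =
      ENNReal.ofReal (4 * Real.exp (-((σ - s) / 2))) := by
  rw [lintegral_Ioi_ofReal_eq (F := fun τ => -4 * Real.exp (-((τ - s) / 2)))]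
  · simp
  · intro x
    exact ((hasDerivAt_exp_neg_half s x).const_mul (-4)).congr_deriv (by ring)
  · intro x _; positivity
  · have := (Real.tendsto_exp_neg_atTop_nhds_zero.comp (tendsto_sub_div_two s)).const_mul (-4)
    simpa using this

theorem lintegral_tail_mul_exp {s σ : ℝ} (h : s ≤ σ) :
    ∫⁻ τ in Ioi σ, ENNReal.ofReal (2 * (τ - s) * Real.exp (-((τ - s) / 2))) =
      ENNReal.ofReal ((4 * (σ - s) + 8) * Real.exp (-((σ - s) / 2))) := by
  rw [lintegral_Ioi_ofReal_eq (F := fun τ => -(4 * (τ - s) + 8) * Real.exp (-((τ - s) / 2)))]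
  · congr 1; ring
  · intro x
    have h1 : HasDerivAt (fun τ => -(4 * (τ - s) + 8)) (-4) x := by
      exact ((((hasDerivAt_id' x).sub_const s).const_mul 4).add_const 8).fun_neg.congr_deriv
        (by norm_num)
    exact (h1.fun_mul (hasDerivAt_exp_neg_half s x)).congr_deriv (by ring)
  · intro x hx
    have : 0 ≤ x - s := by linarith [mem_Ioi.1 hx]
    positivity
  · have h1 := ((Real.tendsto_pow_mul_exp_neg_atTop_nhds_zero 1).comp
      (tendsto_sub_div_two s)).const_mul (-8)
    have h2 := (Real.tendsto_exp_neg_atTop_nhds_zero.comp (tendsto_sub_div_two s)).const_mul (-8)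
    have h3 := h1.add h2
    simp only [mul_zero, add_zero] at h3
    refine h3.congr fun x => ?_
    simp only [Function.comp_apply]
    ring

theorem lintegral_mul_lintegral_Ioc {s : ℝ} {A q : ℝ → ℝ≥0∞} (hA : Measurable A)
    (hq : AEMeasurable q (volume.restrict (Ioi s))) :
    ∫⁻ τ in Ioi s, A τ * ∫⁻ σ in Ioc s τ, q σ = ∫⁻ σ in Ioi s, q σ * ∫⁻ τ in Ioi σ, A τ := by
  have h1 : ∀ τ, A τ * ∫⁻ σ in Ioc s τ, q σ =
      ∫⁻ σ in Ioi s, A τ * (Iic τ).indicator q σ := by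
    intro τ
    rw [lintegral_const_mul'' _ (hq.indicator measurableSet_Iic), lintegral_indicator
      measurableSet_Iic, Measure.restrict_restrict measurableSet_Iic, inter_comm, Ioi_inter_Iic]
  simp_rw [h1]
  rw [lintegral_lintegral_swap]
  · refine setLIntegral_congr_fun measurableSet_Ioi fun σ (hσ : s < σ) => ?_
    have h2 : ∀ τ, A τ * (Iic τ).indicator q σ = q σ * (Ici σ).indicator A τ := by
      intro τ
      by_cases h : σ ≤ τ <;> simp [indicator, h, mul_comm]
    simp only [h2]
    rw [lintegral_const_mul _ (hA.indicator measurableSet_Ici), lintegral_indicator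
      measurableSet_Ici, Measure.restrict_restrict measurableSet_Ici]
    have : Ici σ ∩ Ioi s = Ici σ := inter_eq_left.2 fun x hx => lt_of_lt_of_le hσ hx
    rw [this, setLIntegral_congr Ioi_ae_eq_Ici]
  · have hS : MeasurableSet {z : ℝ × ℝ | z.2 ≤ z.1} :=
      measurableSet_le measurable_snd measurable_fst
    have : (Function.uncurry fun τ σ => A τ * (Iic τ).indicator q σ) =
        {z : ℝ × ℝ | z.2 ≤ z.1}.indicator (fun z => A z.1 * q z.2) := by
      ext ⟨τ, σ⟩
      by_cases h : σ ≤ τ <;> simp [indicator, h]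
    rw [this]
    exact ((hA.comp measurable_fst).aemeasurable.mul hq.comp_snd).indicator hS

variable {h : ℝ → ℝ≥0∞} {s : ℝ}

/-- Cauchy–Schwarz for `h = e^{(σ-s)/4} · e^{-(σ-s)/4} h`. The resulting growth `e^{(τ-s)/2}`
consumes half of the decay of the weight `e^{-(τ-s)}`; after Tonelli, the tail integral and the
inner weight each contribute `e^{-(σ-s)/2}`. -/
theorem sq_lintegral_Ioc_le (hh : AEMeasurable h (volume.restrict (Ioi s))) {τ : ℝ} (hτ : s ≤ τ) :
    (∫⁻ σ in Ioc s τ, h σ) ^ 2 ≤ ENNReal.ofReal (2 * Real.exp ((τ - s) / 2)) *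
      ∫⁻ σ in Ioc s τ, ENNReal.ofReal (Real.exp (-((σ - s) / 2))) * h σ ^ 2 := by
  have hh' : AEMeasurable h (volume.restrict (Ioc s τ)) :=
    hh.mono_measure (Measure.restrict_mono Ioc_subset_Ioi_self le_rfl)
  have hm : ∀ c : ℝ, Measurable fun σ : ℝ => ENNReal.ofReal (Real.exp (c * (σ - s))) :=
    fun c => by fun_prop
  have hcs := sq_lintegral_mul_le (volume.restrict (Ioc s τ)) (hm (1 / 4)).aemeasurable
    ((hm (-(1 / 4))).aemeasurable.mul hh')
  have e1 : ∀ σ, ENNReal.ofReal (Real.exp (1 / 4 * (σ - s))) *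
      ((fun σ => ENNReal.ofReal (Real.exp (-(1 / 4) * (σ - s)))) * h) σ = h σ := fun σ => by
    rw [Pi.mul_apply, ← mul_assoc, ← ENNReal.ofReal_mul (Real.exp_pos _).le, ← Real.exp_add]
    ring_nf
    simp
  have e2 : ∀ σ, ((fun σ => ENNReal.ofReal (Real.exp (-(1 / 4) * (σ - s)))) * h) σ ^ 2 =
      ENNReal.ofReal (Real.exp (-((σ - s) / 2))) * h σ ^ 2 := fun σ => by
    rw [Pi.mul_apply, mul_pow, ← ENNReal.ofReal_pow (Real.exp_pos _).le, ← Real.exp_nat_mul]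
    push_cast
    ring_nf
  have e3 : ∀ σ, ENNReal.ofReal (Real.exp (1 / 4 * (σ - s))) ^ 2 =
      ENNReal.ofReal (Real.exp ((σ - s) / 2)) := fun σ => by
    rw [← ENNReal.ofReal_pow (Real.exp_pos _).le, ← Real.exp_nat_mul]
    push_cast
    ring_nf
  simp only [e1, e2, e3] at hcs
  refine hcs.trans (mul_le_mul_left ?_ _)
  have hc : Continuous fun σ : ℝ => Real.exp ((σ - s) / 2) := by fun_prop
  rw [← ofReal_integral_eq_lintegral_ofReal hc.integrableOn_Ioc
    (Eventually.of_forall fun σ => (Real.exp_pos _).le), ← intervalIntegral.integral_of_le hτ,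
    intervalIntegral.integral_eq_sub_of_hasDerivAt (f := fun σ => 2 * Real.exp ((σ - s) / 2))
      (fun σ _ => ?_) (hc.intervalIntegrable _ _)]
  · exact ENNReal.ofReal_le_ofReal (sub_le_self _ (by positivity))
  · have := ((((hasDerivAt_id' σ).sub_const s).div_const 2).exp).const_mul 2
    exact this.congr_deriv (by ring)

theorem lintegral_mul_sq_lintegral_Ioc_le (hh : AEMeasurable h (volume.restrict (Ioi s)))
    {w : ℝ → ℝ} (hw : Measurable w) (hw0 : ∀ τ ∈ Ioi s, 0 ≤ w τ) :
    ∫⁻ τ in Ioi s, ENNReal.ofReal (w τ) * (∫⁻ σ in Ioc s τ, h σ) ^ 2 ≤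
      ∫⁻ σ in Ioi s, ENNReal.ofReal (Real.exp (-((σ - s) / 2))) * h σ ^ 2 *
        ∫⁻ τ in Ioi σ, ENNReal.ofReal (w τ * (2 * Real.exp ((τ - s) / 2))) := by
  have hm : AEMeasurable (fun σ => ENNReal.ofReal (Real.exp (-((σ - s) / 2))) * h σ ^ 2)
      (volume.restrict (Ioi s)) :=
    (by fun_prop : Measurable fun σ : ℝ =>
      ENNReal.ofReal (Real.exp (-((σ - s) / 2)))).aemeasurable.mul (hh.pow_const 2)
  rw [← lintegral_mul_lintegral_Ioc (by fun_prop) hm]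
  refine setLIntegral_mono' measurableSet_Ioi fun τ hτ => ?_
  rw [ENNReal.ofReal_mul (hw0 τ hτ), mul_assoc]
  gcongr
  exact sq_lintegral_Ioc_le hh (le_of_lt hτ)

/-- Hardy's inequality for `𝒜`. -/
theorem avg_sq_lintegral_le (hh : AEMeasurable h (volume.restrict (Ioi s))) :
    avg (fun τ => (∫⁻ σ in Ioc s τ, h σ) ^ 2) s ≤ 4 * avg (fun τ => h τ ^ 2) s := by
  refine (lintegral_mul_sq_lintegral_Ioc_le hh (by fun_prop)
    fun τ _ => (Real.exp_pos _).le).trans ?_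
  have e : ∀ τ, Real.exp (-(τ - s)) * (2 * Real.exp ((τ - s) / 2)) =
      2 * Real.exp (-((τ - s) / 2)) := fun τ => by
    rw [mul_left_comm, ← Real.exp_add]; ring_nf
  simp only [e, lintegral_tail_exp]
  rw [avg, ← lintegral_const_mul' _ _ (by simp)]
  refine le_of_eq (lintegral_congr fun σ => ?_)
  rw [mul_right_comm, ← ENNReal.ofReal_mul (Real.exp_pos _).le, mul_left_comm, ← Real.exp_add,
    ENNReal.ofReal_mul (by norm_num), ← mul_assoc]
  norm_num
  ring_nf

/-- Hardy's inequality for `𝒜²`. -/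
theorem avg2_sq_lintegral_le (hh : AEMeasurable h (volume.restrict (Ioi s))) :
    avg2 (fun τ => (∫⁻ σ in Ioc s τ, h σ) ^ 2) s ≤
      4 * avg2 (fun τ => h τ ^ 2) s + 8 * avg (fun τ => h τ ^ 2) s := by
  have hpos : ∀ τ ∈ Ioi s, 0 ≤ τ - s := fun τ hτ => sub_nonneg.2 (le_of_lt hτ)
  refine (lintegral_mul_sq_lintegral_Ioc_le hh (by fun_prop)
    fun τ hτ => mul_nonneg (Real.exp_pos _).le (hpos τ hτ)).trans ?_
  have e : ∀ τ, Real.exp (-(τ - s)) * (τ - s) * (2 * Real.exp ((τ - s) / 2)) =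
      2 * (τ - s) * Real.exp (-((τ - s) / 2)) := fun τ => by
    have : Real.exp (-(τ - s)) * Real.exp ((τ - s) / 2) = Real.exp (-((τ - s) / 2)) := by
      rw [← Real.exp_add]; ring_nf
    rw [← this]; ring
  simp only [e]
  rw [avg, avg2, ← lintegral_const_mul' _ _ (by simp), ← lintegral_const_mul' _ _ (by simp)]
  have hm : AEMeasurable (fun σ => 4 * (ENNReal.ofReal (Real.exp (-(σ - s)) * (σ - s)) * h σ ^ 2))
      (volume.restrict (Ioi s)) :=
    ((by fun_prop : Measurable fun σ : ℝ =>
      ENNReal.ofReal (Real.exp (-(σ - s)) * (σ - s))).aemeasurable.mul (hh.pow_const 2)).const_mul _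
  rw [← lintegral_add_left' hm]
  refine setLIntegral_mono' measurableSet_Ioi fun σ hσ => ?_
  rw [lintegral_tail_mul_exp (le_of_lt hσ), ← mul_assoc 4, ← mul_assoc 8, ← add_mul,
    mul_right_comm]
  gcongr
  have h4 : (4 : ℝ≥0∞) = ENNReal.ofReal 4 := by norm_num
  have h8 : (8 : ℝ≥0∞) = ENNReal.ofReal 8 := by norm_num
  have := hpos σ hσ
  rw [h4, h8, ← ENNReal.ofReal_mul (Real.exp_pos _).le,
    ← ENNReal.ofReal_mul (by norm_num : (0 : ℝ) ≤ 4),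
    ← ENNReal.ofReal_mul (by norm_num : (0 : ℝ) ≤ 8), ← ENNReal.ofReal_add (by positivity)
      (by positivity)]
  apply ENNReal.ofReal_le_ofReal
  have : Real.exp (-((σ - s) / 2)) * Real.exp (-((σ - s) / 2)) = Real.exp (-(σ - s)) := by
    rw [← Real.exp_add]; ring_nf
  rw [mul_left_comm, this]
  apply le_of_eq
  ring

theorem avg2_one (s : ℝ) : avg2 (fun _ => 1) s = 1 := by
  simp only [avg2, mul_one]
  rw [lintegral_Ioi_ofReal_eq (F := fun τ => -(1 + τ - s) * Real.exp (-(τ - s)))]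
  · simp
  · intro x
    have h1 : HasDerivAt (fun τ => -(1 + τ - s)) (-1) x := by
      exact (((hasDerivAt_id' x).const_add 1).sub_const s).fun_neg
    have h2 : HasDerivAt (fun τ => Real.exp (-(τ - s))) (-Real.exp (-(x - s))) x := by
      simpa using ((hasDerivAt_id' x).sub_const s).neg.exp
    exact (h1.fun_mul h2).congr_deriv (by ring)
  · intro x hx
    have : 0 ≤ x - s := by linarith [mem_Ioi.1 hx]
    positivity
  · have ht : Tendsto (fun x : ℝ => x - s) atTop atTop :=
      tendsto_atTop_add_const_right _ (-s) tendsto_id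
    have h1 := ((Real.tendsto_pow_mul_exp_neg_atTop_nhds_zero 1).comp ht).neg
    have h2 := (Real.tendsto_exp_neg_atTop_nhds_zero.comp ht).neg
    have h3 := h1.add h2
    simp only [neg_zero, add_zero] at h3
    refine h3.congr fun x => ?_
    simp only [Function.comp_apply]
    ring

/-- Jensen's inequality, since the kernel of `𝒜²` has total mass one by `avg2_one`. -/
theorem sq_avg2_le (hh : AEMeasurable h (volume.restrict (Ioi s))) :
    avg2 h s ^ 2 ≤ avg2 (fun τ => h τ ^ 2) s := by
  have hk : Measurable fun τ : ℝ => ENNReal.ofReal (Real.exp (-(τ - s)) * (τ - s)) := by fun_prop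
  set k := fun τ : ℝ => ENNReal.ofReal (Real.exp (-(τ - s)) * (τ - s)) with hkdef
  have hk2 : Measurable fun τ => k τ ^ (1 / 2 : ℝ) := hk.pow_const _
  have e : ∀ x : ℝ≥0∞, (x ^ (1 / 2 : ℝ)) ^ 2 = x := fun x => by
    rw [← ENNReal.rpow_two, ← ENNReal.rpow_mul]; norm_num
  have hcs := sq_lintegral_mul_le (volume.restrict (Ioi s)) hk2.aemeasurable
    (hk2.aemeasurable.mul hh)
  simp only [Pi.mul_apply, mul_pow, e, ← mul_assoc, ← pow_two] at hcs
  have h1 : ∫⁻ τ in Ioi s, k τ = 1 := by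
    have := avg2_one s
    simpa only [avg2, mul_one] using this
  rw [h1, one_mul] at hcs
  exact hcs

theorem avg2_le_rpow (hh : AEMeasurable h (volume.restrict (Ioi s))) :
    avg2 h s ≤ avg2 (fun τ => h τ ^ 2) s ^ (1 / 2 : ℝ) := by
  have := ENNReal.rpow_le_rpow (sq_avg2_le hh) (show (0 : ℝ) ≤ 1 / 2 by norm_num)
  rwa [← ENNReal.rpow_two, ← ENNReal.rpow_mul, show (2 : ℝ) * (1 / 2) = 1 by norm_num,
    ENNReal.rpow_one] at this

theorem aemeasurable_avg2 (hh : AEMeasurable h (volume.restrict (Ioi 0))) :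
    AEMeasurable (avg2 h) (volume.restrict (Ioi 0)) := by
  have h1 : ∀ s ∈ Ioi (0 : ℝ), avg2 h s = ∫⁻ τ in Ioi 0, (Ioi s).indicator
      (fun τ => ENNReal.ofReal (Real.exp (-(τ - s)) * (τ - s)) * h τ) τ := by
    intro s hs
    rw [lintegral_indicator measurableSet_Ioi, Measure.restrict_restrict measurableSet_Ioi,
      Ioi_inter_Ioi, sup_eq_left.2 (le_of_lt (mem_Ioi.1 hs)), avg2]
  refine AEMeasurable.congr ?_ ((ae_restrict_iff' measurableSet_Ioi).2
    (Eventually.of_forall fun s hs => (h1 s hs).symm))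
  refine AEMeasurable.lintegral_prod_right ?_
  have hS : MeasurableSet {z : ℝ × ℝ | z.1 < z.2} :=
    measurableSet_lt measurable_fst measurable_snd
  have : (Function.uncurry fun s τ => (Ioi s).indicator
      (fun τ => ENNReal.ofReal (Real.exp (-(τ - s)) * (τ - s)) * h τ) τ) =
      {z : ℝ × ℝ | z.1 < z.2}.indicator
        (fun z => ENNReal.ofReal (Real.exp (-(z.2 - z.1)) * (z.2 - z.1)) * h z.2) := by
    ext ⟨s, τ⟩
    by_cases hs : s < τ <;> simp [indicator, hs]
  rw [this]
  refine AEMeasurable.indicator ?_ hS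
  exact Measurable.aemeasurable (by fun_prop) |>.mul hh.comp_snd

theorem avg2_mono {h₁ h₂ : ℝ → ℝ≥0∞} (hle : ∀ τ ∈ Ioi s, h₁ τ ≤ h₂ τ) :
    avg2 h₁ s ≤ avg2 h₂ s :=
  setLIntegral_mono' measurableSet_Ioi fun τ hτ => mul_le_mul_right (hle τ hτ) _

theorem avg2_add {h₁ h₂ : ℝ → ℝ≥0∞} (hm : AEMeasurable h₁ (volume.restrict (Ioi s))) :
    avg2 (fun τ => h₁ τ + h₂ τ) s = avg2 h₁ s + avg2 h₂ s := by
  simp only [avg2, mul_add]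
  have : Measurable fun τ : ℝ => ENNReal.ofReal (Real.exp (-(τ - s)) * (τ - s)) := by fun_prop
  exact lintegral_add_left' (this.aemeasurable.mul hm) _

theorem avg2_const_mul {c : ℝ≥0∞} (hc : c ≠ ⊤) (h : ℝ → ℝ≥0∞) (s : ℝ) :
    avg2 (fun τ => c * h τ) s = c * avg2 h s := by
  simp only [avg2]
  rw [← lintegral_const_mul' _ _ hc]
  exact lintegral_congr fun τ => by ring

theorem avg_const_mul {c : ℝ≥0∞} (hc : c ≠ ⊤) (h : ℝ → ℝ≥0∞) (s : ℝ) :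
    avg (fun τ => c * h τ) s = c * avg h s := by
  simp only [avg]
  rw [← lintegral_const_mul' _ _ hc]
  exact lintegral_congr fun τ => by ring

end Hardy
-- A quadratic Gronwall lemma
section Gronwall

/-- `R = √A + ½∫b` satisfies `R² = A + ∫ b R`, the case of equality in the hypothesis. Raising `A`
by `η > 0` makes the comparison strict, and `η` tends to `0` at the end. -/
theorem le_sq_of_sq_le_add_integral {A t : ℝ} {b k : ℝ → ℝ} (hA : 0 ≤ A) (ht : 0 ≤ t)
    (hb : IntervalIntegrable b volume 0 t) (hb0 : ∀ s, 0 ≤ b s)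
    (hk : ContinuousOn k (Icc 0 t))
    (h : ∀ s ∈ Icc 0 t, k s ^ 2 ≤ A + ∫ r in (0 : ℝ)..s, b r * k r) :
    A + ∫ r in (0 : ℝ)..t, b r * k r ≤ (√A + 1 / 2 * ∫ r in (0 : ℝ)..t, b r) ^ 2 := by
  have hbk : IntervalIntegrable (fun r => b r * k r) volume 0 t :=
    hb.mul_continuousOn (by rwa [uIcc_of_le ht])
  have main : ∀ η > 0, A + ∫ r in (0 : ℝ)..t, b r * k r ≤
      (√(A + η) + 1 / 2 * ∫ r in (0 : ℝ)..t, b r) ^ 2 := by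
    intro η hη
    set R : ℝ → ℝ := fun s => √(A + η) + ∫ r in (0 : ℝ)..s, 1 / 2 * b r with hR
    set Z : ℝ → ℝ := fun s => A + ∫ r in (0 : ℝ)..s, b r * k r with hZ
    have hsub : ∀ s ∈ Icc 0 t, uIcc 0 s ⊆ uIcc 0 t := fun s hs => by
      rw [uIcc_of_le hs.1, uIcc_of_le ht]; exact Icc_subset_Icc_right hs.2
    have hb2 : IntervalIntegrable (fun r => 1 / 2 * b r) volume 0 t := hb.const_mul _
    have hRc : ContinuousOn R (Icc 0 t) := by
      have := continuousOn_primitive_uIcc hb2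
      rw [uIcc_of_le ht] at this
      exact this.const_add _
    have hZc : ContinuousOn Z (Icc 0 t) := by
      have := continuousOn_primitive_uIcc hbk
      rw [uIcc_of_le ht] at this
      exact this.const_add _
    have hR0 : ∀ s ∈ Icc 0 t, 0 ≤ R s := fun s hs => add_nonneg (Real.sqrt_nonneg _)
      (intervalIntegral.integral_nonneg hs.1 fun r _ => mul_nonneg (by norm_num) (hb0 r))
    have hRsq : ∀ s ∈ Icc 0 t, IntervalIntegrable (fun r => b r * R r) volume 0 s ∧
        R s ^ 2 = A + η + ∫ r in (0 : ℝ)..s, b r * R r := by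
      intro s hs
      have hb3 : IntervalIntegrable (fun r => 1 / 2 * b r) volume 0 s := hb2.mono_set (hsub s hs)
      have hRe : ∀ r ∈ Icc 0 s, R r = R 0 + ∫ x in (0 : ℝ)..r, 1 / 2 * b x := fun r _ => by
        simp [hR]
      obtain ⟨i1, i2, e⟩ := bilin_sub_eq_integral (ContinuousLinearMap.mul ℝ ℝ) hs.1 hb3 hb3 hRe hRe
      simp only [ContinuousLinearMap.mul_apply'] at i1 i2 e
      have e2 : ∀ r, 1 / 2 * b r * R r + R r * (1 / 2 * b r) = b r * R r := fun r => by ring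
      refine ⟨by simpa only [e2] using i1.add i2, ?_⟩
      simp only [e2] at e
      have hR00 : R 0 * R 0 = A + η := by
        simp [hR, Real.mul_self_sqrt (by positivity : 0 ≤ A + η)]
      rw [pow_two, e, hR00]
    -- Before a first time of contact `k < R`, so there `Z ≤ A + ∫ b R = R² - η`, contradicting the
    -- contact.
    have hlt : ∀ s ∈ Icc 0 t, Z s < R s ^ 2 := by
      by_contra! hcon
      have hcl : IsClosed {s ∈ Icc 0 t | R s ^ 2 ≤ Z s} :=
        isClosed_Icc.isClosed_le (hRc.pow 2) hZc
      have hcp : IsCompact {s ∈ Icc 0 t | R s ^ 2 ≤ Z s} :=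
        isCompact_Icc.of_isClosed_subset hcl fun s hs => hs.1
      obtain ⟨s₀, ⟨hs₀, hle⟩, hmin⟩ := hcp.exists_isLeast hcon
      obtain ⟨i1, e⟩ := hRsq s₀ hs₀
      have : ∫ r in (0 : ℝ)..s₀, b r * k r ≤ ∫ r in (0 : ℝ)..s₀, b r * R r := by
        refine intervalIntegral.integral_mono_on_of_le_Ioo hs₀.1 (hbk.mono_set (hsub s₀ hs₀)) i1
          fun r hr => ?_
        have hr' : r ∈ Icc 0 t := ⟨hr.1.le, hr.2.le.trans hs₀.2⟩
        have hZR : Z r < R r ^ 2 := by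
          by_contra! hc
          exact absurd (hmin ⟨hr', hc⟩) (not_le.2 hr.2)
        have := (h r hr').trans_lt hZR
        exact mul_le_mul_of_nonneg_left (lt_of_pow_lt_pow_left₀ 2 (hR0 r hr') this).le (hb0 r)
      rw [e] at hle
      simp only [hZ] at hle
      linarith
    have := (hlt t ⟨ht, le_rfl⟩).le
    simpa only [hZ, hR, intervalIntegral.integral_const_mul] using this
  have hc : Tendsto (fun η : ℝ => (√(A + η) + 1 / 2 * ∫ r in (0 : ℝ)..t, b r) ^ 2) (𝓝[>] 0)
      (𝓝 ((√(A + 0) + 1 / 2 * ∫ r in (0 : ℝ)..t, b r) ^ 2)) := by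
    refine Tendsto.mono_left (Continuous.tendsto ?_ 0) nhdsWithin_le_nhds
    fun_prop
  rw [add_zero] at hc
  exact ge_of_tendsto hc (by filter_upwards [self_mem_nhdsWithin] with η hη using main η hη)

end Gronwall

/-! ### Absorbing the source: the energy balance -/

section EnergyEstimate
variable {n : ℕ} {W G : L2 n → ℝ≥0∞} {w₀ w₁ : L2 n} {f : ℝ → L2 n} {ε tε : ℝ} {φ : ℝ → L2 n}
  {u : H2loc (L2 n)}

/-- A minimizer with finite energy, together with the properties of the functionals that the energy
estimates use. -/
structure RegularMinimizer (W G : L2 n → ℝ≥0∞) (w₀ w₁ : L2 n) (f : ℝ → L2 n) (ε tε : ℝ)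
    (φ : ℝ → L2 n) (u : H2loc (L2 n)) : Prop where
  pos : 0 < ε
  homog : ∀ c : ℝ, 0 < c → ∀ v, G (c • v) = ENNReal.ofReal (c ^ 2) * G v
  measW : AEMeasurable (fun s => W (u.toFun s)) (volume.restrict (Ioi 0))
  measG : AEMeasurable (fun s => G (u.d1 s)) (volume.restrict (Ioi 0))
  isSource : IsSource f ε tε φ
  isMinimizer : IsMinimizer W G w₀ w₁ φ ε u
  finite : posPart W G ε u ≠ ⊤

/-- The density `‖u''‖²/(2ε²)`. -/
noncomputable def accel (ε : ℝ) (u : H2loc (L2 n)) (s : ℝ) : ℝ≥0∞ :=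
  ENNReal.ofReal (1 / (2 * ε ^ 2) * ‖u.d2 s‖ ^ 2)

/-- The density `‖φ‖²`. -/
noncomputable def sqNorm (φ : ℝ → L2 n) (s : ℝ) : ℝ≥0∞ := ENNReal.ofReal (‖φ s‖ ^ 2)

theorem ofReal_norm_d1_le (u : H2loc (L2 n)) {s τ : ℝ} (hs : 0 ≤ s) (hτ : s ≤ τ) :
    ENNReal.ofReal ‖u.d1 τ‖ ≤ ENNReal.ofReal ‖u.d1 s‖ +
      ∫⁻ σ in Ioc s τ, ENNReal.ofReal ‖u.d2 σ‖ := by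
  have h1 : u.d1 τ = u.d1 s + ∫ σ in s..τ, u.d2 σ := by
    rw [u.d1_eq τ (hs.trans hτ), u.d1_eq s hs, add_assoc,
      intervalIntegral.integral_add_adjacent_intervals (u.intervalIntegrable_d2 hs)]
    refine (u.intervalIntegrable_d2 (hs.trans hτ)).mono_set ?_
    rw [uIcc_of_le hτ, uIcc_of_le (hs.trans hτ)]
    exact Icc_subset_Icc_left hs
  simp only [ofReal_norm]
  rw [h1, intervalIntegral.integral_of_le hτ]
  exact (enorm_add_le _ _).trans (by gcongr; exact enorm_integral_le_lintegral_enorm _)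

/-- Young's inequality with a prescribed balance: `1/(16ε²)` times Hardy's constant `8` is
`1/(2ε²)`, the coefficient in the acceleration density. -/
theorem ofReal_mul_le_add_sq (hε : 0 < ε) {x : ℝ} (hx : 0 ≤ x) (y : ℝ≥0∞) :
    ENNReal.ofReal x * y ≤ ENNReal.ofReal (4 * ε ^ 2) * ENNReal.ofReal (x ^ 2) +
      ENNReal.ofReal (1 / (16 * ε ^ 2)) * y ^ 2 := by
  rcases eq_or_ne y ⊤ with rfl | hy
  · rw [ENNReal.top_pow two_ne_zero, ENNReal.mul_top (a := ENNReal.ofReal (1 / (16 * ε ^ 2)))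
      (by rw [Ne, ENNReal.ofReal_eq_zero, not_le]; positivity)]
    simp
  · obtain ⟨z, hz, rfl⟩ : ∃ z : ℝ, 0 ≤ z ∧ y = ENNReal.ofReal z :=
      ⟨y.toReal, ENNReal.toReal_nonneg, (ENNReal.ofReal_toReal hy).symm⟩
    rw [← ENNReal.ofReal_pow hz, ← ENNReal.ofReal_mul hx, ← ENNReal.ofReal_mul (by positivity),
      ← ENNReal.ofReal_mul (by positivity), ← ENNReal.ofReal_add (by positivity) (by positivity)]
    apply ENNReal.ofReal_le_ofReal
    have h : 4 * ε ^ 2 * x ^ 2 + 1 / (16 * ε ^ 2) * z ^ 2 - x * z =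
        (2 * ε * x - 1 / (4 * ε) * z) ^ 2 := by field_simp; ring
    nlinarith [sq_nonneg (2 * ε * x - 1 / (4 * ε) * z)]

theorem aemeasurable_sqNorm (hφ : IsSource f ε tε φ) :
    AEMeasurable (sqNorm φ) (volume.restrict (Ioi 0)) :=
  (hφ.meas.norm.pow 2).aemeasurable.ennreal_ofReal

theorem aemeasurable_accel : AEMeasurable (accel ε u) (volume.restrict (Ioi 0)) :=
  ((u.aestronglyMeasurable_d2.norm.pow 2).const_mul _).aemeasurable.ennreal_ofReal

theorem AEMeasurable.mono_Ioi {h : ℝ → ℝ≥0∞} (hh : AEMeasurable h (volume.restrict (Ioi 0)))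
    {s : ℝ} (hs : 0 ≤ s) : AEMeasurable h (volume.restrict (Ioi s)) :=
  hh.mono_measure (Measure.restrict_mono (Ioi_subset_Ioi hs) le_rfl)

/-- `‖u'(τ)‖` exceeds `‖u'(s)‖` by at most `∫_s^τ ‖u''‖`. The factor `‖u'(s)‖` leaves the average,
and Jensen treats the remaining `‖φ‖`; the excess is handled by Young's inequality and then Hardy's
for `𝒜²`. -/
theorem avg2_source_le (hε : 0 < ε) (hφ : IsSource f ε tε φ) (u : H2loc (L2 n)) {s : ℝ}
    (hs : 0 ≤ s) :
    avg2 (fun τ => ENNReal.ofReal (‖φ τ‖ * ‖u.d1 τ‖)) s ≤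
      ENNReal.ofReal ‖u.d1 s‖ * avg2 (sqNorm φ) s ^ (1 / 2 : ℝ) +
      ENNReal.ofReal (4 * ε ^ 2) * avg2 (sqNorm φ) s + (avg2 (accel ε u) s + avg (accel ε u) s) := by
  set Δ : ℝ → ℝ≥0∞ := fun τ => ∫⁻ σ in Ioc s τ, ENNReal.ofReal ‖u.d2 σ‖ with hΔ
  have hφm : AEMeasurable (fun τ => ENNReal.ofReal ‖φ τ‖) (volume.restrict (Ioi s)) :=
    AEMeasurable.mono_Ioi hφ.meas.norm.aemeasurable.ennreal_ofReal hs
  have hum : AEMeasurable (fun τ => ENNReal.ofReal ‖u.d2 τ‖) (volume.restrict (Ioi s)) :=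
    AEMeasurable.mono_Ioi u.aestronglyMeasurable_d2.norm.aemeasurable.ennreal_ofReal hs
  have hsq := AEMeasurable.mono_Ioi (aemeasurable_sqNorm hφ) hs
  have h1 : avg2 (fun τ => ENNReal.ofReal (‖φ τ‖ * ‖u.d1 τ‖)) s ≤
      avg2 (fun τ => ENNReal.ofReal ‖u.d1 s‖ * ENNReal.ofReal ‖φ τ‖ +
        (ENNReal.ofReal (4 * ε ^ 2) * sqNorm φ τ +
          ENNReal.ofReal (1 / (16 * ε ^ 2)) * Δ τ ^ 2)) s := by
    refine avg2_mono fun τ hτ => ?_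
    rw [ENNReal.ofReal_mul (norm_nonneg _)]
    calc _ ≤ ENNReal.ofReal ‖φ τ‖ * (ENNReal.ofReal ‖u.d1 s‖ + Δ τ) := by
          gcongr; exact ofReal_norm_d1_le u hs (le_of_lt hτ)
      _ = ENNReal.ofReal ‖u.d1 s‖ * ENNReal.ofReal ‖φ τ‖ + ENNReal.ofReal ‖φ τ‖ * Δ τ := by ring
      _ ≤ _ := by gcongr; exact ofReal_mul_le_add_sq hε (norm_nonneg _) _
  rw [avg2_add (hφm.const_mul _), avg2_add (hsq.const_mul _), avg2_const_mul ENNReal.ofReal_ne_top,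
    avg2_const_mul ENNReal.ofReal_ne_top, avg2_const_mul ENNReal.ofReal_ne_top] at h1
  refine h1.trans ?_
  rw [← add_assoc]
  refine add_le_add (add_le_add (mul_le_mul_right ?_ _) le_rfl) ?_
  · have := avg2_le_rpow hφm
    simp only [← ENNReal.ofReal_pow (norm_nonneg _)] at this
    exact this
  · have h2 := avg2_sq_lintegral_le hum
    simp only [← ENNReal.ofReal_pow (norm_nonneg _)] at h2
    have e : accel ε u = fun τ => ENNReal.ofReal (1 / (2 * ε ^ 2)) *
        ENNReal.ofReal (‖u.d2 τ‖ ^ 2) := by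
      ext τ; rw [accel, ENNReal.ofReal_mul (by positivity)]
    rw [e, avg2_const_mul ENNReal.ofReal_ne_top, avg_const_mul ENNReal.ofReal_ne_top]
    have h4 : (4 : ℝ≥0∞) = ENNReal.ofReal 4 := by norm_num
    have h8 : (8 : ℝ≥0∞) = ENNReal.ofReal 8 := by norm_num
    calc _ ≤ ENNReal.ofReal (1 / (16 * ε ^ 2)) *
          (4 * avg2 (fun τ => ENNReal.ofReal (‖u.d2 τ‖ ^ 2)) s +
          8 * avg (fun τ => ENNReal.ofReal (‖u.d2 τ‖ ^ 2)) s) := by gcongr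
      _ ≤ _ := by
        rw [mul_add, ← mul_assoc, ← mul_assoc, h4, h8, ← ENNReal.ofReal_mul (by positivity),
          ← ENNReal.ofReal_mul (by positivity)]
        gcongr
        · rw [div_mul_eq_mul_div, div_le_div_iff₀ (by positivity) (by positivity)]
          nlinarith [sq_nonneg ε]
        · rw [div_mul_eq_mul_div, div_le_div_iff₀ (by positivity) (by positivity)]
          nlinarith [sq_nonneg ε]

/-- The contribution of the source to the energy balance on `[0,T]`. -/
noncomputable def sourceBound (ε : ℝ) (φ : ℝ → L2 n) (u : H2loc (L2 n)) (T : ℝ) : ℝ≥0∞ :=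
  (∫⁻ s in Ioc 0 T, ENNReal.ofReal ‖u.d1 s‖ * avg2 (sqNorm φ) s ^ (1 / 2 : ℝ)) +
    ENNReal.ofReal (4 * ε ^ 2) * ∫⁻ s in Ioc 0 T, avg2 (sqNorm φ) s

/-- Integrated over `(0,T)`, the averages `𝒜² + 𝒜` of the acceleration acquire the weight
`e^{-y}(kerOne + kerTwo)`, precisely the one in `energy_inequality`. -/
theorem lintegral_kerTwo_source_le (hε : 0 < ε) (hφ : IsSource f ε tε φ) (u : H2loc (L2 n))
    {T : ℝ} (hT : 0 ≤ T) :
    ∫⁻ y in Ioi 0, ENNReal.ofReal (Real.exp (-y) * kerTwo T y) *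
      ENNReal.ofReal (‖φ y‖ * ‖u.d1 y‖) ≤
    sourceBound ε φ u T +
      ∫⁻ y in Ioi 0, ENNReal.ofReal (Real.exp (-y) * (kerOne T y + kerTwo T y)) * accel ε u y := by
  have hm0 : AEMeasurable (fun y => ENNReal.ofReal (‖φ y‖ * ‖u.d1 y‖))
      (volume.restrict (Ioi 0)) :=
    (hφ.meas.norm.mul u.aestronglyMeasurable_d1.norm).aemeasurable.ennreal_ofReal
  have hIoc : Ioc 0 T ⊆ Ioi (0 : ℝ) := Ioc_subset_Ioi_self
  have hP : AEMeasurable (avg2 (sqNorm φ)) (volume.restrict (Ioc 0 T)) :=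
    (aemeasurable_avg2 (aemeasurable_sqNorm hφ)).mono_measure (Measure.restrict_mono hIoc le_rfl)
  have hd : AEMeasurable (fun s => ENNReal.ofReal ‖u.d1 s‖) (volume.restrict (Ioc 0 T)) :=
    u.aestronglyMeasurable_d1.norm.aemeasurable.ennreal_ofReal.mono_measure
      (Measure.restrict_mono hIoc le_rfl)
  have hacc : AEMeasurable (avg2 (accel ε u)) (volume.restrict (Ioc 0 T)) :=
    (aemeasurable_avg2 aemeasurable_accel).mono_measure (Measure.restrict_mono hIoc le_rfl)
  have m1 : AEMeasurable (fun s => ENNReal.ofReal ‖u.d1 s‖ * avg2 (sqNorm φ) s ^ (1 / 2 : ℝ))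
      (volume.restrict (Ioc 0 T)) := hd.mul (hP.pow_const _)
  have m2 : AEMeasurable (fun s => ENNReal.ofReal ‖u.d1 s‖ * avg2 (sqNorm φ) s ^ (1 / 2 : ℝ) +
      ENNReal.ofReal (4 * ε ^ 2) * avg2 (sqNorm φ) s) (volume.restrict (Ioc 0 T)) :=
    m1.add (hP.const_mul _)
  have hk1 : Measurable fun y => ENNReal.ofReal (Real.exp (-y) * kerTwo T y) :=
    ((by fun_prop : Continuous fun y : ℝ => Real.exp (-y)).mul
      continuous_kerTwo).measurable.ennreal_ofReal
  have m3 : AEMeasurable (fun y => ENNReal.ofReal (Real.exp (-y) * kerTwo T y) * accel ε u y)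
      (volume.restrict (Ioi 0)) := hk1.aemeasurable.mul aemeasurable_accel
  rw [← lintegral_avg2 hT hm0]
  refine (setLIntegral_mono' measurableSet_Ioc fun s hs => avg2_source_le hε hφ u hs.1.le).trans ?_
  rw [lintegral_add_left' m2, lintegral_add_left' m1, lintegral_const_mul' _ _
    ENNReal.ofReal_ne_top, lintegral_add_left' hacc, lintegral_avg2 hT aemeasurable_accel,
    lintegral_avg hT aemeasurable_accel, ← lintegral_add_left' m3]
  refine add_le_add le_rfl (lintegral_mono fun y => le_of_eq ?_)
  rw [← add_mul, ← ENNReal.ofReal_add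
    (mul_nonneg (Real.exp_pos _).le (kerTwo_nonneg hT y))
    (mul_nonneg (Real.exp_pos _).le (kerOne_nonneg hT y)), ← mul_add, add_comm (kerTwo T y)]

/-- Finite without any energy estimate, because `φ` vanishes after a finite time and `u'` is locally
bounded. -/
theorem lintegral_kerTwo_source_ne_top (hφ : IsSource f ε tε φ) (u : H2loc (L2 n))
    {T : ℝ} (hT : 0 ≤ T) :
    ∫⁻ y in Ioi 0, ENNReal.ofReal (Real.exp (-y) * kerTwo T y) *
      ENNReal.ofReal (‖φ y‖ * ‖u.d1 y‖) ≠ ⊤ := by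
  have hw : AEStronglyMeasurable (fun y => kerTwo T y • u.d1 y) (volume.restrict (Ioi 0)) :=
    continuous_kerTwo.aestronglyMeasurable.smul u.aestronglyMeasurable_d1
  have hi := hφ.integrable_mul hw fun R => by
    obtain ⟨C, hC⟩ := isCompact_Icc.exists_bound_of_continuousOn
      ((continuous_kerTwo (T := T)).continuousOn.smul u.continuousOn_d1 |>.mono
        fun (s : ℝ) (hs : s ∈ Icc 0 R) => hs.1)
    exact ⟨C, fun t ht => hC t ⟨ht.1.le, ht.2⟩⟩
  have h2 := hi.lintegral_lt_top
  refine ne_top_of_le_ne_top h2.ne (le_of_eq (lintegral_congr fun y => ?_))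
  rw [← ENNReal.ofReal_mul (mul_nonneg (Real.exp_pos _).le (kerTwo_nonneg hT y)), norm_smul,
    Real.norm_of_nonneg (kerTwo_nonneg hT y)]
  ring_nf

theorem energyD_eq {T : ℝ} (hT : 0 ≤ T)
    (hGm : AEMeasurable (fun s => G (u.d1 s)) (volume.restrict (Ioi 0))) :
    energyD W G ε u T = ENNReal.ofReal (1 / (2 * ε ^ 2) * ‖u.d1 T‖ ^ 2) +
      avg2 (fun s => W (u.toFun s)) T + ENNReal.ofReal (1 / ε) *
      ∫⁻ y in Ioi 0, ENNReal.ofReal (Real.exp (-y) * (kerOne T y + kerTwo T y)) * G (u.d1 y) := by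
  rw [energyD, energy, lintegral_avg_add_avg2 hT hGm]

theorem energyD_zero : energyD W G ε u 0 = ENNReal.ofReal (1 / (2 * ε ^ 2) * ‖u.d1 0‖ ^ 2) +
      avg2 (fun s => W (u.toFun s)) 0 := by
  simp [energyD, energy]

theorem avg2_zero_eq (h : ℝ → ℝ≥0∞) :
    avg2 h 0 = ∫⁻ y in Ioi 0, ENNReal.ofReal (Real.exp (-y) * y) * h y := by
  simp [avg2]

theorem avg_zero_eq (h : ℝ → ℝ≥0∞) :
    avg h 0 = ∫⁻ y in Ioi 0, ENNReal.ofReal (Real.exp (-y)) * h y := by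
  simp [avg]

/-- The integrated form of `kerTwo_add_self`; with `h = 𝒲(u)` it exchanges the potential terms of
`energy_inequality` for those in `E^d` at `T` and at `0`. -/
theorem avg2_add_lintegral_kerOne {h : ℝ → ℝ≥0∞} (hh : AEMeasurable h (volume.restrict (Ioi 0)))
    {T : ℝ} (hT : 0 ≤ T) :
    avg2 h T + (∫⁻ y in Ioi 0, ENNReal.ofReal (Real.exp (-y) * kerOne T y) * h y) =
      avg2 h 0 + ∫⁻ y in Ioi 0, ENNReal.ofReal (Real.exp (-y) * kerTwo T y) * h y := by
  have hexp : Continuous fun y : ℝ => Real.exp (-y) := by fun_prop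
  have h1 : avg2 h T = ∫⁻ y in Ioi 0,
      ENNReal.ofReal (Real.exp (-y) * (Real.exp T * max (y - T) 0)) * h y := by
    rw [avg2]
    have : ∀ y ∈ Ioi (0 : ℝ), ENNReal.ofReal (Real.exp (-y) * (Real.exp T * max (y - T) 0)) * h y =
        (Ioi T).indicator (fun s => ENNReal.ofReal (Real.exp (-(s - T)) * (s - T)) * h s) y := by
      intro y _
      by_cases hy : T < y
      · rw [indicator_of_mem (mem_Ioi.2 hy), max_eq_left (by linarith), ← mul_assoc, ← Real.exp_add]
        ring_nf
      · rw [indicator_of_notMem (by simpa using hy), max_eq_right (by linarith)]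
        simp
    rw [setLIntegral_congr_fun measurableSet_Ioi this, lintegral_indicator measurableSet_Ioi,
      Measure.restrict_restrict measurableSet_Ioi, Ioi_inter_Ioi, sup_eq_left.2 hT]
  have m1 : AEMeasurable (fun y => ENNReal.ofReal (Real.exp (-y) * (Real.exp T * max (y - T) 0)) *
      h y) (volume.restrict (Ioi 0)) :=
    (by fun_prop : Measurable fun y : ℝ => ENNReal.ofReal
      (Real.exp (-y) * (Real.exp T * max (y - T) 0))).aemeasurable.mul hh
  have m2 : AEMeasurable (fun y => ENNReal.ofReal (Real.exp (-y) * y) * h y)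
      (volume.restrict (Ioi 0)) :=
    (by fun_prop : Measurable fun y : ℝ => ENNReal.ofReal
      (Real.exp (-y) * y)).aemeasurable.mul hh
  rw [h1, avg2_zero_eq, ← lintegral_add_left' m1, ← lintegral_add_left' m2]
  refine setLIntegral_congr_fun measurableSet_Ioi fun y (hy : 0 < y) => ?_
  have e := kerTwo_add_self hT hy.le
  have p1 := kerOne_nonneg hT y
  have p2 := kerTwo_nonneg hT y
  simp only [← add_mul]
  rw [← ENNReal.ofReal_add (by positivity) (by positivity), ← ENNReal.ofReal_add (by positivity)
    (by positivity), ← mul_add, ← mul_add, add_comm y, e, add_comm (kerOne T y)]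

namespace RegularMinimizer

theorem energyD_le (hm : RegularMinimizer W G w₀ w₁ f ε tε φ u) {T : ℝ} (hT : 0 ≤ T) :
    energyD W G ε u T ≤ energyD W G ε u 0 + sourceBound ε φ u T := by
  have h := energy_inequality hT hm.pos hm.homog hm.measW hm.measG hm.isSource hm.isMinimizer
    hm.finite
  have hV := lintegral_kerOne_potential_ne_top (T := T) hm.finite
  have hS := lintegral_kerTwo_source_ne_top hm.isSource u hT
  have hSle := lintegral_kerTwo_source_le hm.pos hm.isSource u hT
  have hW := avg2_add_lintegral_kerOne hm.measW hT
  rw [energyD_eq hT hm.measG, energyD_zero]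
  change _ + (∫⁻ y in Ioi 0, ENNReal.ofReal (Real.exp (-y) * (kerOne T y + kerTwo T y)) *
    accel ε u y) ≤ _ at h
  set V := ∫⁻ y in Ioi 0, ENNReal.ofReal (Real.exp (-y) * kerOne T y) * W (u.toFun y)
  set V2 := ∫⁻ y in Ioi 0, ENNReal.ofReal (Real.exp (-y) * kerTwo T y) * W (u.toFun y)
  set D := ∫⁻ y in Ioi 0, ENNReal.ofReal (Real.exp (-y) * (kerOne T y + kerTwo T y)) *
    accel ε u y
  set S := ∫⁻ y in Ioi 0, ENNReal.ofReal (Real.exp (-y) * kerTwo T y) *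
    ENNReal.ofReal (‖φ y‖ * ‖u.d1 y‖)
  -- The acceleration term is bounded by the right side of the energy inequality, which is finite;
  -- only for this reason can it be cancelled in `ℝ≥0∞`.
  have hD : D ≠ ⊤ := by
    refine ne_top_of_le_ne_top ?_ (le_add_self.trans h)
    simp [hV, hS]
  refine (ENNReal.add_le_add_iff_right (ENNReal.add_ne_top.2 ⟨hV, hD⟩)).1 ?_
  calc _ = ENNReal.ofReal (1 / (2 * ε ^ 2) * ‖u.d1 T‖ ^ 2) +
        (avg2 (fun s => W (u.toFun s)) T + V) + ENNReal.ofReal (1 / ε) *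
        (∫⁻ y in Ioi 0, ENNReal.ofReal (Real.exp (-y) * (kerOne T y + kerTwo T y)) * G (u.d1 y)) +
        D := by ring
    _ = avg2 (fun s => W (u.toFun s)) 0 + (ENNReal.ofReal (1 / (2 * ε ^ 2) * ‖u.d1 T‖ ^ 2) +
        V2 + ENNReal.ofReal (1 / ε) *
        (∫⁻ y in Ioi 0, ENNReal.ofReal (Real.exp (-y) * (kerOne T y + kerTwo T y)) * G (u.d1 y)) +
        D) := by rw [hW]; ring
    _ ≤ avg2 (fun s => W (u.toFun s)) 0 + (ENNReal.ofReal (1 / (2 * ε ^ 2) * ‖u.d1 0‖ ^ 2) +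
        V + (sourceBound ε φ u T + D)) := by exact add_le_add le_rfl (h.trans (add_le_add le_rfl hSle))
    _ = _ := by ring

/-- On `(0,T]` the weights of `𝒢/ε` on the right add up exactly: `e^{-y}(kerOne + kerTwo) + e^{-y} y
+ 2e^{-y} = 2`. Beyond `T` they are nonnegative and are dropped. -/
theorem energyC_le (hm : RegularMinimizer W G w₀ w₁ f ε tε φ u) {T : ℝ} (hT : 0 ≤ T) :
    energyC W G ε u T ≤ energyD W G ε u T + ENNReal.ofReal (1 / ε) *
      (avg2 (fun t => G (u.d1 t)) 0 + 2 * avg (fun t => G (u.d1 t)) 0) := by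
  have hε := hm.pos
  rw [energyC, energyD, lintegral_avg_add_avg2 hT hm.measG, add_assoc, ← mul_add, avg2_zero_eq,
    avg_zero_eq, ← lintegral_const_mul' (2 : ℝ≥0∞) _ (by simp)]
  have m1 : AEMeasurable (fun y => ENNReal.ofReal (Real.exp (-y) * (kerOne T y + kerTwo T y)) *
      G (u.d1 y)) (volume.restrict (Ioi 0)) :=
    ((by fun_prop : Continuous fun y : ℝ => Real.exp (-y)).mul
      (continuous_kerOne.add continuous_kerTwo)).measurable.ennreal_ofReal.aemeasurable.mul hm.measG
  have m2 : AEMeasurable (fun y => ENNReal.ofReal (Real.exp (-y) * y) * G (u.d1 y))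
      (volume.restrict (Ioi 0)) :=
    (by fun_prop : Measurable fun y : ℝ => ENNReal.ofReal
      (Real.exp (-y) * y)).aemeasurable.mul hm.measG
  rw [← lintegral_add_left' m2, ← lintegral_add_left' m1]
  have e : ENNReal.ofReal (2 / ε) = ENNReal.ofReal (1 / ε) * 2 := by
    rw [← ENNReal.ofReal_ofNat 2, ← ENNReal.ofReal_mul (by positivity)]; ring_nf
  rw [e, mul_assoc, ← lintegral_const_mul' _ _ (by simp)]
  refine add_le_add le_rfl (mul_le_mul_right ?_ _)
  refine le_trans (setLIntegral_mono' measurableSet_Ioc fun y hy => ?_)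
    (lintegral_mono_set (Ioc_subset_Ioi_self : Ioc (0 : ℝ) T ⊆ Ioi 0))
  have p1 := kerOne_nonneg hT y
  have p2 := kerTwo_nonneg hT y
  have p3 := hy.1.le
  rw [← mul_assoc 2, ← add_mul, ← add_mul]
  gcongr
  rw [← ENNReal.ofReal_ofNat 2, ← ENNReal.ofReal_mul (by norm_num), ← ENNReal.ofReal_add
    (by positivity) (by positivity), ← ENNReal.ofReal_add (by positivity) (by positivity)]
  apply ENNReal.ofReal_le_ofReal
  rw [kerOne_of_mem p3 hy.2, kerTwo_of_mem p3 hy.2]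
  have : Real.exp (-y) * Real.exp y = 1 := by rw [← Real.exp_add]; simp
  linarith

end RegularMinimizer
end EnergyEstimate
-- Gronwall for the energies, and the bound on `Λ`
section EnergyBound
variable {n : ℕ} {W G : L2 n → ℝ≥0∞} {w₀ w₁ : L2 n} {f : ℝ → L2 n} {ε tε : ℝ} {φ : ℝ → L2 n}
  {u : H2loc (L2 n)}

/-- The real valued function `(𝒜²‖φ‖²)^{1/2}`. -/
noncomputable def rootAvg (φ : ℝ → L2 n) (s : ℝ) : ℝ := (avg2 (sqNorm φ) s ^ (1 / 2 : ℝ)).toReal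

theorem rootAvg_nonneg (s : ℝ) : 0 ≤ rootAvg φ s := ENNReal.toReal_nonneg

theorem sq_lintegral_rpow_half_le {h : ℝ → ℝ≥0∞} {t : ℝ}
    (hh : AEMeasurable h (volume.restrict (Ioc 0 t))) :
    (∫⁻ s in Ioc 0 t, h s ^ (1 / 2 : ℝ)) ^ 2 ≤ ENNReal.ofReal t * ∫⁻ s in Ioc 0 t, h s := by
  have := sq_lintegral_mul_le (volume.restrict (Ioc 0 t))
    (aemeasurable_const (b := (1 : ℝ≥0∞))) (hh.pow_const (1 / 2 : ℝ))
  have e : ∀ x : ℝ≥0∞, (x ^ (1 / 2 : ℝ)) ^ 2 = x := fun x => by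
    rw [← ENNReal.rpow_two, ← ENNReal.rpow_mul]; norm_num
  simp only [e] at this
  simpa using this

theorem lintegral_avg2_le {M t : ℝ} (hε : 0 < ε)
    (hP : ENNReal.ofReal ε * ∫⁻ s in Ioc 0 t, avg2 (sqNorm φ) s ≤ ENNReal.ofReal M) :
    ∫⁻ s in Ioc 0 t, avg2 (sqNorm φ) s ≤ ENNReal.ofReal (M / ε) := by
  rw [ENNReal.ofReal_div_of_pos hε, ENNReal.le_div_iff_mul_le (by simp [hε]) (by simp), mul_comm]
  exact hP

/-- Cauchy–Schwarz in time; it also shows that passing to real values in `rootAvg` loses nothing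
almost everywhere. -/
theorem integrableOn_rootAvg {t : ℝ} (hφ : IsSource f ε tε φ)
    (hP : ∫⁻ s in Ioc 0 t, avg2 (sqNorm φ) s ≠ ⊤) :
    IntegrableOn (rootAvg φ) (Ioc 0 t) ∧
      (∀ᵐ s ∂volume.restrict (Ioc 0 t), avg2 (sqNorm φ) s ^ (1 / 2 : ℝ) ≠ ⊤) ∧
      ENNReal.ofReal (∫ s in Ioc 0 t, rootAvg φ s) ^ 2 ≤
        ENNReal.ofReal t * ∫⁻ s in Ioc 0 t, avg2 (sqNorm φ) s := by
  have hm : AEMeasurable (avg2 (sqNorm φ)) (volume.restrict (Ioc 0 t)) :=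
    (aemeasurable_avg2 (aemeasurable_sqNorm hφ)).mono_measure
      (Measure.restrict_mono Ioc_subset_Ioi_self le_rfl)
  have hm2 := hm.pow_const (1 / 2 : ℝ)
  have h1 := sq_lintegral_rpow_half_le hm
  have h2 : ∫⁻ s in Ioc 0 t, avg2 (sqNorm φ) s ^ (1 / 2 : ℝ) ≠ ⊤ := by
    intro h
    rw [h, ENNReal.top_pow two_ne_zero, top_le_iff] at h1
    exact ENNReal.mul_ne_top ENNReal.ofReal_ne_top hP h1
  have h3 := ae_lt_top' hm2 h2
  refine ⟨integrable_toReal_of_lintegral_ne_top hm2 h2, h3.mono fun s hs => hs.ne, ?_⟩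
  simp only [rootAvg]
  rwa [integral_toReal hm2 h3, ENNReal.ofReal_toReal h2]

theorem sourceBound_le {M t : ℝ} (hε : 0 < ε) (hM : 0 ≤ M) (hφ : IsSource f ε tε φ)
    (hP : ENNReal.ofReal ε * ∫⁻ s in Ioc 0 t, avg2 (sqNorm φ) s ≤ ENNReal.ofReal M)
    {s : ℝ} (hs : s ∈ Icc 0 t) :
    sourceBound ε φ u s ≤ ENNReal.ofReal (4 * ε * M + ∫ r in (0 : ℝ)..s, rootAvg φ r * ‖u.d1 r‖) := by
  have hP' := lintegral_avg2_le hε hP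
  obtain ⟨hi, hfin, -⟩ := integrableOn_rootAvg hφ (ne_top_of_le_ne_top ENNReal.ofReal_ne_top hP')
  have hsub : Ioc 0 s ⊆ Ioc 0 t := Ioc_subset_Ioc_right hs.2
  have hint : IntervalIntegrable (rootAvg φ) volume 0 s :=
    (intervalIntegrable_iff_integrableOn_Ioc_of_le hs.1).2 (hi.mono_set hsub)
  have hc : ContinuousOn (fun r => ‖u.d1 r‖) (uIcc 0 s) := by
    rw [uIcc_of_le hs.1]; exact (u.continuousOn_d1.mono fun _ h => h.1).norm
  have hint2 := hint.mul_continuousOn hc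
  rw [intervalIntegrable_iff_integrableOn_Ioc_of_le hs.1] at hint2
  rw [sourceBound, add_comm, ENNReal.ofReal_add (by positivity)
    (intervalIntegral.integral_nonneg hs.1 fun r _ =>
      mul_nonneg (rootAvg_nonneg r) (norm_nonneg _)),
    intervalIntegral.integral_of_le hs.1, ofReal_integral_eq_lintegral_ofReal hint2
      (Eventually.of_forall fun r => mul_nonneg (rootAvg_nonneg r) (norm_nonneg _))]
  refine add_le_add ?_ (le_of_eq (lintegral_congr_ae ?_))
  · have e : 4 * ε * M = 4 * ε ^ 2 * (M / ε) := by field_simp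
    rw [e, ENNReal.ofReal_mul (show 0 ≤ 4 * ε ^ 2 by positivity)]
    exact mul_le_mul_right ((lintegral_mono_set hsub).trans hP') _
  · filter_upwards [ae_restrict_of_ae_restrict_of_subset hsub hfin] with r hr
    rw [ENNReal.ofReal_mul (rootAvg_nonneg r), rootAvg, ENNReal.ofReal_toReal hr, mul_comm]

/-- The constant `c` does not depend on time and passes through Gronwall: `c = 0` serves the
estimate of `E^d`, and `c = Λ - E^d(0)` the one with `Λ`. -/
theorem RegularMinimizer.energyD_add_le (hm : RegularMinimizer W G w₀ w₁ f ε tε φ u) {t M : ℝ}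
    (ht : 0 ≤ t) (hM : 0 ≤ M)
    (hP : ENNReal.ofReal ε * ∫⁻ s in Ioc 0 t, avg2 (sqNorm φ) s ≤ ENNReal.ofReal M)
    {c : ℝ≥0∞} (hc : energyD W G ε u 0 + c ≠ ⊤) :
    energyD W G ε u t + c ≤ ENNReal.ofReal
      ((√(energyD W G ε u 0 + c).toReal + (√(ε * 4) + √(ε * t / 2)) * √M) ^ 2) := by
  have hε := hm.pos
  have hφ := hm.isSource
  have hP' := lintegral_avg2_le hε hP
  obtain ⟨hi, -, hcs⟩ := integrableOn_rootAvg hφ (ne_top_of_le_ne_top ENNReal.ofReal_ne_top hP')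
  set A₀ := (energyD W G ε u 0 + c).toReal with hA₀
  have hA₀0 : 0 ≤ A₀ := ENNReal.toReal_nonneg
  have hs2 : (0 : ℝ) < √2 := by positivity
  have hs2' : √2 ^ 2 = 2 := Real.sq_sqrt (by norm_num)
  -- Normalized so that `k²` is the kinetic energy, hence at most `E^d`, while `b k` is the density
  -- of the source.
  set b : ℝ → ℝ := fun s => √2 * ε * rootAvg φ s with hb
  set k : ℝ → ℝ := fun s => ‖u.d1 s‖ / (√2 * ε) with hk
  have hbk : ∀ r, b r * k r = rootAvg φ r * ‖u.d1 r‖ := fun r => by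
    simp only [hb, hk]; field_simp
  have hbint : IntervalIntegrable b volume 0 t :=
    ((intervalIntegrable_iff_integrableOn_Ioc_of_le ht).2 hi).const_mul _
  have hb0 : ∀ s, 0 ≤ b s := fun s => mul_nonneg (by positivity) (rootAvg_nonneg s)
  have hkc : ContinuousOn k (Icc 0 t) := (u.continuousOn_d1.mono fun _ h => h.1).norm.div_const _
  have hI0 : ∀ s ∈ Icc 0 t, 0 ≤ ∫ r in (0 : ℝ)..s, b r * k r := fun s hs =>
    intervalIntegral.integral_nonneg hs.1 fun r _ => mul_nonneg (hb0 r) (by positivity)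
  have hE : ∀ s ∈ Icc 0 t, energyD W G ε u s + c ≤
      ENNReal.ofReal (A₀ + 4 * ε * M + ∫ r in (0 : ℝ)..s, b r * k r) := by
    intro s hs
    have h1 := sourceBound_le (u := u) hε hM hφ hP hs
    simp only [← hbk] at h1
    calc _ ≤ energyD W G ε u 0 + sourceBound ε φ u s + c := by gcongr; exact hm.energyD_le hs.1
      _ = (energyD W G ε u 0 + c) + sourceBound ε φ u s := by ring
      _ ≤ ENNReal.ofReal A₀ + ENNReal.ofReal (4 * ε * M + ∫ r in (0 : ℝ)..s, b r * k r) := by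
        rw [hA₀, ENNReal.ofReal_toReal hc]; gcongr
      _ = _ := by
        have := hI0 s hs
        rw [← ENNReal.ofReal_add hA₀0 (by positivity), add_assoc]
  have hgr := le_sq_of_sq_le_add_integral (A := A₀ + 4 * ε * M) (by positivity) ht hbint hb0 hkc
    fun s hs => by
      have h1 : ENNReal.ofReal (k s ^ 2) ≤ energyD W G ε u s + c := by
        have e : k s ^ 2 = 1 / (2 * ε ^ 2) * ‖u.d1 s‖ ^ 2 := by
          simp only [hk, div_pow, mul_pow, hs2']; ring
        rw [e, energyD, energy]
        exact le_add_right (le_add_right le_self_add)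
      have := hI0 s hs
      exact (ENNReal.ofReal_le_ofReal_iff (by positivity)).1 (h1.trans (hE s hs))
  refine (hE t ⟨ht, le_rfl⟩).trans (ENNReal.ofReal_le_ofReal (hgr.trans ?_))
  have hint0 : 0 ≤ ∫ r in (0 : ℝ)..t, b r :=
    intervalIntegral.integral_nonneg ht fun r _ => hb0 r
  have hsq : √(A₀ + 4 * ε * M) ≤ √A₀ + √(ε * 4) * √M := by
    rw [← Real.sqrt_mul (by positivity), mul_comm ε 4]
    have h4 : 0 ≤ 4 * ε * M := by positivity
    refine Real.sqrt_le_iff.2 ⟨by positivity, ?_⟩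
    nlinarith [Real.sq_sqrt hA₀0, Real.sq_sqrt h4,
      mul_nonneg (Real.sqrt_nonneg A₀) (Real.sqrt_nonneg (4 * ε * M))]
  -- `½ · √2 ε · √(tM/ε) = √(εtM/2)`, which becomes `√(TM/2)` at `t = T/ε`.
  have hhalf : 1 / 2 * ∫ r in (0 : ℝ)..t, b r ≤ √(ε * t / 2) * √M := by
    rw [← Real.sqrt_mul (by positivity)]
    apply Real.le_sqrt_of_sq_le
    set I := ∫ s in Ioc 0 t, rootAvg φ s with hI
    have hI0 : 0 ≤ I := setIntegral_nonneg measurableSet_Ioc fun s _ => rootAvg_nonneg s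
    have hIsq : I ^ 2 ≤ t * (M / ε) := by
      have := hcs.trans (mul_le_mul_right hP' _)
      rwa [← ENNReal.ofReal_mul ht, ← ENNReal.ofReal_pow hI0,
        ENNReal.ofReal_le_ofReal_iff (by positivity)] at this
    have e : 1 / 2 * ∫ r in (0 : ℝ)..t, b r = √2 * ε / 2 * I := by
      rw [hI, intervalIntegral.integral_const_mul, intervalIntegral.integral_of_le ht]; ring
    rw [e, mul_pow, div_pow, mul_pow, hs2']
    calc 2 * ε ^ 2 / 2 ^ 2 * I ^ 2 ≤ 2 * ε ^ 2 / 2 ^ 2 * (t * (M / ε)) := by gcongr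
      _ = ε * t / 2 * M := by field_simp
  refine pow_le_pow_left₀ (by positivity) ?_ 2
  linarith

/-- The energies at the initial time are controlled by the functional and the source. -/
theorem RegularMinimizer.Lam_le (hm : RegularMinimizer W G w₀ w₁ f ε tε φ u) :
    Lam W G ε u ≤ 2 * ENNReal.ofReal (1 / (2 * ε ^ 2) * ‖u.d1 0‖ ^ 2) +
      ENNReal.ofReal (Real.exp 1 + 4) * posPart W G ε u + sourceBound ε φ u 1 := by
  have h01 : (0 : ℝ) ≤ 1 := zero_le_one
  have h := energy_inequality h01 hm.pos hm.homog hm.measW hm.measG hm.isSource hm.isMinimizer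
    hm.finite
  have hV := lintegral_kerOne_potential_ne_top (T := 1) hm.finite
  have hVle := lintegral_kerOne_potential_le (W := W) (G := G) (ε := ε) (u := u) (T := 1)
  have hS := lintegral_kerTwo_source_ne_top hm.isSource u h01
  have hSle := lintegral_kerTwo_source_le hm.pos hm.isSource u h01
  change _ + (∫⁻ y in Ioi 0, ENNReal.ofReal (Real.exp (-y) * (kerOne 1 y + kerTwo 1 y)) *
    accel ε u y) ≤ _ at h
  -- The weight `y e^{-y}` of `𝒜²` at `0` is at most a weight controlled by the energy inequality at
  -- time `1`, plus the weight `e^{-y}` of the functional itself.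
  have key : ∀ {h : ℝ → ℝ≥0∞} {κ : ℝ → ℝ}, AEMeasurable h (volume.restrict (Ioi 0)) →
      (∀ y, 0 < y → y ≤ κ y + 1) → (∀ y, 0 ≤ κ y) → avg2 h 0 ≤
      (∫⁻ y in Ioi 0, ENNReal.ofReal (Real.exp (-y) * κ y) * h y) +
      ∫⁻ y in Ioi 0, ENNReal.ofReal (Real.exp (-y)) * h y := by
    intro h κ hh hκ hκ0
    have hm : AEMeasurable (fun y => ENNReal.ofReal (Real.exp (-y)) * h y)
        (volume.restrict (Ioi 0)) :=
      (by fun_prop : Measurable fun y : ℝ => ENNReal.ofReal (Real.exp (-y))).aemeasurable.mul hh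
    rw [avg2_zero_eq, ← lintegral_add_right' _ hm]
    refine setLIntegral_mono' measurableSet_Ioi fun y (hy : 0 < y) => ?_
    have := hκ0 y
    rw [← add_mul, ← ENNReal.ofReal_add (by positivity) (by positivity)]
    gcongr
    nlinarith [Real.exp_pos (-y), hκ y hy]
  have kW := key hm.measW (κ := kerTwo 1) (fun y hy => le_kerTwo_one_add_one hy.le)
    (kerTwo_nonneg h01)
  have kG := key hm.measG (κ := fun y => kerOne 1 y + kerTwo 1 y)
    (fun y hy => by linarith [le_kerTwo_one_add_one hy.le, kerOne_nonneg h01 y])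
    (fun y => add_nonneg (kerOne_nonneg h01 y) (kerTwo_nonneg h01 y))
  have hXW := lintegral_exp_potential_le (W := W) (G := G) (ε := ε) (u := u)
  have hXG : ENNReal.ofReal (1 / ε) * avg (fun t => G (u.d1 t)) 0 ≤ posPart W G ε u := by
    rw [avg_zero_eq, posPart]; exact le_add_self
  rw [Lam, energyD_zero]
  set X := posPart W G ε u
  set K := ENNReal.ofReal (1 / (2 * ε ^ 2) * ‖u.d1 0‖ ^ 2)
  set V := ∫⁻ y in Ioi 0, ENNReal.ofReal (Real.exp (-y) * kerOne 1 y) * W (u.toFun y)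
  set V2 := ∫⁻ y in Ioi 0, ENNReal.ofReal (Real.exp (-y) * kerTwo 1 y) * W (u.toFun y)
  set D := ∫⁻ y in Ioi 0, ENNReal.ofReal (Real.exp (-y) * (kerOne 1 y + kerTwo 1 y)) *
    accel ε u y
  set S := ∫⁻ y in Ioi 0, ENNReal.ofReal (Real.exp (-y) * kerTwo 1 y) *
    ENNReal.ofReal (‖φ y‖ * ‖u.d1 y‖)
  set B := ∫⁻ y in Ioi 0, ENNReal.ofReal (Real.exp (-y) * (kerOne 1 y + kerTwo 1 y)) * G (u.d1 y)
  have hD : D ≠ ⊤ := by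
    refine ne_top_of_le_ne_top ?_ (le_add_self.trans h)
    simp [K, hV, hS]
  have h2 : V2 + ENNReal.ofReal (1 / ε) * B ≤ K + V + sourceBound ε φ u 1 := by
    refine (ENNReal.add_le_add_iff_right hD).1 ?_
    calc _ ≤ ENNReal.ofReal (1 / (2 * ε ^ 2) * ‖u.d1 1‖ ^ 2) + V2 +
          ENNReal.ofReal (1 / ε) * B + D := by
          exact add_le_add (add_le_add le_add_self le_rfl) le_rfl
      _ ≤ K + V + (sourceBound ε φ u 1 + D) := h.trans (add_le_add le_rfl hSle)
      _ = _ := by ring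
  rw [← avg_zero_eq] at kG
  calc _ ≤ K + (V2 + X) + ENNReal.ofReal (1 / ε) *
        ((B + avg (fun t => G (u.d1 t)) 0) + 2 * avg (fun t => G (u.d1 t)) 0) := by
        gcongr; exact kW.trans (by gcongr)
    _ = K + X + (V2 + ENNReal.ofReal (1 / ε) * B) +
        3 * (ENNReal.ofReal (1 / ε) * avg (fun t => G (u.d1 t)) 0) := by ring
    _ ≤ K + X + (K + ENNReal.ofReal (Real.exp 1) * X + sourceBound ε φ u 1) + 3 * X := by
        exact add_le_add (add_le_add le_rfl (h2.trans (by gcongr))) (mul_le_mul_right hXG _)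
    _ = 2 * K + (ENNReal.ofReal (Real.exp 1) + 4) * X + sourceBound ε φ u 1 := by ring
    _ = _ := by
        rw [ENNReal.ofReal_add (Real.exp_pos _).le (by norm_num)]; norm_num

end EnergyBound
-- Semicontinuity, measurability and homogeneity of the functionals
section Semicontinuity
variable {n : ℕ} {W G : L2 n → ℝ≥0∞}

/-- Strong convergence implies weak convergence. The result is used only to make `𝒲 ∘ u` measurable.
-/
theorem WeaklyLSC.lowerSemicontinuous (hW : WeaklyLSC W) : LowerSemicontinuous W := by
  rw [lowerSemicontinuous_iff_isClosed_preimage]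
  intro c
  refine IsSeqClosed.isClosed fun x y hx hy => ?_
  have h1 := hW x y fun z => (tendsto_const_nhds (x := z)).inner hy
  refine h1.trans ?_
  refine (liminf_le_liminf (v := fun _ => c) (Eventually.of_forall fun k => hx k)).trans ?_
  simp

/-- Balls of a Hilbert space are weakly compact and bounded operators are weakly continuous, so the
image is weakly compact, hence closed. Weak topologies are realized as pointwise convergence of
functions on `H`, with Banach–Alaoglu supplying compactness. -/
theorem isClosed_image_closedBall {Y H : Type} [NormedAddCommGroup Y] [InnerProductSpace ℝ Y]
    [CompleteSpace Y] [NormedAddCommGroup H] [InnerProductSpace ℝ H] [CompleteSpace H]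
    (k : Y →L[ℝ] H) (R : ℝ) : IsClosed (k '' Metric.closedBall 0 R) := by
  set Φ : WeakDual ℝ Y → H → ℝ := fun g z => g (k.adjoint z) with hΦ
  have hΦc : Continuous Φ := continuous_pi fun z => WeakDual.eval_continuous _
  set ι : H → H → ℝ := fun v z => inner ℝ v z with hι
  have hιc : Continuous ι := continuous_pi fun z => by fun_prop
  have hK := (WeakDual.isCompact_closedBall (𝕜 := ℝ) (0 : StrongDual ℝ Y) R).image hΦc
  have e : k '' Metric.closedBall 0 R =
      ι ⁻¹' (Φ '' (WeakDual.toStrongDual ⁻¹' Metric.closedBall (0 : StrongDual ℝ Y) R)) := by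
    ext v
    constructor
    · rintro ⟨y, hy, rfl⟩
      refine ⟨StrongDual.toWeakDual (InnerProductSpace.toDual ℝ Y y), ?_, ?_⟩
      · simpa using hy
      · ext z
        simp only [hΦ, hι, StrongDual.coe_toWeakDual]
        simp [ContinuousLinearMap.adjoint_inner_right]
    · rintro ⟨g, hg, hgv⟩
      refine ⟨(InnerProductSpace.toDual ℝ Y).symm (WeakDual.toStrongDual g), ?_, ?_⟩
      · simpa using hg
      · refine ext_inner_right ℝ fun z => ?_
        have := congrFun hgv z
        simp only [hΦ, hι] at this
        rw [← this, ← ContinuousLinearMap.adjoint_inner_right]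
        simp
  rw [e]
  exact hK.isClosed.preimage hιc

/-- If `x i → v` with `𝒢 ≤ c`, the preimages eventually lie in the ball of squared radius `‖v‖² + 2c
+ η`, whose image is closed, so `v` has a preimage there. By injectivity this preimage is the same
for all `η`, and `η → 0` gives `𝒢(v) ≤ c`. -/
theorem IsDissipation.lowerSemicontinuous (hG : IsDissipation G) : LowerSemicontinuous G := by
  obtain ⟨Y, _, _, _, k, a, hk, -, hpos, hGk, htop, hnorm⟩ := hG
  rw [lowerSemicontinuous_iff_isClosed_preimage]
  intro c
  rcases eq_or_ne c ⊤ with rfl | hc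
  · simp
  have hmem : ∀ v, G v ≤ c → ∃ y, k y = v ∧ ‖y‖ ^ 2 ≤ ‖v‖ ^ 2 + 2 * c.toReal := by
    intro v hv
    obtain ⟨y, rfl⟩ : v ∈ range k := by
      by_contra h
      rw [htop v h, top_le_iff] at hv
      exact hc hv
    rw [hGk, ENNReal.ofReal_le_iff_le_toReal hc] at hv
    exact ⟨y, rfl, by rw [hnorm]; linarith⟩
  refine IsSeqClosed.isClosed fun x v hx hxv => ?_
  have hball : ∀ η > 0, ∃ y, k y = v ∧ ‖y‖ ^ 2 ≤ ‖v‖ ^ 2 + 2 * c.toReal + η := by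
    intro η hη
    have hc0 : 0 ≤ c.toReal := ENNReal.toReal_nonneg
    have hR : 0 ≤ ‖v‖ ^ 2 + 2 * c.toReal + η := by positivity
    have hev : ∀ᶠ i in atTop, x i ∈ k '' Metric.closedBall 0 (√(‖v‖ ^ 2 + 2 * c.toReal + η)) := by
      filter_upwards [(hxv.norm.pow 2).eventually (gt_mem_nhds (show ‖v‖ ^ 2 < ‖v‖ ^ 2 + η by
        linarith))] with i hi
      obtain ⟨y, hy, hle⟩ := hmem (x i) (hx i)
      refine ⟨y, ?_, hy⟩
      rw [mem_closedBall_zero_iff]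
      apply Real.le_sqrt_of_sq_le
      linarith
    obtain ⟨y, hy, hyv⟩ := (isClosed_image_closedBall k _).mem_of_tendsto hxv hev
    refine ⟨y, hyv, ?_⟩
    rw [mem_closedBall_zero_iff] at hy
    calc ‖y‖ ^ 2 ≤ √(‖v‖ ^ 2 + 2 * c.toReal + η) ^ 2 := by gcongr
      _ = _ := Real.sq_sqrt hR
  obtain ⟨y, hyv, -⟩ := hball 1 one_pos
  have hle : ‖y‖ ^ 2 ≤ ‖v‖ ^ 2 + 2 * c.toReal := by
    refine le_of_forall_pos_le_add fun η hη => ?_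
    obtain ⟨y', hyv', h⟩ := hball η hη
    rwa [hk.injective (hyv.trans hyv'.symm)]
  rw [mem_preimage, mem_Iic, ← hyv, hGk, ENNReal.ofReal_le_iff_le_toReal hc]
  rw [hnorm, hyv] at hle
  linarith

theorem IsDissipation.smul (hG : IsDissipation G) {c : ℝ} (hc : 0 < c) (v : L2 n) :
    G (c • v) = ENNReal.ofReal (c ^ 2) * G v := by
  obtain ⟨Y, _, _, _, k, a, -, -, -, hGk, htop, -⟩ := hG
  by_cases hv : v ∈ range k
  · obtain ⟨y, rfl⟩ := hv
    rw [← map_smul, hGk, hGk, ← ENNReal.ofReal_mul (by positivity)]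
    congr 1
    simp only [map_smul, smul_apply, smul_eq_mul]
    ring
  · have hcv : c • v ∉ range k := by
      rintro ⟨y, hy⟩
      exact hv ⟨c⁻¹ • y, by rw [map_smul, hy, inv_smul_smul₀ hc.ne']⟩
    rw [htop _ hcv, htop _ hv, ENNReal.mul_top]
    rw [Ne, ENNReal.ofReal_eq_zero, not_le]
    positivity

theorem aemeasurable_comp_toFun (hW : LowerSemicontinuous W) (u : H2loc (L2 n)) :
    AEMeasurable (fun s => W (u.toFun s)) (volume.restrict (Ioi 0)) := by
  refine AEMeasurable.congr (f := fun s => W (u.toFun (max s 0)))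
    (hW.comp u.continuous_toFun_max).measurable.aemeasurable ?_
  filter_upwards [ae_restrict_mem measurableSet_Ioi] with s hs
  rw [max_eq_left (le_of_lt hs)]

theorem aemeasurable_comp_d1 (hG : LowerSemicontinuous G) (u : H2loc (L2 n)) :
    AEMeasurable (fun s => G (u.d1 s)) (volume.restrict (Ioi 0)) := by
  refine AEMeasurable.congr (f := fun s => G (u.d1 (max s 0)))
    (hG.comp u.continuous_d1_max).measurable.aemeasurable ?_
  filter_upwards [ae_restrict_mem measurableSet_Ioi] with s hs
  rw [max_eq_left (le_of_lt hs)]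

end Semicontinuity

/-! ### Growth of the potential along lines, and the affine competitor -/

section LineGrowth
variable {n : ℕ} {W G : L2 n → ℝ≥0∞} {w₀ w₁ : L2 n}

/-- Weighted arithmetic-geometric mean of `p/2` and the constant, with weights `θ` and `1 - θ`. -/
theorem const_mul_rpow_le {K θ : ℝ} (hK : 0 ≤ K) (hθ : 0 < θ) (hθ1 : θ < 1) :
    ∃ B, 0 ≤ B ∧ ∀ p, 0 ≤ p → K * p ^ θ ≤ 1 / 2 * p + B := by
  have h1 : 0 < 1 - θ := by linarith
  have hb : 0 ≤ K * 2 ^ θ := by positivity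
  refine ⟨(K * 2 ^ θ) ^ (1 / (1 - θ)), by positivity, fun p hp => ?_⟩
  have h := Real.geom_mean_le_arith_mean2_weighted hθ.le h1.le (by positivity : 0 ≤ p / 2)
    (by positivity : 0 ≤ (K * 2 ^ θ) ^ (1 / (1 - θ))) (by ring)
  rw [← Real.rpow_mul hb, one_div_mul_cancel h1.ne', Real.rpow_one,
    Real.div_rpow hp (by norm_num)] at h
  have h2 : (0 : ℝ) < 2 ^ θ := by positivity
  have e : p ^ θ / 2 ^ θ * (K * 2 ^ θ) = K * p ^ θ := by field_simp
  have h3 : 0 ≤ (K * 2 ^ θ) ^ (1 / (1 - θ)) := by positivity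
  rw [e] at h
  nlinarith

/-- Along the line the derivative of `𝒲` is at most `C‖x₁‖(1 + 𝒲^θ) ≤ 𝒲/2 + D`, and Gronwall
applies. The rate `½` keeps the growth integrable against `e^{-t}` at `s = εt`, uniformly in `ε <
1`. -/
theorem IsPotential.line_growth (hW : IsPotential W) (h₀ : W w₀ < ⊤) (h₁ : W w₁ < ⊤) :
    ∃ A, 0 ≤ A ∧ ∀ s, 0 ≤ s → W (w₀ + s • w₁) ≤ ENNReal.ofReal (A * Real.exp (s / 2)) := by
  obtain ⟨-, X, _, _, _, j, -, hdom, dW, hder, C, θ, hC, hθ, hθ1, hbd⟩ := hW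
  obtain ⟨x₀, rfl⟩ : w₀ ∈ range j := by rw [hdom]; exact h₀
  obtain ⟨x₁, rfl⟩ : w₁ ∈ range j := by rw [hdom]; exact h₁
  set p : ℝ → ℝ := fun s => (W (j (x₀ + s • x₁))).toReal with hp
  have hp0 : ∀ s, 0 ≤ p s := fun s => ENNReal.toReal_nonneg
  have hfin : ∀ x, W (j x) ≠ ⊤ := fun x => by
    have : j x ∈ {v : L2 n | W v < ⊤} := hdom ▸ mem_range_self x
    exact this.ne
  have hpd : ∀ s, HasDerivAt p (dW (x₀ + s • x₁) x₁) s := by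
    intro s
    have h := hder (x₀ + s • x₁) x₁
    rw [HasLineDerivAt] at h
    have h2 : HasDerivAt (fun t => t - s) 1 s := (hasDerivAt_id' s).sub_const s
    have h' : HasDerivAt (fun t => (W (j (x₀ + s • x₁ + t • x₁))).toReal)
      (dW (x₀ + s • x₁) x₁) ((fun t => t - s) s) := by simpa using h
    have h3 := HasDerivAt.comp (h := fun t => t - s) s h' h2
    rw [mul_one] at h3
    refine h3.congr_of_eventuallyEq (Eventually.of_forall fun t => ?_)
    simp only [hp, Function.comp_apply]
    rw [add_assoc, ← add_smul]
    simp
  obtain ⟨B, hB, hBp⟩ := const_mul_rpow_le (mul_nonneg hC (norm_nonneg x₁)) hθ hθ1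
  set D := C * ‖x₁‖ + B with hD
  have hD0 : 0 ≤ D := by positivity
  have hle : ∀ s, dW (x₀ + s • x₁) x₁ ≤ 1 / 2 * p s + D := by
    intro s
    calc _ ≤ ‖dW (x₀ + s • x₁) x₁‖ := Real.le_norm_self _
      _ ≤ ‖dW (x₀ + s • x₁)‖ * ‖x₁‖ := ContinuousLinearMap.le_opNorm _ _
      _ ≤ C * (1 + p s ^ θ) * ‖x₁‖ := by gcongr; exact hbd _
      _ = C * ‖x₁‖ + C * ‖x₁‖ * p s ^ θ := by ring
      _ ≤ _ := by have := hBp (p s) (hp0 s); linarith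
  have hanti : Antitone fun s => (p s + 2 * D) * Real.exp (-(s / 2)) := by
    have hd : ∀ s, HasDerivAt (fun s => (p s + 2 * D) * Real.exp (-(s / 2)))
        ((dW (x₀ + s • x₁) x₁ - 1 / 2 * p s - D) * Real.exp (-(s / 2))) s := by
      intro s
      have h1 := (hpd s).add_const (2 * D)
      have h2 := (((hasDerivAt_id' s).div_const 2).fun_neg).exp
      exact (h1.fun_mul h2).congr_deriv (by ring)
    refine antitone_of_deriv_nonpos (fun s => (hd s).differentiableAt) fun s => ?_
    rw [(hd s).deriv]
    exact mul_nonpos_of_nonpos_of_nonneg (by linarith [hle s]) (Real.exp_pos _).le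
  refine ⟨p 0 + 2 * D, by have := hp0 0; positivity, fun s hs => ?_⟩
  rw [← map_smul, ← map_add, ← ENNReal.ofReal_toReal (hfin _)]
  apply ENNReal.ofReal_le_ofReal
  have := hanti hs
  simp only [zero_div, neg_zero, Real.exp_zero, mul_one] at this
  calc p s ≤ p s + 2 * D := by linarith
    _ = (p s + 2 * D) * Real.exp (-(s / 2)) * Real.exp (s / 2) := by
      rw [mul_assoc, ← Real.exp_add]; simp
    _ ≤ _ := by gcongr

/-- The affine function `t ↦ w₀ + t ε w₁`. -/
noncomputable def affine (ε : ℝ) (w₀ w₁ : L2 n) : H2loc (L2 n) where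
  toFun t := w₀ + t • (ε • w₁)
  d1 _ := ε • w₁
  d2 _ := 0
  memL2loc_d2 _ := MemLp.zero'
  d1_eq _ _ := by simp
  toFun_eq t _ := by simp [smul_comm t]

theorem hasInitialData_affine (ε : ℝ) (w₀ w₁ : L2 n) :
    HasInitialData ε w₀ w₁ (affine ε w₀ w₁) := ⟨by simp [affine], rfl⟩

theorem lintegral_exp_neg_mul {c : ℝ} (hc : 0 < c) :
    ∫⁻ t in Ioi (0 : ℝ), ENNReal.ofReal (Real.exp (-c * t)) = ENNReal.ofReal (1 / c) := by
  rw [← ofReal_integral_eq_lintegral_ofReal (integrableOn_exp_mul_Ioi (by linarith) 0)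
    (Eventually.of_forall fun t => (Real.exp_pos _).le), integral_exp_mul_Ioi (by linarith)]
  simp

theorem exists_posPart_affine_le (hW : IsPotential W) (hG : IsDissipation G) (h₀ : W w₀ < ⊤)
    (h₁ : W w₁ < ⊤) (hG₁ : G w₁ < ⊤) :
    ∃ Q, 0 ≤ Q ∧ ∀ ε ∈ Ioo (0 : ℝ) 1, posPart W G ε (affine ε w₀ w₁) ≤ ENNReal.ofReal Q := by
  obtain ⟨A, hA, hAW⟩ := hW.line_growth h₀ h₁
  refine ⟨2 * A + (G w₁).toReal, by positivity, fun ε hε => ?_⟩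
  have hexp : ∫⁻ t in Ioi (0 : ℝ), ENNReal.ofReal (Real.exp (-t)) = 1 := by
    simpa using lintegral_exp_neg_mul one_pos
  rw [posPart, ENNReal.ofReal_add (by positivity) ENNReal.toReal_nonneg]
  refine add_le_add ?_ ?_
  · calc _ ≤ ∫⁻ t in Ioi (0 : ℝ), ENNReal.ofReal A * ENNReal.ofReal (Real.exp (-(1 / 2) * t)) := by
          refine setLIntegral_mono' measurableSet_Ioi fun t (ht : 0 < t) => ?_
          have h1 : W ((affine ε w₀ w₁).toFun t) ≤ ENNReal.ofReal (A * Real.exp (t / 2)) := by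
            have h2 := hAW (t * ε) (mul_nonneg ht.le hε.1.le)
            simp only [affine, smul_smul]
            refine h2.trans (ENNReal.ofReal_le_ofReal ?_)
            gcongr
            nlinarith [hε.2]
          have h3 : ENNReal.ofReal (1 / (2 * ε ^ 2) * ‖(affine ε w₀ w₁).d2 t‖ ^ 2) = 0 := by
            simp [affine]
          rw [h3, zero_add]
          refine (mul_le_mul_right h1 _).trans (le_of_eq ?_)
          rw [← ENNReal.ofReal_mul (Real.exp_pos _).le, ← ENNReal.ofReal_mul hA]
          congr 1
          rw [mul_left_comm, ← Real.exp_add]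
          ring_nf
      _ = _ := by
          rw [lintegral_const_mul' _ _ ENNReal.ofReal_ne_top, lintegral_exp_neg_mul (by norm_num), mul_comm 2,
            ENNReal.ofReal_mul hA]
          norm_num
  · simp only [affine]
    rw [lintegral_mul_const _ (by fun_prop), hexp, one_mul, hG.smul hε.1, ← mul_assoc,
      ← ENNReal.ofReal_mul (by have := hε.1; positivity), ENNReal.ofReal_toReal hG₁.ne]
    refine mul_le_of_le_one_left' ?_
    rw [ENNReal.ofReal_le_one]
    have := hε.1
    have e : 1 / ε * ε ^ 2 = ε := by field_simp
    rw [e]; exact hε.2.le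

end LineGrowth
-- Level estimate and bounds uniform in `ε`
section LevelEstimate
variable {n : ℕ} {W G : L2 n → ℝ≥0∞} {w₀ w₁ : L2 n} {f : ℝ → L2 n} {ε tε : ℝ} {φ : ℝ → L2 n}
  {u : H2loc (L2 n)}

theorem ennreal_add_sq_le (a b : ℝ≥0∞) : (a + b) ^ 2 ≤ 2 * (a ^ 2 + b ^ 2) := by
  have := ENNReal.rpow_add_le_mul_rpow_add_rpow a b (p := 2) (by norm_num)
  simpa [ENNReal.rpow_two, show (2 : ℝ) - 1 = 1 by norm_num] using this

theorem two_mul_ofReal (x : ℝ) : 2 * ENNReal.ofReal x = ENNReal.ofReal (2 * x) := by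
  rw [ENNReal.ofReal_mul (by norm_num), ENNReal.ofReal_ofNat]

theorem avg_mono {h₁ h₂ : ℝ → ℝ≥0∞} {s : ℝ} (hle : ∀ τ ∈ Ioi s, h₁ τ ≤ h₂ τ) :
    avg h₁ s ≤ avg h₂ s :=
  setLIntegral_mono' measurableSet_Ioi fun τ hτ => mul_le_mul_right (hle τ hτ) _

theorem avg_accel_le : avg (accel ε u) 0 ≤ posPart W G ε u := by
  rw [avg_zero_eq, posPart]
  exact le_add_right (lintegral_mono fun t => mul_le_mul_right le_self_add _)

theorem avg_sq_d2_le (hε : 0 < ε) :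
    avg (fun t => ENNReal.ofReal ‖u.d2 t‖ ^ 2) 0 ≤ ENNReal.ofReal (2 * ε ^ 2) * posPart W G ε u := by
  refine le_trans (le_of_eq ?_) (mul_le_mul_right avg_accel_le _)
  rw [← avg_const_mul ENNReal.ofReal_ne_top]
  congr 1
  ext t
  rw [accel, ← ENNReal.ofReal_mul (by positivity), ← ENNReal.ofReal_pow (norm_nonneg _)]
  congr 1
  field_simp

theorem ofReal_norm_toFun_le (u : H2loc (L2 n)) {t : ℝ} (ht : 0 ≤ t) :
    ENNReal.ofReal ‖u.toFun t‖ ≤ ENNReal.ofReal (‖u.toFun 0‖ + t * ‖u.d1 0‖) +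
      ∫⁻ s in Ioc 0 t, ∫⁻ r in Ioc 0 s, ENNReal.ofReal ‖u.d2 r‖ := by
  have h1 : ENNReal.ofReal ‖u.toFun t‖ ≤ ENNReal.ofReal ‖u.toFun 0‖ +
      ∫⁻ s in Ioc 0 t, ENNReal.ofReal ‖u.d1 s‖ := by
    simp only [ofReal_norm]
    rw [u.toFun_eq t ht, intervalIntegral.integral_of_le ht]
    exact (enorm_add_le _ _).trans (by gcongr; exact enorm_integral_le_lintegral_enorm _)
  refine h1.trans ?_
  rw [ENNReal.ofReal_add (norm_nonneg _) (by positivity), add_assoc]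
  gcongr
  calc _ ≤ ∫⁻ s in Ioc 0 t, (ENNReal.ofReal ‖u.d1 0‖ +
        ∫⁻ r in Ioc 0 s, ENNReal.ofReal ‖u.d2 r‖) :=
        setLIntegral_mono' measurableSet_Ioc fun s hs => ofReal_norm_d1_le u le_rfl hs.1.le
    _ = _ := by
        rw [lintegral_add_left' aemeasurable_const, setLIntegral_const, Real.volume_Ioc, sub_zero,
          ENNReal.ofReal_mul ht, mul_comm]

theorem measurable_lintegral_Ioc {h : ℝ → ℝ≥0∞} :
    Measurable fun s => ∫⁻ r in Ioc 0 s, h r :=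
  Monotone.measurable fun _ _ hab => lintegral_mono_set (Ioc_subset_Ioc_right hab)

/-- `u` is affine plus a double integral of `u''`, to which Hardy's inequality for `𝒜` is applied
twice. The resulting factor `64ε²` is at most `64`. -/
theorem avg_sq_toFun_le (hε : 0 < ε) (hε1 : ε ≤ 1) (hu : HasInitialData ε w₀ w₁ u) :
    avg (fun t => ENNReal.ofReal ‖u.toFun t‖ ^ 2) 0 ≤
      ENNReal.ofReal (64 * (‖w₀‖ + ‖w₁‖) ^ 2) + ENNReal.ofReal 64 * posPart W G ε u := by
  set m := ‖w₀‖ + ‖w₁‖ with hm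
  have hd2 : AEMeasurable (fun t => ENNReal.ofReal ‖u.d2 t‖) (volume.restrict (Ioi 0)) :=
    u.aestronglyMeasurable_d2.norm.aemeasurable.ennreal_ofReal
  have h1 : avg (fun t => ENNReal.ofReal ‖u.toFun t‖ ^ 2) 0 ≤
      avg (fun t => ENNReal.ofReal (32 * m ^ 2) * ENNReal.ofReal (Real.exp (1 / 2 * t)) +
        2 * (∫⁻ s in Ioc 0 t, ∫⁻ r in Ioc 0 s, ENNReal.ofReal ‖u.d2 r‖) ^ 2) 0 := by
    refine avg_mono fun t (ht : 0 < t) => ?_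
    refine (pow_le_pow_left' (ofReal_norm_toFun_le u ht.le) 2).trans
      ((ennreal_add_sq_le _ _).trans ?_)
    rw [mul_add]
    refine add_le_add ?_ le_rfl
    rw [hu.1, hu.2, norm_smul, Real.norm_of_nonneg hε.le, ← ENNReal.ofReal_pow (by positivity),
      two_mul_ofReal,
      ← ENNReal.ofReal_mul (by positivity)]
    apply ENNReal.ofReal_le_ofReal
    -- The rate `¼` is chosen so that the square still decays after multiplication by `e^{-t}`.
    have e1 : ‖w₀‖ + t * (ε * ‖w₁‖) ≤ m * (4 * Real.exp (1 / 4 * t)) := by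
      have h2 := Real.add_one_le_exp (1 / 4 * t)
      have h3 : ε * ‖w₁‖ ≤ ‖w₁‖ := mul_le_of_le_one_left (norm_nonneg _) hε1
      calc ‖w₀‖ + t * (ε * ‖w₁‖) ≤ m * (1 + t) := by
            nlinarith [norm_nonneg w₀, norm_nonneg w₁, mul_nonneg ht.le (norm_nonneg w₀)]
        _ ≤ _ := by gcongr; linarith
    have e2 : Real.exp (1 / 4 * t) ^ 2 = Real.exp (1 / 2 * t) := by
      rw [← Real.exp_nat_mul]; push_cast; ring_nf
    calc 2 * (‖w₀‖ + t * (ε * ‖w₁‖)) ^ 2 ≤ 2 * (m * (4 * Real.exp (1 / 4 * t))) ^ 2 := by gcongr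
      _ = 32 * m ^ 2 * Real.exp (1 / 4 * t) ^ 2 := by ring
      _ = _ := by rw [e2]
  refine h1.trans ?_
  rw [avg_zero_eq]
  simp only [mul_add]
  have hmeas : Measurable fun t : ℝ => ENNReal.ofReal (Real.exp (-t)) *
      (ENNReal.ofReal (32 * m ^ 2) * ENNReal.ofReal (Real.exp (1 / 2 * t))) := by fun_prop
  rw [lintegral_add_left hmeas]
  refine add_le_add (le_of_eq ?_) ?_
  · have e : ∀ t : ℝ, ENNReal.ofReal (Real.exp (-t)) *
        (ENNReal.ofReal (32 * m ^ 2) * ENNReal.ofReal (Real.exp (1 / 2 * t))) =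
        ENNReal.ofReal (32 * m ^ 2) * ENNReal.ofReal (Real.exp (-(1 / 2) * t)) := fun t => by
      rw [mul_left_comm, ← ENNReal.ofReal_mul (Real.exp_pos _).le, ← Real.exp_add]
      ring_nf
    simp only [e]
    rw [lintegral_const_mul' _ _ ENNReal.ofReal_ne_top, lintegral_exp_neg_mul (by norm_num),
      ← ENNReal.ofReal_mul (by positivity)]
    congr 1; ring
  · rw [← avg_zero_eq fun t => 2 * (∫⁻ s in Ioc 0 t, ∫⁻ r in Ioc 0 s, ENNReal.ofReal ‖u.d2 r‖) ^ 2,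
      avg_const_mul (by norm_num)]
    have e : ENNReal.ofReal 64 = 2 * (4 * (4 * 2)) := by norm_num
    calc _ ≤ 2 * (4 * (4 * avg (fun t => ENNReal.ofReal ‖u.d2 t‖ ^ 2) 0)) := by
          gcongr
          exact (avg_sq_lintegral_le measurable_lintegral_Ioc.aemeasurable).trans
            (mul_le_mul_right (avg_sq_lintegral_le hd2) _)
      _ ≤ 2 * (4 * (4 * (ENNReal.ofReal (2 * ε ^ 2) * posPart W G ε u))) := by
          gcongr; exact avg_sq_d2_le hε
      _ ≤ 2 * (4 * (4 * (2 * posPart W G ε u))) := by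
          gcongr
          rw [← ENNReal.ofReal_ofNat 2]
          apply ENNReal.ofReal_le_ofReal
          nlinarith
      _ = _ := by rw [e]; ring

/-- Young's inequality with coefficient `1/128`, which turns the constant `64` of `avg_sq_toFun_le`
into `½`: the source costs at most half of the functional and can be absorbed. -/
theorem ofReal_abs_source_le (hε : 0 < ε) (hε1 : ε ≤ 1) (hφ : IsSource f ε tε φ)
    (hu : HasInitialData ε w₀ w₁ u) :
    ENNReal.ofReal |source φ u| ≤ ENNReal.ofReal (32 + (‖w₀‖ + ‖w₁‖) ^ 2) +
      ENNReal.ofReal (1 / 2) * posPart W G ε u := by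
  have hsq := aemeasurable_sqNorm hφ
  have hm : AEMeasurable (fun t => ENNReal.ofReal (Real.exp (-t)) *
      (ENNReal.ofReal 32 * sqNorm φ t)) (volume.restrict (Ioi 0)) :=
    (by fun_prop : Measurable fun t : ℝ => ENNReal.ofReal (Real.exp (-t))).aemeasurable.mul
      (hsq.const_mul _)
  calc ENNReal.ofReal |source φ u|
      ≤ ∫⁻ t in Ioi (0 : ℝ), ENNReal.ofReal ‖Real.exp (-t) * inner ℝ (φ t) (u.toFun t)‖ := by
        rw [← Real.norm_eq_abs, source]
        simp only [ofReal_norm]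
        exact enorm_integral_le_lintegral_enorm _
    _ ≤ ∫⁻ t in Ioi (0 : ℝ), (ENNReal.ofReal (Real.exp (-t)) * (ENNReal.ofReal 32 * sqNorm φ t) +
        ENNReal.ofReal (1 / 128) *
          (ENNReal.ofReal (Real.exp (-t)) * ENNReal.ofReal ‖u.toFun t‖ ^ 2)) := by
        refine lintegral_mono fun t => ?_
        rw [sqNorm, ← ENNReal.ofReal_pow (norm_nonneg _), ← ENNReal.ofReal_mul (by norm_num),
          ← ENNReal.ofReal_mul (Real.exp_pos _).le, ← ENNReal.ofReal_mul (Real.exp_pos _).le,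
          ← ENNReal.ofReal_mul (by norm_num), ← ENNReal.ofReal_add (by positivity) (by positivity)]
        apply ENNReal.ofReal_le_ofReal
        rw [norm_mul, Real.norm_of_nonneg (Real.exp_pos _).le]
        have h1 := norm_inner_le_norm (𝕜 := ℝ) (φ t) (u.toFun t)
        have h2 : ‖φ t‖ * ‖u.toFun t‖ ≤ 32 * ‖φ t‖ ^ 2 + 1 / 128 * ‖u.toFun t‖ ^ 2 := by
          nlinarith [sq_nonneg (64 * ‖φ t‖ - ‖u.toFun t‖)]
        have := mul_le_mul_of_nonneg_left (h1.trans h2) (Real.exp_pos (-t)).le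
        linarith
    _ = ENNReal.ofReal 32 * (∫⁻ t in Ioi (0 : ℝ), ENNReal.ofReal (Real.exp (-t) * ‖φ t‖ ^ 2)) +
        ENNReal.ofReal (1 / 128) * avg (fun t => ENNReal.ofReal ‖u.toFun t‖ ^ 2) 0 := by
        rw [lintegral_add_left' hm, lintegral_const_mul' (ENNReal.ofReal (1 / 128)) _
          ENNReal.ofReal_ne_top, avg_zero_eq]
        congr 1
        rw [← lintegral_const_mul' _ _ ENNReal.ofReal_ne_top]
        refine lintegral_congr fun t => ?_
        rw [sqNorm, ENNReal.ofReal_mul (Real.exp_pos _).le, mul_left_comm]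
    _ ≤ ENNReal.ofReal 32 * ENNReal.ofReal (ε ^ 2) + ENNReal.ofReal (1 / 128) *
        (ENNReal.ofReal (64 * (‖w₀‖ + ‖w₁‖) ^ 2) + ENNReal.ofReal 64 * posPart W G ε u) := by
        gcongr
        · exact hφ.norm_le
        · exact avg_sq_toFun_le hε hε1 hu
    _ ≤ _ := by
        rw [mul_add, ← mul_assoc, ← ENNReal.ofReal_mul (by norm_num), ← ENNReal.ofReal_mul
          (by norm_num), ← ENNReal.ofReal_mul (by norm_num), ← add_assoc, ← ENNReal.ofReal_add
          (by positivity) (by positivity)]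
        refine add_le_add (ENNReal.ofReal_le_ofReal ?_) (mul_le_mul_left
          (ENNReal.ofReal_le_ofReal (by norm_num)) _)
        nlinarith [sq_nonneg (‖w₀‖ + ‖w₁‖)]

/-- The level estimate: the minimal value of the nonnegative part is controlled by that of any
competitor. -/
theorem posPart_minimizer_le (hε : 0 < ε) (hε1 : ε ≤ 1) (hφ : IsSource f ε tε φ)
    (hu : IsMinimizer W G w₀ w₁ φ ε u) {v : H2loc (L2 n)} (hv : HasInitialData ε w₀ w₁ v) {Q : ℝ}
    (hQ : 0 ≤ Q) (hvQ : posPart W G ε v ≤ ENNReal.ofReal Q) :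
    posPart W G ε u ≤ ENNReal.ofReal (3 * Q + 128 + 4 * (‖w₀‖ + ‖w₁‖) ^ 2) := by
  have hvfin := ne_top_of_le_ne_top ENNReal.ofReal_ne_top hvQ
  obtain ⟨hfin, hle⟩ := toReal_posPart_sub_source_le hu hv hvfin
  have key : ∀ z : H2loc (L2 n), HasInitialData ε w₀ w₁ z → posPart W G ε z ≠ ⊤ →
      |source φ z| ≤ 32 + (‖w₀‖ + ‖w₁‖) ^ 2 + 1 / 2 * (posPart W G ε z).toReal := by
    intro z hz hzfin
    have h := ofReal_abs_source_le (W := W) (G := G) hε hε1 hφ hz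
    rw [← ENNReal.ofReal_toReal hzfin, ← ENNReal.ofReal_mul (by norm_num), ← ENNReal.ofReal_add
      (by positivity) (by positivity)] at h
    exact (ENNReal.ofReal_le_ofReal_iff (by positivity)).1 h
  have hu' := key u hu.1 hfin
  have hv' := key v hv hvfin
  have hvQ' : (posPart W G ε v).toReal ≤ Q := ENNReal.toReal_le_of_le_ofReal hQ hvQ
  rw [ENNReal.le_ofReal_iff_toReal_le hfin (by positivity)]
  linarith [le_abs_self (source φ u), neg_abs_le (source φ v)]

theorem IsMinimizerFamily.exists_posPart_le {tε : ℝ → ℝ} {φ : ℝ → ℝ → L2 n}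
    {u : ℝ → H2loc (L2 n)} (h : IsMinimizerFamily W G w₀ w₁ f tε φ u) :
    ∃ Q, 0 ≤ Q ∧ ∀ ε ∈ Ioo (0 : ℝ) 1, posPart W G ε (u ε) ≤ ENNReal.ofReal Q := by
  obtain ⟨Q, hQ, hle⟩ := exists_posPart_affine_le h.potential h.dissipation h.w₀_mem h.w₁_mem_W
    h.w₁_mem_G
  exact ⟨_, by positivity, fun ε hε => posPart_minimizer_le hε.1 hε.2.le (h.isSource ε hε)
    (h.isMinimizer ε hε) (hasInitialData_affine ε w₀ w₁) hQ (hle ε hε)⟩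

theorem IsMinimizerFamily.regularMinimizer {tε : ℝ → ℝ} {φ : ℝ → ℝ → L2 n}
    {u : ℝ → H2loc (L2 n)} (h : IsMinimizerFamily W G w₀ w₁ f tε φ u) {ε : ℝ}
    (hε : ε ∈ Ioo (0 : ℝ) 1) : RegularMinimizer W G w₀ w₁ f ε (tε ε) (φ ε) (u ε) where
  pos := hε.1
  homog c hc v := h.dissipation.smul hc v
  measW := aemeasurable_comp_toFun h.potential.1.lowerSemicontinuous _
  measG := aemeasurable_comp_d1 h.dissipation.lowerSemicontinuous _
  isSource := h.isSource ε hε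
  isMinimizer := h.isMinimizer ε hε
  finite := by
    obtain ⟨Q, -, hQ⟩ := h.exists_posPart_le
    exact ne_top_of_le_ne_top ENNReal.ofReal_ne_top (hQ ε hε)

theorem gam_nonneg {f : ℝ → L2 n} {t : ℝ} (ht : 0 ≤ t) : 0 ≤ gam f t :=
  intervalIntegral.integral_nonneg ht fun s _ => by positivity

theorem gam_mono (hf : MemL2loc f) {s t : ℝ} (hs : 0 ≤ s) (hst : s ≤ t) : gam f s ≤ gam f t := by
  rw [gam, gam, intervalIntegral.integral_of_le hs, intervalIntegral.integral_of_le (hs.trans hst)]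
  exact setIntegral_mono_set ((hf t).integrable_norm_pow (by norm_num))
    (Eventually.of_forall fun s => by positivity) (Ioc_subset_Ioc_right hst).eventuallyLE

/-- A substitute for `IsSource.avg_le` that does not involve `t_ε`: on the support of `φ` one has
`e^{-s} kerTwo ≤ 1 ≤ e^{Tstar} e^{-s}`. -/
theorem lintegral_avg2_sqNorm_le (hφ : IsSource f ε tε φ) {Tstar t : ℝ} (ht : 0 ≤ t)
    (hsupp : ∀ s, Tstar < s → φ s = 0) :
    ∫⁻ s in Ioc 0 t, avg2 (sqNorm φ) s ≤ ENNReal.ofReal (Real.exp Tstar * ε ^ 2) := by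
  rw [lintegral_avg2 ht (aemeasurable_sqNorm hφ), ENNReal.ofReal_mul (Real.exp_pos _).le]
  refine le_trans ?_ (mul_le_mul_right hφ.norm_le _)
  rw [← lintegral_const_mul' _ _ ENNReal.ofReal_ne_top]
  refine setLIntegral_mono' measurableSet_Ioi fun s (hs : 0 < s) => ?_
  rw [sqNorm, ← ENNReal.ofReal_mul (mul_nonneg (Real.exp_pos _).le (kerTwo_nonneg ht s)),
    ← ENNReal.ofReal_mul (Real.exp_pos _).le]
  apply ENNReal.ofReal_le_ofReal
  rcases le_or_gt s Tstar with h | h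
  · rw [← mul_assoc, ← Real.exp_add]
    gcongr
    exact (exp_neg_mul_kerTwo_le hs.le).trans (Real.one_le_exp (by linarith))
  · simp [hsupp s h]

/-- The shift `t_ε` is controlled only near `ε = 0`. For `ε ≥ ε₀` the supports of all sources lie in
the fixed interval `[0, ε₀^{-3/2}]`, and the bound on the weighted norm of `φ` is used instead. -/
theorem IsMinimizerFamily.exists_source_le {tε : ℝ → ℝ} {φ : ℝ → ℝ → L2 n}
    {u : ℝ → H2loc (L2 n)} (h : IsMinimizerFamily W G w₀ w₁ f tε φ u) {T : ℝ} (hT : 0 ≤ T) :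
    ∃ M, 0 ≤ M ∧ ∀ ε ∈ Ioo (0 : ℝ) 1,
      ENNReal.ofReal ε * ∫⁻ s in Ioc 0 (T / ε), avg2 (sqNorm (φ ε)) s ≤ ENNReal.ofReal M := by
  obtain ⟨ε₀, hε₀, hsmall⟩ : ∃ ε₀ > 0, ∀ ε ∈ Ioo (0 : ℝ) ε₀, tε ε < 1 := by
    have := h.shift_tendsto.eventually (gt_mem_nhds one_pos)
    obtain ⟨ε₀, hε₀, hsub⟩ := mem_nhdsGT_iff_exists_Ioo_subset.1 this
    exact ⟨ε₀, hε₀, fun ε hε => hsub hε⟩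
  refine ⟨gam f (T + 1) + 1 + Real.exp (ε₀ ^ (-(3 / 2) : ℝ)), ?_, fun ε hε => ?_⟩
  · have := gam_nonneg (f := f) (show 0 ≤ T + 1 by linarith)
    positivity
  have hT1 := gam_nonneg (f := f) (show 0 ≤ T + 1 by linarith)
  have hsq : ε ^ 2 ≤ 1 := pow_le_one₀ hε.1.le hε.2.le
  rcases lt_or_ge ε ε₀ with hlt | hge
  · refine ((h.isSource ε hε).avg_le (T / ε) (div_nonneg hT hε.1.le)).trans
      (ENNReal.ofReal_le_ofReal ?_)
    rw [mul_div_cancel₀ _ hε.1.ne']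
    have h1 := hsmall ε ⟨hε.1, hlt⟩
    have h2 := h.shift_pos ε hε
    have h3 := gam_mono h.f_mem (show 0 ≤ T + tε ε by linarith) (show T + tε ε ≤ T + 1 by linarith)
    linarith [Real.exp_pos (ε₀ ^ (-(3 / 2) : ℝ))]
  · obtain ⟨Tstar, -, hTs, hsupp⟩ := (h.isSource ε hε).supp
    refine (mul_le_mul_right (lintegral_avg2_sqNorm_le (h.isSource ε hε)
      (div_nonneg hT hε.1.le) hsupp) _).trans ?_
    rw [← ENNReal.ofReal_mul hε.1.le]
    apply ENNReal.ofReal_le_ofReal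
    have h1 : Tstar ≤ ε₀ ^ (-(3 / 2) : ℝ) :=
      hTs.trans (Real.rpow_le_rpow_of_nonpos hε₀ hge (by norm_num))
    have h2 := Real.exp_le_exp.2 h1
    have h3 := Real.exp_pos Tstar
    calc ε * (Real.exp Tstar * ε ^ 2) ≤ 1 * (Real.exp Tstar * 1) := by
          gcongr; exact hε.2.le
      _ ≤ _ := by linarith

/-- On `(0,1]` the velocity is of order `ε`, by the initial datum and the bound on `u''`. This
compensates for `∫ 𝒜²‖φ‖²` being only of order `1/ε`. -/
theorem sourceBound_one_le (hε : 0 < ε) (hε1 : ε ≤ 1)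
    (hu : HasInitialData ε w₀ w₁ u) {Q M : ℝ} (hQ : 0 ≤ Q) (hM : 0 ≤ M)
    (hX : posPart W G ε u ≤ ENNReal.ofReal Q)
    (hP : ENNReal.ofReal ε * ∫⁻ s in Ioc 0 1, avg2 (sqNorm φ) s ≤ ENNReal.ofReal M) :
    sourceBound ε φ u 1 ≤
      ENNReal.ofReal ((‖w₁‖ + √(2 * Real.exp 1 * Q)) * (1 + M) + 4 * M) := by
  set B := ‖w₁‖ + √(2 * Real.exp 1 * Q) with hB
  have hB0 : 0 ≤ B := by positivity
  have hP' := lintegral_avg2_le hε hP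
  have hd2 : AEMeasurable (fun t => ENNReal.ofReal ‖u.d2 t‖) (volume.restrict (Ioc 0 1)) :=
    u.aestronglyMeasurable_d2.norm.aemeasurable.ennreal_ofReal.mono_measure
      (Measure.restrict_mono Ioc_subset_Ioi_self le_rfl)
  have h1 : ∫⁻ r in Ioc 0 1, ENNReal.ofReal ‖u.d2 r‖ ≤
      ENNReal.ofReal (ε * √(2 * Real.exp 1 * Q)) := by
    have hcs := sq_lintegral_mul_le (volume.restrict (Ioc (0 : ℝ) 1))
      (aemeasurable_const (b := (1 : ℝ≥0∞))) hd2
    simp only [one_mul, one_pow, lintegral_const, Measure.restrict_apply_univ, Real.volume_Ioc,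
      sub_zero, ENNReal.ofReal_one] at hcs
    have h2 : ∫⁻ r in Ioc 0 1, ENNReal.ofReal ‖u.d2 r‖ ^ 2 ≤
        ENNReal.ofReal (Real.exp 1) * avg (fun t => ENNReal.ofReal ‖u.d2 t‖ ^ 2) 0 := by
      rw [avg_zero_eq, ← lintegral_const_mul' _ _ ENNReal.ofReal_ne_top]
      refine (setLIntegral_mono' measurableSet_Ioc fun r hr => ?_).trans
        (lintegral_mono_set (Ioc_subset_Ioi_self : Ioc (0 : ℝ) 1 ⊆ Ioi 0))
      rw [← mul_assoc, ← ENNReal.ofReal_mul (Real.exp_pos _).le, ← Real.exp_add]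
      refine le_mul_of_one_le_left' ?_
      rw [ENNReal.one_le_ofReal]
      exact Real.one_le_exp (by linarith [hr.2])
    have h3 : (∫⁻ r in Ioc 0 1, ENNReal.ofReal ‖u.d2 r‖) ^ 2 ≤
        ENNReal.ofReal (ε * √(2 * Real.exp 1 * Q)) ^ 2 := by
      refine hcs.trans (h2.trans ((mul_le_mul_right ((avg_sq_d2_le (W := W) (G := G) hε).trans
        (mul_le_mul_right hX _)) _).trans (le_of_eq ?_)))
      rw [← ENNReal.ofReal_mul (by positivity), ← ENNReal.ofReal_mul (by positivity),
        ← ENNReal.ofReal_pow (by positivity), mul_pow, Real.sq_sqrt (by positivity)]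
      ring_nf
    exact (ENNReal.pow_right_strictMono two_ne_zero).le_iff_le.1 h3
  have hd1 : ∀ s ∈ Ioc (0 : ℝ) 1, ENNReal.ofReal ‖u.d1 s‖ ≤ ENNReal.ofReal (ε * B) := by
    intro s hs
    refine (ofReal_norm_d1_le u le_rfl hs.1.le).trans ?_
    rw [hu.2, norm_smul, Real.norm_of_nonneg hε.le, hB, mul_add, ENNReal.ofReal_add (by positivity)
      (by positivity)]
    gcongr
    exact (lintegral_mono_set (Ioc_subset_Ioc_right hs.2)).trans h1
  have hsqrt : ∀ p : ℝ≥0∞, ENNReal.ofReal ε * p ^ (1 / 2 : ℝ) ≤ 1 + ENNReal.ofReal ε * p := by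
    intro p
    have hε' : ENNReal.ofReal ε ≤ 1 := ENNReal.ofReal_le_one.2 hε1
    rcases le_total p 1 with hp | hp
    · refine le_add_right (mul_le_one' hε' (ENNReal.rpow_le_one hp (by norm_num)))
    · refine le_add_left (mul_le_mul_right ?_ _)
      simpa using ENNReal.rpow_le_rpow_of_exponent_le hp (show (1 / 2 : ℝ) ≤ 1 by norm_num)
  rw [sourceBound, ENNReal.ofReal_add (by positivity) (by positivity)]
  refine add_le_add ?_ ?_
  · calc _ ≤ ∫⁻ s in Ioc 0 1, ENNReal.ofReal B * (1 + ENNReal.ofReal ε * avg2 (sqNorm φ) s) := by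
          refine setLIntegral_mono' measurableSet_Ioc fun s hs => ?_
          calc _ ≤ ENNReal.ofReal (ε * B) * avg2 (sqNorm φ) s ^ (1 / 2 : ℝ) := by
                exact mul_le_mul_left (hd1 s hs) _
            _ = ENNReal.ofReal B * (ENNReal.ofReal ε * avg2 (sqNorm φ) s ^ (1 / 2 : ℝ)) := by
                rw [mul_comm ε, ENNReal.ofReal_mul hB0, mul_assoc]
            _ ≤ _ := by gcongr; exact hsqrt _
      _ = ENNReal.ofReal B * (1 + ENNReal.ofReal ε * ∫⁻ s in Ioc 0 1, avg2 (sqNorm φ) s) := by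
          rw [lintegral_const_mul' _ _ ENNReal.ofReal_ne_top, lintegral_add_left' aemeasurable_const,
            lintegral_const_mul' _ _ ENNReal.ofReal_ne_top]
          simp
      _ ≤ _ := by
          rw [ENNReal.ofReal_mul hB0, ENNReal.ofReal_add zero_le_one hM, ENNReal.ofReal_one]
          gcongr
  · refine (mul_le_mul_right hP' _).trans ?_
    rw [← ENNReal.ofReal_mul (by positivity)]
    apply ENNReal.ofReal_le_ofReal
    have e : 4 * ε ^ 2 * (M / ε) = 4 * M * ε := by field_simp
    rw [e]
    exact mul_le_of_le_one_right (by positivity) hε1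

theorem IsMinimizerFamily.exists_Lam_le {tε : ℝ → ℝ} {φ : ℝ → ℝ → L2 n}
    {u : ℝ → H2loc (L2 n)} (h : IsMinimizerFamily W G w₀ w₁ f tε φ u) :
    ∃ L, 0 ≤ L ∧ ∀ ε ∈ Ioo (0 : ℝ) 1, Lam W G ε (u ε) ≤ ENNReal.ofReal L := by
  obtain ⟨Q, hQ, hX⟩ := h.exists_posPart_le
  obtain ⟨M, hM, hP⟩ := h.exists_source_le zero_le_one
  refine ⟨‖w₁‖ ^ 2 + (Real.exp 1 + 4) * Q +
    ((‖w₁‖ + √(2 * Real.exp 1 * Q)) * (1 + M) + 4 * M), by positivity, fun ε hε => ?_⟩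
  have hr := h.regularMinimizer hε
  have hε0 := hε.1
  have h1 : ENNReal.ofReal ε * ∫⁻ s in Ioc 0 1, avg2 (sqNorm (φ ε)) s ≤ ENNReal.ofReal M := by
    refine le_trans (mul_le_mul_right (lintegral_mono_set (Ioc_subset_Ioc_right ?_)) _) (hP ε hε)
    rw [le_div_iff₀ hε.1, one_mul]
    exact hε.2.le
  have hs := sourceBound_one_le hε.1 hε.2.le (h.isMinimizer ε hε).1 hQ hM
    (hX ε hε) h1
  refine hr.Lam_le.trans ?_
  have hQ' : 0 ≤ (Real.exp 1 + 4) * Q := by positivity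
  have hB : 0 ≤ (‖w₁‖ + √(2 * Real.exp 1 * Q)) * (1 + M) + 4 * M := by positivity
  rw [ENNReal.ofReal_add (add_nonneg (sq_nonneg ‖w₁‖) hQ') hB,
    ENNReal.ofReal_add (sq_nonneg ‖w₁‖) hQ']
  refine add_le_add (add_le_add (le_of_eq ?_) ?_) hs
  · rw [(h.isMinimizer ε hε).1.2, norm_smul, Real.norm_of_nonneg hε.1.le, two_mul_ofReal]
    congr 1
    field_simp
  · rw [ENNReal.ofReal_mul (by positivity)]
    exact mul_le_mul_right (hX ε hε) _

end LevelEstimate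
-- The two energy estimates
section Main
variable {n : ℕ} {W G : L2 n → ℝ≥0∞} {w₀ w₁ : L2 n} {f : ℝ → L2 n} {tε : ℝ → ℝ}
  {φ : ℝ → ℝ → L2 n} {u : ℝ → H2loc (L2 n)}

namespace IsMinimizerFamily

theorem Lam_ne_top (h : IsMinimizerFamily W G w₀ w₁ f tε φ u) {ε : ℝ} (hε : ε ∈ Ioo (0 : ℝ) 1) :
    Lam W G ε (u ε) ≠ ⊤ := by
  obtain ⟨L, -, hL⟩ := h.exists_Lam_le
  exact ne_top_of_le_ne_top ENNReal.ofReal_ne_top (hL ε hε)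

theorem energyD_add_le (h : IsMinimizerFamily W G w₀ w₁ f tε φ u) {T : ℝ} (hT : 0 ≤ T) {ε : ℝ}
    (hε : ε ∈ Ioo (0 : ℝ) 1) {c : ℝ≥0∞} (hc : energyD W G ε (u ε) 0 + c ≠ ⊤) {β : ℝ}
    (hβ : 1 ≤ β) :
    energyD W G ε (u ε) (T / ε) + c ≤ ENNReal.ofReal
      ((√(energyD W G ε (u ε) 0 + c).toReal +
        (√(ε * 4) + √(T * β / 2)) * √(gam f (T + tε ε) + ε ^ 2)) ^ 2) := by
  have hP := (h.isSource ε hε).avg_le (T / ε) (div_nonneg hT hε.1.le)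
  rw [mul_div_cancel₀ _ hε.1.ne'] at hP
  have hM : 0 ≤ gam f (T + tε ε) + ε ^ 2 := by
    have := gam_nonneg (f := f) (add_nonneg hT (h.shift_pos ε hε).le)
    positivity
  have := (h.regularMinimizer hε).energyD_add_le (div_nonneg hT hε.1.le) hM hP hc
  rw [mul_div_cancel₀ _ hε.1.ne'] at this
  refine this.trans (ENNReal.ofReal_le_ofReal ?_)
  gcongr
  nlinarith

theorem sqrt_energyD_le (h : IsMinimizerFamily W G w₀ w₁ f tε φ u) {T : ℝ} (hT : 0 ≤ T) {ε : ℝ}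
    (hε : ε ∈ Ioo (0 : ℝ) 1) {β : ℝ} (hβ : 1 ≤ β) :
    energyD W G ε (u ε) (T / ε) ≠ ⊤ ∧
      √(energyD W G ε (u ε) (T / ε)).toReal ≤ √(energyD W G ε (u ε) 0).toReal +
        (√(ε * 4) + √(T * β / 2)) * √(gam f (T + tε ε) + ε ^ 2) := by
  have h0 : energyD W G ε (u ε) 0 + 0 ≠ ⊤ := by
    rw [add_zero]
    exact ne_top_of_le_ne_top (h.Lam_ne_top hε) le_self_add
  have hle := h.energyD_add_le hT hε h0 hβ
  simp only [add_zero] at hle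
  refine ⟨ne_top_of_le_ne_top ENNReal.ofReal_ne_top hle, ?_⟩
  exact Real.sqrt_le_iff.2 ⟨by positivity, ENNReal.toReal_le_of_le_ofReal (by positivity) hle⟩

theorem energyC_add_le (h : IsMinimizerFamily W G w₀ w₁ f tε φ u) {T : ℝ} (hT : 0 ≤ T) {ε : ℝ}
    (hε : ε ∈ Ioo (0 : ℝ) 1) {β : ℝ} (hβ : 1 ≤ β) :
    energyC W G ε (u ε) (T / ε) ≠ ⊤ ∧
      (energyC W G ε (u ε) (T / ε)).toReal ≤ (√(Lam W G ε (u ε)).toReal +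
        (√(ε * 4) + √(T * β / 2)) * √(gam f (T + tε ε) + ε ^ 2)) ^ 2 := by
  have hle := ((h.regularMinimizer hε).energyC_le (div_nonneg hT hε.1.le)).trans
    (h.energyD_add_le hT hε (h.Lam_ne_top hε) hβ)
  exact ⟨ne_top_of_le_ne_top ENNReal.ofReal_ne_top hle,
    ENNReal.toReal_le_of_le_ofReal (by positivity) hle⟩

theorem exists_energy_le (h : IsMinimizerFamily W G w₀ w₁ f tε φ u) {T : ℝ} (hT : 0 ≤ T) :
    ∃ C : ℝ, ∀ ε ∈ Ioo (0 : ℝ) 1, ∀ t ∈ Icc (0 : ℝ) T,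
      energyD W G ε (u ε) (t / ε) ≤ ENNReal.ofReal C ∧
        energyC W G ε (u ε) (t / ε) ≤ ENNReal.ofReal C := by
  obtain ⟨L, hL, hLam⟩ := h.exists_Lam_le
  obtain ⟨M, hM, hP⟩ := h.exists_source_le hT
  refine ⟨(√L + (√4 + √(T / 2)) * √M) ^ 2, fun ε hε t ht => ?_⟩
  have hr := h.regularMinimizer hε
  have ht0 : 0 ≤ t / ε := div_nonneg ht.1 hε.1.le
  have hPt : ENNReal.ofReal ε * ∫⁻ s in Ioc 0 (t / ε), avg2 (sqNorm (φ ε)) s ≤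
      ENNReal.ofReal M := by
    refine le_trans (mul_le_mul_right (lintegral_mono_set (Ioc_subset_Ioc_right ?_)) _) (hP ε hε)
    exact div_le_div_of_nonneg_right ht.2 hε.1.le
  -- With `c = Λ - E^d(0)` a single bound dominates both energies.
  have hE := hr.energyD_add_le ht0 hM hPt (h.Lam_ne_top hε)
  have hLε : (Lam W G ε (u ε)).toReal ≤ L := ENNReal.toReal_le_of_le_ofReal hL (hLam ε hε)
  rw [mul_div_cancel₀ _ hε.1.ne'] at hE
  have hC : ENNReal.ofReal ((√(Lam W G ε (u ε)).toReal + (√(ε * 4) + √(t / 2)) * √M) ^ 2) ≤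
      ENNReal.ofReal ((√L + (√4 + √(T / 2)) * √M) ^ 2) := by
    apply ENNReal.ofReal_le_ofReal
    gcongr
    · linarith [hε.2]
    · exact ht.2
  exact ⟨(le_self_add.trans hE).trans hC, ((hr.energyC_le ht0).trans hE).trans hC⟩

end IsMinimizerFamily
end Main
end DeGiorgi

theorem proposition5p3 :
    (∀ β : ℝ, 1 < β → ∃ Cβ : ℝ, 0 < Cβ ∧
      ∀ (n : ℕ) (W G : DeGiorgi.L2 n → ℝ≥0∞) (w₀ w₁ : DeGiorgi.L2 n) (f : ℝ → DeGiorgi.L2 n)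
        (tε : ℝ → ℝ) (φ : ℝ → ℝ → DeGiorgi.L2 n) (u : ℝ → DeGiorgi.H2loc (DeGiorgi.L2 n)),
        DeGiorgi.IsMinimizerFamily W G w₀ w₁ f tε φ u →
        ∀ T : ℝ, 0 ≤ T → ∀ ε ∈ Ioo (0 : ℝ) 1,
          (DeGiorgi.energyD W G ε (u ε) (T / ε) ≠ ⊤ ∧
            √(DeGiorgi.energyD W G ε (u ε) (T / ε)).toReal
              ≤ √(DeGiorgi.energyD W G ε (u ε) 0).toReal
                + (√(ε * Cβ) + √(T * β / 2)) * √(DeGiorgi.gam f (T + tε ε) + ε ^ 2)) ∧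
          (DeGiorgi.energyC W G ε (u ε) (T / ε) ≠ ⊤ ∧ DeGiorgi.Lam W G ε (u ε) ≠ ⊤ ∧
            (DeGiorgi.energyC W G ε (u ε) (T / ε)).toReal
              ≤ (√(DeGiorgi.Lam W G ε (u ε)).toReal
                + (√(ε * Cβ) + √(T * β / 2)) * √(DeGiorgi.gam f (T + tε ε) + ε ^ 2)) ^ 2)) ∧
    (∀ (n : ℕ) (W G : DeGiorgi.L2 n → ℝ≥0∞) (w₀ w₁ : DeGiorgi.L2 n) (f : ℝ → DeGiorgi.L2 n)
        (tε : ℝ → ℝ) (φ : ℝ → ℝ → DeGiorgi.L2 n) (u : ℝ → DeGiorgi.H2loc (DeGiorgi.L2 n)),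
        DeGiorgi.IsMinimizerFamily W G w₀ w₁ f tε φ u →
        ∀ T : ℝ, 0 ≤ T → ∃ CT : ℝ, ∀ ε ∈ Ioo (0 : ℝ) 1, ∀ t ∈ Icc (0 : ℝ) T,
          DeGiorgi.energyD W G ε (u ε) (t / ε) ≤ ENNReal.ofReal CT ∧
          DeGiorgi.energyC W G ε (u ε) (t / ε) ≤ ENNReal.ofReal CT) := by
  -- `4` is the constant in the term `4ε²‖φ‖²` of Young's inequality; it serves for all `β ≥ 1`, as
  -- `β` enters only through `T/2 ≤ Tβ/2`.
  refine ⟨fun β hβ => ⟨4, by norm_num, fun n W G w₀ w₁ f tε φ u h T hT ε hε => ?_⟩,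
    fun n W G w₀ w₁ f tε φ u h T hT => h.exists_energy_le hT⟩
  have hC := h.energyC_add_le hT hε hβ.le
  exact ⟨h.sqrt_energyD_le hT hε hβ.le, hC.1, h.Lam_ne_top hε, hC.2⟩
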